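/- Let $n$ be an integer with $1\le n\le 200$ and let $0.0001<\alpha<0.27$. Let $X$ be binomial with $n$ trials and success probability $p$, and write $P(X=x\mid p)=\binom nx p^x(1-p)^{n-x}$. LCC intervals. Intervals $(0,u_x)$, $x=0,\dots,n$, are upper-tail LCC (locally correct confidence) intervals with level $1-\alpha$ if $0<u_0<u_1<\dots<u_n=1$ and, for $i=1,\dots,n$, $$\frac1{u_i-u_{i-1}}\int_{u_{i-1}}^{u_i}C_u(p)\,dp\ \ge\ 1-\alpha,$$ where $C_u(p)=\sum_{x:\,p\le u_x}P(X=x\mid p)$ is the coverage probability, i.e. $C_u(p)=P(X\ge i\mid p)$ for $u_{i-1}<p\le u_i$. Intervals $(l_x,1)$, $x=0,\dots,n$, are lower-tail LCC intervals with level $1-\alpha$ if $0=l_0<l_1<\dots<l_n<1$ and, for $i=0,\dots,n-1$, $$\frac1{l_{i+1}-l_i}\int_{l_i}^{l_{i+1}}C_l(p)\,dp\ \ge\ 1-\alpha,$$ where $C_l(p)=\sum_{x:\,l_x<p}P(X=x\mid p)$, i.e. $C_l(p)=P(X\le i\mid p)$ for $l_i<p\le l_{i+1}$. Intervals $(l_x,u_x)$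 are equal-tail LCC intervals with level $1-2\alpha$ if $(l_x,1)$ and $(0,u_x)$ are lower-tail and upper-tail LCC intervals, respectively, each with level $1-\alpha$. OLC method. The optimal locally correct (OLC) upper endpoints are obtained from $u_n=1$ by choosing successively, for $i=n,\dots,1$, the point $u_{i-1}\in(0,u_i)$ with $\frac1{u_i-u_{i-1}}\int_{u_{i-1}}^{u_i}P(X\ge i\mid p)\,dp=1-\alpha$. The OLC lower endpoints are obtained from $l_0=0$ by choosing successively, for $i=0,\dots,n-1$, the point $l_{i+1}\in(l_i,1)$ with $\frac1{l_{i+1}-l_i}\int_{l_i}^{l_{i+1}}P(X\le i\mid p)\,dp=1-\alpha$. The OLC upper-tail, lower-tail and equal-tail intervals are $(0,u_x)$, $(l_x,1)$ and $(l_x,u_x)$. Average expected length. The average expected length (AEL) of intervals $(l_x,u_x)$, $x=0,\dots,n$, is $\int_0^1\sum_{x=0}^n(u_x-l_x)P(X=x\mid p)\,dp$, with $l_x=0$ for upper-tail and $u_x=1$ for lower-tail intervals. Then the OLC upper endpoints and the OLC lower endpoints exist and are unique, and: (i) the OLC upper-tail intervals are upper-tail LCC intervals with level $1-\alpha$, and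 their AEL is strictly smaller than that of any other upper-tail LCC intervals with level $1-\alpha$; likewise, the OLC lower-tail intervals are lower-tail LCC intervals with level $1-\alpha$, and their AEL is strictly smaller than that of any other lower-tail LCC intervals with level $1-\alpha$; (ii) the OLC equal-tail intervals are equal-tail LCC intervals with level $1-2\alpha$, and their AEL is strictly smaller than that of any other equal-tail LCC intervals with level $1-2\alpha$. -/

import Mathlib

open scoped BigOperators

noncomputable section

namespace BinomialInterval

/-- The probability `P(X = x | p)` of `x` successes for a binomial variate `X` based on `n` trials
with success probability `p`. -/
def binomialProb (n x : ℕ) (p : ℝ) : ℝ :=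
  (n.choose x : ℝ) * p ^ x * (1 - p) ^ (n - x)

/-- `P(X ≥ i | p)`. -/
def upperTail (n : ℕ) (i : Fin (n + 1)) (p : ℝ) : ℝ :=
  ∑ x ∈ Finset.Ici i, binomialProb n x p

/-- `P(X ≤ i | p)`. -/
def lowerTail (n : ℕ) (i : Fin (n + 1)) (p : ℝ) : ℝ :=
  ∑ x ∈ Finset.Iic i, binomialProb n x p

/-- The average of `f` over the interval from `a` to `b` (used for `a < b`). -/
def average (f : ℝ → ℝ) (a b : ℝ) : ℝ :=
  1 / (b - a) * ∫ p in a..b, f p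

/-- Coverage probability `C_u(p)` of the upper-tail intervals with upper endpoints `u 0, …, u n`:
the probability that the interval obtained from `X` contains `p`. The upper endpoint counts as
covered. -/
def upperCoverage (n : ℕ) (u : Fin (n + 1) → ℝ) (p : ℝ) : ℝ :=
  ∑ x : Fin (n + 1) with p ≤ u x, binomialProb n x p

/-- Coverage probability `C_l(p)` of the lower-tail intervals with lower endpoints `l 0, …, l n`:
the probability that the interval obtained from `X` contains `p`. The lower endpoint does not
count as covered. -/
def lowerCoverage (n : ℕ) (l : Fin (n + 1) → ℝ) (p : ℝ) : ℝ :=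
  ∑ x : Fin (n + 1) with l x < p, binomialProb n x p

/-- Between consecutive endpoints, `u (i-1) < p ≤ u i`, the coverage `C_u(p)` is `P(X ≥ i | p)`. -/
theorem upperCoverage_eq {n : ℕ} {u : Fin (n + 1) → ℝ} (hu : StrictMono u) (i : Fin n) {p : ℝ}
    (h₁ : u i.castSucc < p) (h₂ : p ≤ u i.succ) :
    upperCoverage n u p = upperTail n i.succ p := by
  unfold upperCoverage upperTail
  congr 1
  ext x
  simp only [Finset.mem_filter, Finset.mem_univ, true_and, Finset.mem_Ici]
  constructor
  · intro h
    exact Fin.castSucc_lt_iff_succ_le.mp (hu.lt_iff_lt.mp (h₁.trans_le h))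
  · intro h
    exact h₂.trans (hu.monotone h)

/-- Between consecutive endpoints, `l i < p ≤ l (i+1)`, the coverage `C_l(p)` is `P(X ≤ i | p)`. -/
theorem lowerCoverage_eq {n : ℕ} {l : Fin (n + 1) → ℝ} (hl : StrictMono l) (i : Fin n) {p : ℝ}
    (h₁ : l i.castSucc < p) (h₂ : p ≤ l i.succ) :
    lowerCoverage n l p = lowerTail n i.castSucc p := by
  unfold lowerCoverage lowerTail
  congr 1
  ext x
  simp only [Finset.mem_filter, Finset.mem_univ, true_and, Finset.mem_Iic]
  constructor
  · intro h
    exact Fin.le_castSucc_iff.mpr (hl.lt_iff_lt.mp (h.trans_le h₂))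
  · intro h
    exact (hl.monotone h).trans_lt h₁

/-- The upper-tail intervals `(0, u x)`, `x = 0, …, n`, are upper-tail locally correct confidence
intervals with confidence level `1 - α`. -/
structure IsUpperLCC (n : ℕ) (α : ℝ) (u : Fin (n + 1) → ℝ) : Prop where
  zero_lt : 0 < u 0
  strictMono : StrictMono u
  last_eq : u (Fin.last n) = 1
  average_ge : ∀ i : Fin n, 1 - α ≤ average (upperCoverage n u) (u i.castSucc) (u i.succ)

/-- The lower-tail intervals `(l x, 1)`, `x = 0, …, n`, are lower-tail locally correct confidence
intervals with confidence level `1 - α`. -/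
structure IsLowerLCC (n : ℕ) (α : ℝ) (l : Fin (n + 1) → ℝ) : Prop where
  zero_eq : l 0 = 0
  strictMono : StrictMono l
  last_lt : l (Fin.last n) < 1
  average_ge : ∀ i : Fin n, 1 - α ≤ average (lowerCoverage n l) (l i.castSucc) (l i.succ)

/-- The two-sided intervals `(l x, u x)`, `x = 0, …, n`, are equal-tail locally correct confidence
intervals with confidence level `1 - 2 * α`. -/
structure IsEqualTailLCC (n : ℕ) (α : ℝ) (l u : Fin (n + 1) → ℝ) : Prop where
  lower : IsLowerLCC n α l
  upper : IsUpperLCC n α u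

/-- `u 0, …, u n` are the upper endpoints produced by the optimal locally correct (OLC) method with
confidence level `1 - α`: `u n = 1`, and, going down from `i = n` to `i = 1`, the endpoint
`u (i-1)` is a point strictly between `0` and `u i` for which the average of `P(X ≥ i | p)` over
`(u (i-1), u i)` is exactly `1 - α`. (Here `i` is `i.succ` and `i - 1` is `i.castSucc`.) -/
structure IsUpperOLC (n : ℕ) (α : ℝ) (u : Fin (n + 1) → ℝ) : Prop where
  last_eq : u (Fin.last n) = 1
  zero_lt : ∀ i : Fin n, 0 < u i.castSucc
  lt_succ : ∀ i : Fin n, u i.castSucc < u i.succ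
  average_eq : ∀ i : Fin n, average (upperTail n i.succ) (u i.castSucc) (u i.succ) = 1 - α

/-- `l 0, …, l n` are the lower endpoints produced by the optimal locally correct (OLC) method with
confidence level `1 - α`: `l 0 = 0`, and, going up from `i = 0` to `i = n - 1`, the endpoint
`l (i+1)` is a point strictly between `l i` and `1` for which the average of `P(X ≤ i | p)` over
`(l i, l (i+1))` is exactly `1 - α`. -/
structure IsLowerOLC (n : ℕ) (α : ℝ) (l : Fin (n + 1) → ℝ) : Prop where
  zero_eq : l 0 = 0
  lt_succ : ∀ i : Fin n, l i.castSucc < l i.succ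
  lt_one : ∀ i : Fin n, l i.succ < 1
  average_eq : ∀ i : Fin n, average (lowerTail n i.castSucc) (l i.castSucc) (l i.succ) = 1 - α

/-- Expected length `L_n(p)` of the intervals `(l x, u x)`, `x = 0, …, n`. -/
def expectedLength (n : ℕ) (l u : Fin (n + 1) → ℝ) (p : ℝ) : ℝ :=
  ∑ x : Fin (n + 1), (u x - l x) * binomialProb n x p

/-- Average expected length (AEL) of the intervals `(l x, u x)`, `x = 0, …, n`. -/
def averageExpectedLength (n : ℕ) (l u : Fin (n + 1) → ℝ) : ℝ :=
  ∫ p in (0 : ℝ)..1, expectedLength n l u p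

/-- The average expected length of the upper-tail intervals `(0, u x)`. -/
def upperAEL (n : ℕ) (u : Fin (n + 1) → ℝ) : ℝ :=
  averageExpectedLength n (fun _ => 0) u

/-- The average expected length of the lower-tail intervals `(l x, 1)`. -/
def lowerAEL (n : ℕ) (l : Fin (n + 1) → ℝ) : ℝ :=
  averageExpectedLength n l (fun _ => 1)

end BinomialInterval

end

/-! Put `y = 1 - α`, so that `73 / 100 < y < 1`. Each binomial probability integrates to `1 / (n +
1)` over `[0, 1]`, so the average expected length is `(∑ u - ∑ l) / (n + 1)`: the two tails
decouple. The symmetry `p ↦ 1 - p`, `x ↦ n - x` turns lower end points into upper ones. It remains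
to construct the optimal sequence `u` and to show that its sum is smaller than that of any other
correct sequence `v`.

Let `F_i` be an antiderivative of `P(X ≥ i | p) - y` (`prim`). Correctness of `v` reads `F_i (v
(i-1)) ≤ F_i (v i)`, and `u` satisfies these with equality. `F_i` decreases up to the quantile
`c_i`, where `P(X ≥ i | c_i) = y`, and increases afterwards; this already gives uniqueness.

Minimality. Let `d i = v i - u i`. The shape of `F_i` shows that `d i ≤ 0` implies `d (i-1) ≥ 0`
(`le_of_prim_le`). The hard half is that `d i > 0` implies `d (i-1) + d i > 0`
(`add_lt_add_of_prim_le`). Both together make all sums of `d` from `m` to `n` nonnegative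
(`IsOptimal.sum_lt`). For the hard half, reflect about the midpoint of `u (i-1)` and `u i`, with `s`
their sum: `F_i p - F_i (s - p)` vanishes at `s / 2` and at `u i`, and a nonnegative value to the
right of `u i` has to be excluded. Its derivative is `reflSum - 2 y`. The monotonicity of `reflSum`
is governed by the sign of a log ratio of densities, whose derivative has a numerator affine in `p *
(s - p)`; few sign changes are therefore possible.

Existence. The invariant is `c_i < u i < c_{i+1}` (`Admissible`). A next point between `c_{i-1}` and
`c_i` exists as soon as `F_i c_{i+1} ≤ F_i c_{i-1}` (`Admissible.exists_next`). At these two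
quantiles `F_i` collapses to one binomial term each, and the inequality becomes a comparison of two
weights. Following the weights as functions of the order `y`, the comparison propagates from a
starting order of at most `73 / 100` to all larger orders (`rightWeight_le_leftWeight`). The
starting conditions are finitely many integer inequalities for `n ≤ 200`, evaluated in the kernel
(`hasStart`). The thresholds `n` and `1` lack one neighbouring quantile and are treated separately
(`prim_one_lt_prim`, `prim_lt_prim_last`); the threshold `n - 1` needs an extra estimate in the
minimality argument (`tail_mode_le_or_add_tail_lt`). -/

namespace BinomialInterval

/-! ### Binomial tails and their antiderivatives -/

/-- `P(X ≥ i | p)` with a natural-number threshold `i`. -/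
noncomputable def tail (n i : ℕ) (p : ℝ) : ℝ := ∑ x ∈ Finset.Icc i n, binomialProb n x p

/-- The derivative of `tail n i`. -/
noncomputable def tailDeriv (n i : ℕ) (p : ℝ) : ℝ :=
  i * (n.choose i : ℝ) * p ^ (i - 1) * (1 - p) ^ (n - i)

/-- An antiderivative of `tail n i - y`. -/
noncomputable def prim (n i : ℕ) (y p : ℝ) : ℝ :=
  (p - i / (n + 1)) * (tail n (i + 1) p - y) + (1 - i / (n + 1)) * (p * binomialProb n i p)

theorem tail_eq_add {n i : ℕ} (h : i ≤ n) (p : ℝ) :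
    tail n i p = binomialProb n i p + tail n (i + 1) p := by
  unfold tail
  rw [← Finset.insert_Icc_add_one_left_eq_Icc h, Finset.sum_insert (by simp)]

theorem tail_of_lt {n i : ℕ} (h : n < i) (p : ℝ) : tail n i p = 0 := by
  unfold tail; rw [Finset.Icc_eq_empty (by omega)]; simp

theorem tail_zero (n : ℕ) (p : ℝ) : tail n 0 p = 1 := by
  unfold tail binomialProb
  have := add_pow p (1 - p) n
  rw [add_sub_cancel, one_pow] at this
  conv_rhs => rw [this]
  rw [Finset.range_eq_Ico, Finset.Ico_add_one_right_eq_Icc]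
  exact Finset.sum_congr rfl fun x _ => by ring

theorem tail_at_zero {n i : ℕ} (hi : 1 ≤ i) : tail n i 0 = 0 := by
  unfold tail binomialProb
  refine Finset.sum_eq_zero fun x hx => ?_
  have : x ≠ 0 := by have := (Finset.mem_Icc.1 hx).1; omega
  simp [this]

theorem tail_at_one {n i : ℕ} (hi : i ≤ n) : tail n i 1 = 1 := by
  unfold tail binomialProb
  rw [Finset.sum_eq_single n]
  · simp
  · intro x hx hne
    have : n - x ≠ 0 := by have := (Finset.mem_Icc.1 hx).2; omega
    simp [this]
  · simp [hi]

theorem binomialProb_pos {n x : ℕ} (hx : x ≤ n) {p : ℝ} (h0 : 0 < p) (h1 : p < 1) :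
    0 < binomialProb n x p := by
  unfold binomialProb
  have : 0 < 1 - p := by linarith
  have := Nat.choose_pos hx
  positivity

theorem hasDerivAt_binomialProb (n x : ℕ) (p : ℝ) :
    HasDerivAt (binomialProb n x) (tailDeriv n x p - tailDeriv n (x + 1) p) p := by
  have h1 : HasDerivAt (fun p : ℝ => p ^ x) (x * p ^ (x - 1)) p := hasDerivAt_pow x p
  have h2 : HasDerivAt (fun p : ℝ => (1 - p) ^ (n - x))
      (((n - x : ℕ) : ℝ) * (1 - p) ^ (n - x - 1) * (-1)) p :=
    ((hasDerivAt_id p).const_sub 1).pow (n - x)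
  have h := (h1.const_mul (n.choose x : ℝ)).mul h2
  refine HasDerivAt.congr_deriv h ?_
  unfold tailDeriv
  have h3 : ((x + 1 : ℕ) : ℝ) * (n.choose (x + 1) : ℝ) = (n.choose x : ℝ) * ((n - x : ℕ) : ℝ) := by
    have := Nat.choose_succ_right_eq n x
    rw [mul_comm]
    exact_mod_cast this
  rw [h3, show n - (x + 1) = n - x - 1 by omega, Nat.add_sub_cancel]
  ring

/-- The derivative of each term is a difference of consecutive `tailDeriv`s, so the sum telescopes
from the top. -/
theorem hasDerivAt_tail (n : ℕ) {i : ℕ} (hi : 1 ≤ i) (p : ℝ) :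
    HasDerivAt (tail n i) (tailDeriv n i p) p := by
  by_cases h : n < i
  · have : tail n i = fun _ => 0 := funext fun p => tail_of_lt h p
    rw [this]
    simpa [tailDeriv, Nat.choose_eq_zero_of_lt h] using hasDerivAt_const p (0 : ℝ)
  · push Not at h
    induction h using Nat.decreasingInduction with
    | self =>
      have : tail n n = binomialProb n n := by
        funext p; rw [tail_eq_add le_rfl, tail_of_lt (Nat.lt_succ_self n), add_zero]
      rw [this]
      simpa [tailDeriv] using hasDerivAt_binomialProb n n p
    | of_succ k hk ih =>
      have : tail n k = fun p => binomialProb n k p + tail n (k + 1) p :=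
        funext fun p => tail_eq_add hk.le p
      rw [this]
      refine ((hasDerivAt_binomialProb n k p).add (ih (by omega))).congr_deriv (by ring)

theorem continuous_tail (n i : ℕ) : Continuous (tail n i) := by
  unfold tail binomialProb; fun_prop

theorem tailDeriv_pos {n i : ℕ} (hi : 1 ≤ i) (hn : i ≤ n) {p : ℝ} (h0 : 0 < p) (h1 : p < 1) :
    0 < tailDeriv n i p := by
  unfold tailDeriv
  have : 0 < 1 - p := by linarith
  have := Nat.choose_pos hn
  positivity

theorem strictMonoOn_tail {n i : ℕ} (hi : 1 ≤ i) (hn : i ≤ n) :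
    StrictMonoOn (tail n i) (Set.Icc 0 1) := by
  refine strictMonoOn_of_deriv_pos (convex_Icc 0 1) (continuous_tail n i).continuousOn ?_
  intro p hp
  rw [interior_Icc] at hp
  rw [(hasDerivAt_tail n hi p).deriv]
  exact tailDeriv_pos hi hn hp.1 hp.2

theorem binomialProb_succ_mul {n i : ℕ} (h : i + 1 ≤ n) (p : ℝ) :
    (i + 1) * ((1 - p) * binomialProb n (i + 1) p) = (n - i) * (p * binomialProb n i p) := by
  unfold binomialProb
  have h3 : (n.choose (i + 1) : ℝ) * ((i : ℝ) + 1) = (n.choose i : ℝ) * ((n : ℝ) - i) := by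
    have := Nat.choose_succ_right_eq n i
    rw [← Nat.cast_sub (by omega)]
    exact_mod_cast this
  have h4 : (1 - p) ^ (n - i) = (1 - p) ^ (n - (i + 1)) * (1 - p) := by
    rw [← pow_succ]; congr 1; omega
  rw [h4, pow_succ]
  linear_combination (p ^ i * p * (1 - p) ^ (n - (i + 1)) * (1 - p)) * h3

/-- The constant `κ = i / (n + 1)` in `prim` is forced: by `e1` and `e2` the derivative is `tail n
(i + 1) p - y` plus `1 + i - κ * (n + 1)` times the binomial term, and this factor has to be `1`. -/
theorem hasDerivAt_prim {n i : ℕ} (h : i ≤ n) (y p : ℝ) :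
    HasDerivAt (prim n i y) (tail n i p - y) p := by
  have h1 := ((hasDerivAt_id p).sub_const ((i : ℝ) / (n + 1))).mul
    ((hasDerivAt_tail n (Nat.succ_pos i) p).sub_const y)
  have h2 := ((hasDerivAt_id p).mul (hasDerivAt_binomialProb n i p)).const_mul
    (1 - (i : ℝ) / (n + 1))
  refine (h1.add h2).congr_deriv ?_
  rw [tail_eq_add h]
  have hn : (n : ℝ) + 1 ≠ 0 := by positivity
  have e1 : p * tailDeriv n i p = i * binomialProb n i p := by
    unfold tailDeriv binomialProb
    rcases Nat.eq_zero_or_pos i with rfl | hi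
    · simp
    · rw [show p ^ i = p * p ^ (i - 1) by rw [← pow_succ']; congr 1; omega]; ring
  have e2 : (1 - p) * tailDeriv n (i + 1) p = (n - i) * binomialProb n i p := by
    have h3 : (n.choose (i + 1) : ℝ) * ((i : ℝ) + 1) = (n.choose i : ℝ) * ((n : ℝ) - i) := by
      have := Nat.choose_succ_right_eq n i
      rw [← Nat.cast_sub h]
      exact_mod_cast this
    unfold tailDeriv binomialProb
    rcases h.lt_or_eq with h | rfl
    · rw [show (1 - p) ^ (n - i) = (1 - p) * (1 - p) ^ (n - (i + 1)) by
        rw [← pow_succ']; congr 1; omega]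
      rw [Nat.add_sub_cancel]
      push_cast
      linear_combination ((1 - p) * (1 - p) ^ (n - (i + 1)) * p ^ i) * h3
    · simp
  simp only [id, Nat.succ_eq_add_one]
  have e4 : ((i : ℝ) / (n + 1)) * (n + 1) = i := by field_simp
  generalize (i : ℝ) / (n + 1) = κ at e4 ⊢
  linear_combination (1 - κ) * e1 - κ * e2 - binomialProb n i p * e4

/-- The defining form of `prim n (i + 1) y` collapses to one term where `tail n (i + 2) = y`, this
form where `tail n i = y`: the two quantiles next to that of the threshold `i + 1`. -/
theorem prim_eq {n i : ℕ} (hi : i + 1 ≤ n) (y p : ℝ) :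
    prim n (i + 1) y p = (p - (i + 1) / (n + 1)) * (tail n i p - y) +
      (i + 1) / (n + 1) * ((1 - p) * binomialProb n i p) := by
  have hn : (n : ℝ) + 1 ≠ 0 := by positivity
  unfold prim
  rw [tail_eq_add (show i ≤ n by omega), tail_eq_add hi]
  have h := binomialProb_succ_mul hi p
  push_cast
  have e4 : (((i : ℝ) + 1) / (n + 1)) * (n + 1) = i + 1 := by field_simp
  have e5 : (((i : ℝ) + 1) / (n + 1)) * ((1 - p) * binomialProb n (i + 1) p) =
      (1 - ((i : ℝ) + 1) / (n + 1)) * (p * binomialProb n i p) := by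
    field_simp
    linear_combination h
  generalize ((i : ℝ) + 1) / (n + 1) = κ at e4 e5 ⊢
  linear_combination e5

/-! ### The shape of a tail added to its reflection -/

theorem exists_deriv_mul_eq {f f' : ℝ → ℝ} {a b : ℝ} (hab : a < b) (hc : ContinuousOn f (Set.Icc a b))
    (h : ∀ x ∈ Set.Ioo a b, HasDerivAt f (f' x) x) :
    ∃ c ∈ Set.Ioo a b, f' c * (b - a) = f b - f a := by
  obtain ⟨c, hc, h⟩ := exists_hasDerivAt_eq_slope f f' hab hc h
  exact ⟨c, hc, by rw [h]; field_simp [sub_ne_zero.2 hab.ne']⟩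

/-- The logarithm of the ratio of the density `p ^ A * (1 - p) ^ B` at `p` and at the reflected
point `s - p`. -/
noncomputable def reflLog (A B s p : ℝ) : ℝ :=
  A * Real.log p + B * Real.log (1 - p) - A * Real.log (s - p) - B * Real.log (1 - s + p)

/-- The numerator of the derivative of `reflLog`. -/
noncomputable def reflNum (A B s p : ℝ) : ℝ :=
  A * s * (1 - s) + (A * s - B * (2 - s)) * (p * (s - p))

theorem hasDerivAt_reflLog {A B s p : ℝ} (h0 : 0 < p) (h1 : p < 1) (hs : p < s) (hs2 : s - 1 < p) :
    HasDerivAt (reflLog A B s)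
      (reflNum A B s p / (p * (1 - p) * (s - p) * (1 - s + p))) p := by
  have e1 : p ≠ 0 := h0.ne'
  have e2 : 1 - p ≠ 0 := by linarith
  have e3 : s - p ≠ 0 := by linarith
  have e4 : 1 - s + p ≠ 0 := by linarith
  have d1 := (Real.hasDerivAt_log e1).const_mul A
  have d2 := (((hasDerivAt_id p).const_sub 1).log e2).const_mul B
  have d3 := (((hasDerivAt_id p).const_sub s).log e3).const_mul A
  have d4 := (((hasDerivAt_id p).const_add (1 - s)).log e4).const_mul B
  refine (((d1.add d2).sub d3).sub d4).congr_deriv ?_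
  unfold reflNum
  simp only [id]
  field_simp
  ring

theorem reflLog_half (A B s : ℝ) : reflLog A B s (s / 2) = 0 := by
  unfold reflLog
  rw [show s - s / 2 = s / 2 by ring, show 1 - s + s / 2 = 1 - s / 2 by ring]
  ring

theorem exists_reflNum_of_reflLog {A B s a b : ℝ} (hs0 : 0 < s) (hs : s / 2 ≤ a) (hab : a < b)
    (h1 : b < 1) (hbs : b < s) :
    ∃ c ∈ Set.Ioo a b, ∃ d : ℝ, 0 < d ∧
      reflNum A B s c * d = reflLog A B s b - reflLog A B s a := by
  have key : ∀ x ∈ Set.Icc a b, HasDerivAt (reflLog A B s)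
      (reflNum A B s x / (x * (1 - x) * (s - x) * (1 - s + x))) x := fun x hx =>
    hasDerivAt_reflLog (by linarith [hx.1]) (by linarith [hx.2]) (by linarith [hx.2])
      (by linarith [hx.1])
  obtain ⟨c, hc, h⟩ := exists_deriv_mul_eq hab
    (fun x hx => (key x hx).continuousAt.continuousWithinAt)
    (fun x hx => key x (Set.Ioo_subset_Icc_self hx))
  refine ⟨c, hc, (b - a) / (c * (1 - c) * (s - c) * (1 - s + c)), ?_, ?_⟩
  · have := hc.1; have := hc.2
    have : 0 < c := by linarith
    have : 0 < 1 - c := by linarith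
    have : 0 < s - c := by linarith
    have : 0 < 1 - s + c := by linarith
    have : 0 < b - a := by linarith
    positivity
  · rw [← h]; ring

theorem log_tailDeriv {n i : ℕ} (hi : 1 ≤ i) (hn : i ≤ n) {p : ℝ} (h0 : 0 < p) (h1 : p < 1) :
    Real.log (tailDeriv n i p) = Real.log (i * (n.choose i : ℝ)) +
      (((i : ℝ) - 1) * Real.log p + ((n : ℝ) - i) * Real.log (1 - p)) := by
  have h2 : (0 : ℝ) < 1 - p := by linarith
  have h3 : (0 : ℝ) < i * (n.choose i : ℝ) := by
    have := Nat.choose_pos hn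
    have : 0 < i := hi
    positivity
  unfold tailDeriv
  rw [Real.log_mul (by positivity) (by positivity), Real.log_mul (by positivity) (by positivity),
    Real.log_pow, Real.log_pow, Nat.cast_sub hn, Nat.cast_sub hi]
  push_cast
  ring

theorem tailDeriv_sub_sign {n i : ℕ} (hi : 1 ≤ i) (hn : i ≤ n) {s p : ℝ} (h0 : 0 < p) (h1 : p < 1)
    (hs : p < s) (hs2 : s - 1 < p) :
    (tailDeriv n i (s - p) ≤ tailDeriv n i p ↔ 0 ≤ reflLog ((i : ℝ) - 1) ((n : ℝ) - i) s p) ∧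
    (tailDeriv n i (s - p) < tailDeriv n i p ↔ 0 < reflLog ((i : ℝ) - 1) ((n : ℝ) - i) s p) := by
  have h2 : 0 < s - p := by linarith
  have h3 : s - p < 1 := by linarith
  have e : reflLog ((i : ℝ) - 1) ((n : ℝ) - i) s p =
      Real.log (tailDeriv n i p) - Real.log (tailDeriv n i (s - p)) := by
    rw [log_tailDeriv hi hn h0 h1, log_tailDeriv hi hn h2 h3]
    unfold reflLog
    rw [show 1 - (s - p) = 1 - s + p by ring]
    ring
  have p1 := tailDeriv_pos hi hn h0 h1
  have p2 := tailDeriv_pos hi hn h2 h3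
  rw [e, sub_nonneg, sub_pos, Real.log_le_log_iff p2 p1, Real.log_lt_log_iff p2 p1]
  exact ⟨Iff.rfl, Iff.rfl⟩

/-- The sum of a tail probability at `p` and at the reflected point `s - p`. -/
noncomputable def reflSum (n i : ℕ) (s p : ℝ) : ℝ := tail n i p + tail n i (s - p)

theorem hasDerivAt_reflSum (n : ℕ) {i : ℕ} (hi : 1 ≤ i) (s p : ℝ) :
    HasDerivAt (reflSum n i s) (tailDeriv n i p - tailDeriv n i (s - p)) p := by
  have h2 := (hasDerivAt_tail n hi (s - p)).comp p ((hasDerivAt_id p).const_sub s)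
  exact ((hasDerivAt_tail n hi p).add h2).congr_deriv (by simp; ring)

theorem exists_reflLog_of_reflSum {n i : ℕ} (hi : 1 ≤ i) (hn : i ≤ n) {s a b : ℝ} (hs0 : 0 < s)
    (hs : s / 2 ≤ a) (hab : a < b) (h1 : b ≤ 1) (hbs : b ≤ s) :
    ∃ c ∈ Set.Ioo a b,
      (reflSum n i s a ≤ reflSum n i s b → 0 ≤ reflLog ((i : ℝ) - 1) ((n : ℝ) - i) s c) ∧
      (reflSum n i s a < reflSum n i s b → 0 < reflLog ((i : ℝ) - 1) ((n : ℝ) - i) s c) ∧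
      (reflSum n i s b < reflSum n i s a → reflLog ((i : ℝ) - 1) ((n : ℝ) - i) s c < 0) := by
  obtain ⟨c, hc, h⟩ := exists_deriv_mul_eq hab
    (fun x _ => (hasDerivAt_reflSum n hi s x).continuousAt.continuousWithinAt)
    (fun x _ => hasDerivAt_reflSum n hi s x)
  obtain ⟨s1, s2⟩ := tailDeriv_sub_sign hi hn (s := s) (p := c) (by linarith [hc.1])
    (by linarith [hc.2]) (by linarith [hc.2]) (by linarith [hc.1])
  have hpos : 0 < b - a := by linarith
  refine ⟨c, hc, fun hle => s1.1 ?_, fun hlt => s2.1 ?_, fun hlt => ?_⟩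
  · have : 0 ≤ tailDeriv n i c - tailDeriv n i (s - c) := by
      by_contra hneg; push Not at hneg; nlinarith
    linarith
  · have : 0 < tailDeriv n i c - tailDeriv n i (s - c) := by
      by_contra hneg; push Not at hneg; nlinarith
    linarith
  · rw [← not_le, ← s1, not_le]
    have : tailDeriv n i c - tailDeriv n i (s - c) < 0 := by
      by_contra hneg; push Not at hneg; nlinarith
    linarith

/-- If the reflected sum does not decrease between two points to the right of `s / 2`, then
`reflNum` is nonnegative somewhere to their left. -/
theorem exists_reflNum_nonneg {n i : ℕ} (hi : 1 ≤ i) (hn : i ≤ n) {s a b : ℝ} (hs0 : 0 < s)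
    (hs : s / 2 ≤ a) (hab : a < b) (h1 : b ≤ 1) (hbs : b ≤ s)
    (h : reflSum n i s a ≤ reflSum n i s b) :
    ∃ c ∈ Set.Ioo a b, 0 ≤ reflLog ((i : ℝ) - 1) ((n : ℝ) - i) s c ∧
      ∃ d ∈ Set.Ioo (s / 2) c, 0 ≤ reflNum ((i : ℝ) - 1) ((n : ℝ) - i) s d := by
  obtain ⟨c, hc, h2, -, -⟩ := exists_reflLog_of_reflSum hi hn hs0 hs hab h1 hbs
  obtain ⟨d, hd, r, hr, h3⟩ := exists_reflNum_of_reflLog (A := (i : ℝ) - 1) (B := (n : ℝ) - i)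
    hs0 le_rfl (by linarith [hc.1] : s / 2 < c) (by linarith [hc.2]) (by linarith [hc.2])
  rw [reflLog_half, sub_zero] at h3
  refine ⟨c, hc, h2 h, d, hd, ?_⟩
  have := h2 h
  by_contra hneg; push Not at hneg; nlinarith

/-- `reflNum` is affine in `p * (s - p)`, so this monotonicity controls its signs to the right of `s
/ 2`. -/
theorem reflNum_anti_arg {s a b : ℝ} (ha : s / 2 ≤ a) (hab : a < b) :
    b * (s - b) < a * (s - a) := by nlinarith

/-- Case of small `s`: the reflected sum stays below a level that it takes once and that exceeds
its value at `s`. -/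
theorem reflSum_lt_of_le_one {n i : ℕ} (hi : 1 ≤ i) (hn : i ≤ n) {s a b z : ℝ} (hs0 : 0 < s)
    (hs1 : s ≤ 1) (ha : s / 2 ≤ a) (hab : a < b) (hb : b < s) (hz : reflSum n i s a = z)
    (hend : reflSum n i s s < z) : reflSum n i s b < z := by
  -- Otherwise the log ratio is nonnegative at `c` and, since the sum has dropped below `z` at `s`,
  -- negative at a later `c'`. So `reflNum` is nonnegative at `d` and negative at a later `d'`. For
  -- `s ≤ 1` its constant term is nonnegative, so the negative value forces a negative slope in `p *
  -- (s - p)`; then `reflNum` increases with `p`, a contradiction.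
  by_contra hge
  push Not at hge
  obtain ⟨c, hc, h2, d, hd, h3⟩ := exists_reflNum_nonneg hi hn hs0 ha hab (by linarith) hb.le
    (hz.trans_le hge)
  obtain ⟨c', hc', -, -, h4⟩ := exists_reflLog_of_reflSum hi hn hs0 (by linarith) hb hs1 le_rfl
  have h5 := h4 (by linarith)
  obtain ⟨d', hd', r, hr, h6⟩ := exists_reflNum_of_reflLog (A := (i : ℝ) - 1) (B := (n : ℝ) - i)
    hs0 (by linarith [hd.1, hd.2] : s / 2 ≤ c) (by linarith [hc.2, hc'.1] : c < c')
    (by linarith [hc'.2]) (by linarith [hc'.2])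
  have h7 : reflNum ((i : ℝ) - 1) ((n : ℝ) - i) s d' < 0 := by
    by_contra hneg; push Not at hneg; nlinarith
  have h8 := reflNum_anti_arg hd.1.le (by linarith [hd.2, hd'.1] : d < d')
  have h9 : 0 < d' * (s - d') :=
    mul_pos (by linarith [hd.1, hd.2, hd'.1]) (by linarith [hd'.2, hc'.2])
  have hi' : (1 : ℝ) ≤ i := by exact_mod_cast hi
  have h10 : 0 ≤ ((i : ℝ) - 1) * s * (1 - s) :=
    mul_nonneg (mul_nonneg (by linarith) hs0.le) (by linarith)
  unfold reflNum at h3 h7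
  have h11 : ((i : ℝ) - 1) * s - ((n : ℝ) - i) * (2 - s) < 0 := by
    by_contra hneg; push Not at hneg; nlinarith
  nlinarith

/-- Case of large `s` with the reflection point to the right of the mode. -/
theorem reflSum_lt_of_mode_le {n i : ℕ} (hi : 1 ≤ i) (hn : i < n) {s a b : ℝ}
    (hs1 : 1 < s) (hs2 : s < 2) (hm : 2 * ((i : ℝ) - 1) ≤ s * ((n : ℝ) - 1)) (ha : s / 2 ≤ a)
    (hab : a < b) (hb : b ≤ 1) : reflSum n i s b < reflSum n i s a := by
  by_contra hge
  push Not at hge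
  obtain ⟨c, hc, h2, d, hd, h3⟩ := exists_reflNum_nonneg hi hn.le (by linarith) ha hab hb
    (by linarith) hge
  have hn' : (i : ℝ) < n := by exact_mod_cast hn
  have h4 := reflNum_anti_arg le_rfl hd.1
  have h5 := reflNum_anti_arg hd.1.le (by linarith [hd.2, hc.2] : d < 1)
  have hB : 0 < ((n : ℝ) - i) * (2 - s) := mul_pos (by linarith) (by linarith)
  unfold reflNum at h3
  -- `reflNum` is negative at `p = 1` and, by `hm`, nonpositive at `p = s / 2`. Being affine in `p *
  -- (s - p)`, it is negative in between, against `h3`.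
  have e1 : ((i : ℝ) - 1) * s * (1 - s) + (((i : ℝ) - 1) * s - ((n : ℝ) - i) * (2 - s)) *
      (1 * (s - 1)) < 0 := by nlinarith
  have e2 : ((i : ℝ) - 1) * s * (1 - s) + (((i : ℝ) - 1) * s - ((n : ℝ) - i) * (2 - s)) *
      (s / 2 * (s - s / 2)) ≤ 0 := by
    have : ((i : ℝ) - 1) * s * (1 - s) + (((i : ℝ) - 1) * s - ((n : ℝ) - i) * (2 - s)) *
      (s / 2 * (s - s / 2)) = (2 * ((i : ℝ) - 1) - s * ((n : ℝ) - 1)) * (s * (2 - s) / 4) := by ring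
    rw [this]
    exact mul_nonpos_of_nonpos_of_nonneg (by linarith)
      (div_nonneg (mul_nonneg (by linarith) (by linarith)) (by norm_num))
  rcases le_total 0 (((i : ℝ) - 1) * s - ((n : ℝ) - i) * (2 - s)) with h | h
  · rcases h.eq_or_lt with h | h
    · rw [← h] at h3 e1; linarith
    · nlinarith
  · nlinarith

/-- Case of large `s`: once below its value at an earlier point, the reflected sum stays below. -/
theorem reflSum_lt_of_lt {n i : ℕ} (hi : 1 ≤ i) (hn : i < n) {s a x b z : ℝ}
    (hs1 : 1 < s) (hs2 : s < 2) (ha : s / 2 ≤ a) (hax : a < x) (hxb : x < b) (hb : b ≤ 1)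
    (hz : reflSum n i s a = z) (hx : reflSum n i s x < z) : reflSum n i s b < z := by
  by_contra hge
  push Not at hge
  obtain ⟨c, hc, -, -, h2⟩ := exists_reflLog_of_reflSum hi hn.le (by linarith) ha hax
    (by linarith) (by linarith)
  have h2 := h2 (by linarith)
  obtain ⟨c', hc', -, h3, -⟩ := exists_reflLog_of_reflSum hi hn.le (by linarith)
    (by linarith : s / 2 ≤ x) hxb hb (by linarith)
  have h3 := h3 (by linarith)
  obtain ⟨d, hd, r, hr, h4⟩ := exists_reflNum_of_reflLog (A := (i : ℝ) - 1) (B := (n : ℝ) - i)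
    (by linarith) le_rfl (by linarith [hc.1] : s / 2 < c) (by linarith [hc.2]) (by linarith [hc.2])
  obtain ⟨d', hd', r', hr', h5⟩ := exists_reflNum_of_reflLog (A := (i : ℝ) - 1)
    (B := (n : ℝ) - i) (by linarith) (by linarith [hc.1] : s / 2 ≤ c)
    (by linarith [hc.2, hc'.1] : c < c') (by linarith [hc'.2]) (by linarith [hc'.2])
  rw [reflLog_half, sub_zero] at h4
  have h6 : reflNum ((i : ℝ) - 1) ((n : ℝ) - i) s d < 0 := by
    by_contra hneg; push Not at hneg; nlinarith
  have h7 : 0 < reflNum ((i : ℝ) - 1) ((n : ℝ) - i) s d' := by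
    by_contra hneg; push Not at hneg; nlinarith
  have hn' : (i : ℝ) < n := by exact_mod_cast hn
  have hB : 0 < ((n : ℝ) - i) * (2 - s) := mul_pos (by linarith) (by linarith)
  have h8 := reflNum_anti_arg hd.1.le (by linarith [hd.2, hd'.1] : d < d')
  have h9 := reflNum_anti_arg (by linarith [hd.1, hd.2, hd'.1] : s / 2 ≤ d')
    (by linarith [hd'.2, hc'.2] : d' < 1)
  unfold reflNum at h6 h7
  have e1 : ((i : ℝ) - 1) * s * (1 - s) + (((i : ℝ) - 1) * s - ((n : ℝ) - i) * (2 - s)) *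
      (1 * (s - 1)) < 0 := by nlinarith
  -- A nonpositive slope in `p * (s - p)` would keep `reflNum` positive from `d'` to `1`, against
  -- `e1`; a positive slope contradicts the signs at `d` and `d'`.
  have : 0 < ((i : ℝ) - 1) * s - ((n : ℝ) - i) * (2 - s) := by
    by_contra hneg; push Not at hneg; nlinarith
  nlinarith

/-! ### Comparison of the two end points of one step -/

theorem tail_lt_tail {n i : ℕ} (hi : 1 ≤ i) (hn : i ≤ n) {a b : ℝ} (ha : 0 ≤ a) (hab : a < b)
    (hb : b ≤ 1) : tail n i a < tail n i b :=
  strictMonoOn_tail hi hn ⟨ha, by linarith⟩ ⟨by linarith, hb⟩ hab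

theorem tail_le_tail {n i : ℕ} (hi : 1 ≤ i) (hn : i ≤ n) {a b : ℝ} (ha : 0 ≤ a) (hab : a ≤ b)
    (hb : b ≤ 1) : tail n i a ≤ tail n i b :=
  (strictMonoOn_tail hi hn).monotoneOn ⟨ha, by linarith⟩ ⟨by linarith, hb⟩ hab

theorem lt_of_tail_lt {n i : ℕ} (hi : 1 ≤ i) (hn : i ≤ n) {a b : ℝ} (ha : a ≤ 1) (hb : 0 ≤ b)
    (h : tail n i a < tail n i b) : a < b := by
  by_contra hge
  push Not at hge
  exact absurd (tail_le_tail hi hn hb hge ha) (not_le.2 h)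

theorem continuous_prim (n i : ℕ) (y : ℝ) : Continuous (prim n i y) := by
  have := continuous_tail n (i + 1)
  unfold prim binomialProb
  fun_prop

theorem exists_prim_sub {n i : ℕ} (hn : i ≤ n) (y : ℝ) {a b : ℝ} (hab : a < b) :
    ∃ c ∈ Set.Ioo a b, (tail n i c - y) * (b - a) = prim n i y b - prim n i y a :=
  exists_deriv_mul_eq hab (continuous_prim n i y).continuousOn fun x _ => hasDerivAt_prim hn y x

theorem prim_lt_of_tail_le {n i : ℕ} (hi : 1 ≤ i) (hn : i ≤ n) {y a b : ℝ} (ha : 0 ≤ a)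
    (hab : a < b) (hb : b ≤ 1) (h : tail n i b ≤ y) : prim n i y b < prim n i y a := by
  obtain ⟨c, hc, h1⟩ := exists_prim_sub hn y hab
  have := tail_lt_tail hi hn (ha.trans hc.1.le) hc.2 hb
  nlinarith

theorem prim_lt_of_le_tail {n i : ℕ} (hi : 1 ≤ i) (hn : i ≤ n) {y a b : ℝ} (ha : 0 ≤ a)
    (hab : a < b) (hb : b ≤ 1) (h : y ≤ tail n i a) : prim n i y a < prim n i y b := by
  obtain ⟨c, hc, h1⟩ := exists_prim_sub hn y hab
  have := tail_lt_tail hi hn ha hc.1 (hc.2.le.trans hb)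
  nlinarith

theorem tail_lt_of_prim_eq {n i : ℕ} (hi : 1 ≤ i) (hn : i ≤ n) {y w x : ℝ} (hw : 0 ≤ w)
    (hwx : w < x) (hx : x ≤ 1) (h : prim n i y w = prim n i y x) :
    tail n i w < y ∧ y < tail n i x := by
  constructor
  · by_contra hge
    exact absurd h (prim_lt_of_le_tail hi hn hw hwx hx (not_lt.1 hge)).ne
  · by_contra hge
    exact absurd h (prim_lt_of_tail_le hi hn hw hwx hx (not_lt.1 hge)).ne'

theorem eq_of_prim_eq {n i : ℕ} (hi : 1 ≤ i) (hn : i ≤ n) {y w w' x : ℝ} (hw : 0 ≤ w)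
    (hwx : w < x) (hw' : 0 ≤ w') (hwx' : w' < x) (hx : x ≤ 1) (h : prim n i y w = prim n i y x)
    (h' : prim n i y w' = prim n i y x) : w = w' := by
  have h1 := (tail_lt_of_prim_eq hi hn hw hwx hx h).1
  have h2 := (tail_lt_of_prim_eq hi hn hw' hwx' hx h').1
  rcases lt_trichotomy w w' with hlt | heq | hlt
  · exact absurd (h.trans h'.symm) (prim_lt_of_tail_le hi hn hw hlt (by linarith) h2.le).ne'
  · exact heq
  · exact absurd (h.trans h'.symm) (prim_lt_of_tail_le hi hn hw' hlt (by linarith) h1.le).ne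

theorem exists_tail_eq {n i : ℕ} {y a b : ℝ} (hab : a ≤ b)
    (ha : tail n i a ≤ y) (hb : y ≤ tail n i b) : ∃ c ∈ Set.Icc a b, tail n i c = y :=
  intermediate_value_Icc hab (continuous_tail n i).continuousOn ⟨ha, hb⟩

theorem exists_prim_eq {n i : ℕ} (hi : 1 ≤ i) (hn : i ≤ n) {y a b : ℝ} (ha : 0 ≤ a) (hab : a < b)
    (hb : b ≤ 1) (hya : tail n i a < y) (hyb : y < tail n i b)
    (h : prim n i y b < prim n i y a) :
    ∃ w, a < w ∧ w < b ∧ prim n i y w = prim n i y b ∧ tail n i w < y := by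
  obtain ⟨c, hc, hcy⟩ := exists_tail_eq hab.le hya.le hyb.le
  have hcb : c < b := hc.2.lt_of_ne (by rintro rfl; linarith)
  have hac : a < c := hc.1.lt_of_ne (by rintro rfl; linarith)
  have h1 := prim_lt_of_le_tail hi hn (ha.trans hc.1) hcb hb hcy.ge
  obtain ⟨w, hw, hwe⟩ := intermediate_value_Icc' hc.1 (continuous_prim n i y).continuousOn
    ⟨h1.le, h.le⟩
  have hwa : a < w := hw.1.lt_of_ne (by rintro rfl; linarith)
  have hwb : w < b := hw.2.trans_lt hcb
  exact ⟨w, hwa, hwb, hwe, (tail_lt_of_prim_eq hi hn (by linarith) hwb hb hwe).1⟩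

/-- A smaller right end point forces a larger left end point. -/
theorem le_of_prim_le {n i : ℕ} (hi : 1 ≤ i) (hn : i ≤ n) {y w x a b : ℝ} (hw : 0 < w)
    (hwx : w < x) (hx : x ≤ 1) (hG : prim n i y w = prim n i y x) (ha : 0 < a) (hab : a < b)
    (hbx : b ≤ x) (hF : prim n i y a ≤ prim n i y b) : w ≤ a := by
  by_contra hlt
  push Not at hlt
  obtain ⟨h1, h2⟩ := tail_lt_of_prim_eq hi hn hw.le hwx hx hG
  have h3 := prim_lt_of_tail_le hi hn ha.le hlt (by linarith) h1.le
  rcases le_or_gt (tail n i b) y with h4 | h4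
  · linarith [prim_lt_of_tail_le hi hn ha.le hab (by linarith) h4]
  · rcases hbx.eq_or_lt with rfl | h5
    · linarith
    · linarith [prim_lt_of_le_tail hi hn (by linarith) h5 hx h4.le]

theorem exists_reflSum_sub {n i : ℕ} (hn : i ≤ n) (y s : ℝ) {a b : ℝ} (hab : a < b) :
    ∃ c ∈ Set.Ioo a b, (reflSum n i s c - 2 * y) * (b - a) =
      (prim n i y b - prim n i y (s - b)) - (prim n i y a - prim n i y (s - a)) := by
  have key : ∀ p, HasDerivAt (fun p => prim n i y p - prim n i y (s - p))
      (reflSum n i s p - 2 * y) p := fun p => by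
    have h2 := (hasDerivAt_prim hn y (s - p)).comp p ((hasDerivAt_id p).const_sub s)
    exact ((hasDerivAt_prim hn y p).sub h2).congr_deriv (by unfold reflSum; simp; ring)
  exact exists_deriv_mul_eq hab (fun x _ => (key x).continuousAt.continuousWithinAt)
    fun x _ => key x

/-- A larger right end point forces a larger sum of the end points. -/
theorem add_lt_add_of_prim_le {n i : ℕ} (hi : 1 ≤ i) (hn : i < n) {y w x a b : ℝ} (hy : 1 / 2 < y)
    (hw : 0 < w) (hwx : w < x) (hG : prim n i y w = prim n i y x) (ha : 0 < a)
    (hxb : x < b) (hb : b ≤ 1) (hF : prim n i y a ≤ prim n i y b)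
    (hm : (n : ℝ) - 1 < 2 * ((i : ℝ) - 1) →
      tail n i (((i : ℝ) - 1) / ((n : ℝ) - 1)) ≤ y ∨ tail n i x + tail n i w < 2 * y) :
    w + x < a + b := by
  by_contra hle
  push Not at hle
  have hx1 : x < 1 := by linarith
  obtain ⟨h1, h2⟩ := tail_lt_of_prim_eq hi hn.le hw.le hwx hx1.le hG
  -- The function `prim p - prim (s - p)` vanishes at `s / 2` and at `x`, and is nonnegative at `b`
  -- by `e1`. So `reflSum` equals `2 * y` at some `p₀ < x` and is at least `2 * y` at some `p > x`;
  -- its shape has to exclude this.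
  obtain ⟨s, hs⟩ : ∃ s, s = w + x := ⟨_, rfl⟩
  have hnR : (i : ℝ) < n := by exact_mod_cast hn
  have hiR : (1 : ℝ) ≤ i := by exact_mod_cast hi
  have e1 : prim n i y (s - b) ≤ prim n i y b := by
    rcases (show a ≤ s - b by linarith).eq_or_lt with h | h
    · rw [← h]; exact hF
    · have := tail_lt_tail hi hn.le (by linarith) (by linarith : s - b < w) (by linarith)
      linarith [prim_lt_of_tail_le (y := y) hi hn.le ha.le h (by linarith) (by linarith)]
  have ew : s - x = w := by linarith
  obtain ⟨p₀, hp₀, h3⟩ := exists_reflSum_sub hn.le y s (by linarith : s / 2 < x)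
  rw [ew, show s - s / 2 = s / 2 by ring, hG] at h3
  have h3 : reflSum n i s p₀ = 2 * y := by
    have : (reflSum n i s p₀ - 2 * y) * (x - s / 2) = 0 := by rw [h3]; ring
    rcases mul_eq_zero.1 this with h | h <;> linarith
  obtain ⟨p, hp, h4⟩ := exists_reflSum_sub hn.le y s hxb
  rw [ew, hG] at h4
  have h4 : 2 * y ≤ reflSum n i s p := by
    by_contra hneg; push Not at hneg; nlinarith
  refine absurd h4 (not_le.2 ?_)
  rcases le_or_gt s 1 with hs1 | hs1
  · refine reflSum_lt_of_le_one hi hn.le (by linarith) hs1 hp₀.1.le (by linarith [hp₀.2, hp.1])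
      (by linarith [hp.2]) h3 ?_
    unfold reflSum
    rw [sub_self, tail_at_zero hi]
    have := tail_le_tail hi hn.le (by linarith : 0 ≤ s) hs1 le_rfl
    rw [tail_at_one hn.le] at this
    linarith
  · rcases le_or_gt (2 * ((i : ℝ) - 1)) (s * ((n : ℝ) - 1)) with hms | hms
    · rw [← h3]
      exact reflSum_lt_of_mode_le hi hn hs1 (by linarith) hms hp₀.1.le
        (by linarith [hp₀.2, hp.1]) (by linarith [hp.2])
    · have hn1 : 0 < (n : ℝ) - 1 := by linarith
      rcases hm (by nlinarith) with hfm | hfx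
      -- Reflect about the mode `m` instead: beyond `m` the sum decreases from `2 * tail n i m ≤ 2 *
      -- y`, so `prim` is smaller at `x` than at `2 * m - x`. As `w < 2 * m - x` and `prim`
      -- decreases between these two points, `prim` differs at `w` and `x`.
      · exfalso
        set m := ((i : ℝ) - 1) / ((n : ℝ) - 1) with hmdef
        have hmm : m * ((n : ℝ) - 1) = (i : ℝ) - 1 := by rw [hmdef]; field_simp
        have hm1 : m < 1 := by rw [hmdef, div_lt_one hn1]; linarith
        have hms : s < 2 * m := by
          by_contra hneg; push Not at hneg; nlinarith
        have hmx : m < x := lt_of_tail_lt hi hn.le hm1.le (by linarith) (by linarith)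
        obtain ⟨q, hq, h5⟩ := exists_reflSum_sub hn.le y (2 * m) hmx
        rw [show 2 * m - m = m by ring, sub_self, sub_zero] at h5
        have h6 : reflSum n i (2 * m) q < reflSum n i (2 * m) m :=
          reflSum_lt_of_mode_le hi hn (by linarith) (by linarith)
            (by rw [mul_assoc, hmm]) (by linarith) hq.1 (by linarith [hq.2])
        have h7 : reflSum n i (2 * m) m = 2 * tail n i m := by
          unfold reflSum; rw [show 2 * m - m = m by ring]; ring
        have h8 : prim n i y x < prim n i y (2 * m - x) := by
          have : (reflSum n i (2 * m) q - 2 * y) * (x - m) < 0 :=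
            mul_neg_of_neg_of_pos (by linarith) (by linarith)
          linarith
        have h9 := tail_lt_tail hi hn.le (by linarith) (by linarith : 2 * m - x < m) hm1.le
        have := prim_lt_of_tail_le hi hn.le hw.le (by linarith : w < 2 * m - x) (by linarith)
          (by linarith : tail n i (2 * m - x) ≤ y)
        linarith
      · refine reflSum_lt_of_lt hi hn hs1 (by linarith) hp₀.1.le hp₀.2 hp.1
          (by linarith [hp.2]) h3 ?_
        unfold reflSum
        rw [ew]
        exact hfx

/-! ### Quantiles and the comparison of weights -/

/-- A strictly increasing surjection of `[0, 1]` onto itself is an order isomorphism, so its inverse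
is continuous; outside `[0, 1]` it is extended by constants. -/
theorem exists_quantile {n i : ℕ} (hi : 1 ≤ i) (hn : i ≤ n) :
    ∃ c : ℝ → ℝ, Continuous c ∧
      ∀ y ∈ Set.Icc (0 : ℝ) 1, c y ∈ Set.Icc (0 : ℝ) 1 ∧ tail n i (c y) = y := by
  have h01 : (0 : ℝ) ≤ 1 := zero_le_one
  have hmem : ∀ p : Set.Icc (0 : ℝ) 1, tail n i p ∈ Set.Icc (0 : ℝ) 1 := fun p => by
    have h1 := tail_le_tail hi hn le_rfl p.2.1 p.2.2
    have h2 := tail_le_tail hi hn p.2.1 p.2.2 le_rfl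
    rw [tail_at_zero hi] at h1
    rw [tail_at_one hn] at h2
    exact ⟨h1, h2⟩
  let f : Set.Icc (0 : ℝ) 1 → Set.Icc (0 : ℝ) 1 := fun p => ⟨tail n i p, hmem p⟩
  have hf : StrictMono f := fun p q hpq => strictMonoOn_tail hi hn p.2 q.2 hpq
  have hs : Function.Surjective f := fun y => by
    obtain ⟨c, hc, h⟩ := exists_tail_eq (n := n) (i := i) h01 (y := y)
      (by rw [tail_at_zero hi]; exact y.2.1) (by rw [tail_at_one hn]; exact y.2.2)
    exact ⟨⟨c, hc⟩, Subtype.ext h⟩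
  let e := hf.orderIsoOfSurjective f hs
  refine ⟨Set.IccExtend h01 fun y => (e.symm y : ℝ),
    (continuous_subtype_val.comp e.symm.continuous).Icc_extend', fun y hy => ?_⟩
  rw [Set.IccExtend_of_mem h01 _ hy]
  exact ⟨(e.symm ⟨y, hy⟩).2, congrArg Subtype.val (e.apply_symm_apply ⟨y, hy⟩)⟩

theorem hasDerivAt_quantile {n i : ℕ} (hi : 1 ≤ i) (hn : i ≤ n) {c : ℝ → ℝ} (hc : Continuous c)
    (h : ∀ y ∈ Set.Icc (0 : ℝ) 1, c y ∈ Set.Icc (0 : ℝ) 1 ∧ tail n i (c y) = y) {y : ℝ}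
    (hy : y ∈ Set.Ioo (0 : ℝ) 1) :
    c y ∈ Set.Ioo (0 : ℝ) 1 ∧ HasDerivAt c (tailDeriv n i (c y))⁻¹ y := by
  obtain ⟨h1, h2⟩ := h y (Set.Ioo_subset_Icc_self hy)
  have hmem : c y ∈ Set.Ioo (0 : ℝ) 1 := by
    refine ⟨h1.1.lt_of_ne ?_, h1.2.lt_of_ne ?_⟩
    · intro h0
      rw [← h0, tail_at_zero hi] at h2
      exact hy.1.ne h2
    · intro h0
      rw [h0, tail_at_one hn] at h2
      exact hy.2.ne h2.symm
  refine ⟨hmem, HasDerivAt.of_local_left_inverse hc.continuousAt (hasDerivAt_tail n hi _)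
    (tailDeriv_pos hi hn hmem.1 hmem.2).ne' ?_⟩
  filter_upwards [Ioo_mem_nhds hy.1 hy.2] with z hz
  exact (h z (Set.Ioo_subset_Icc_self hz)).2

theorem exists_lt_of_hasDerivAt_neg {φ : ℝ → ℝ} {d t u : ℝ} (h : HasDerivAt φ d t) (hd : d < 0)
    (htu : t < u) : ∃ s ∈ Set.Ioo t u, φ s < φ t := by
  have h1 := (hasDerivAt_iff_tendsto_slope.1 h).eventually (eventually_lt_nhds hd)
  have h2 : ∀ᶠ s in nhdsWithin t (Set.Ioi t), slope φ t s < 0 :=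
    h1.filter_mono (nhdsWithin_mono t fun s hs => ne_of_gt hs)
  obtain ⟨s, hs1, hs2⟩ := (h2.and (Ioo_mem_nhdsGT htu)).exists
  refine ⟨s, hs2, ?_⟩
  rw [slope_def_field, div_neg_iff] at hs1
  rcases hs1 with ⟨_, h3⟩ | ⟨h3, _⟩
  · linarith [hs2.1]
  · linarith

theorem hasDerivAt_pow_mul_pow {s t : ℕ} (hs : 1 ≤ s) (ht : 1 ≤ t) (p : ℝ) :
    HasDerivAt (fun p : ℝ => p ^ s * (1 - p) ^ t)
      (p ^ (s - 1) * (1 - p) ^ (t - 1) * (s - (s + t) * p)) p := by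
  refine ((hasDerivAt_pow s p).mul (((hasDerivAt_id p).const_sub 1).pow t)).congr_deriv ?_
  obtain ⟨s, rfl⟩ := Nat.exists_eq_add_of_le' hs
  obtain ⟨t, rfl⟩ := Nat.exists_eq_add_of_le' ht
  simp only [id, Nat.add_sub_cancel, Pi.pow_apply]
  push_cast
  ring

theorem strictAntiOn_pow_mul_pow {s t : ℕ} (hs : 1 ≤ s) (ht : 1 ≤ t) :
    StrictAntiOn (fun p : ℝ => p ^ s * (1 - p) ^ t) (Set.Icc ((s : ℝ) / (s + t)) 1) := by
  have hs' : (0 : ℝ) < s := by exact_mod_cast hs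
  have ht' : (0 : ℝ) < t := by exact_mod_cast ht
  refine strictAntiOn_of_deriv_neg (convex_Icc _ _) (by fun_prop) fun p hp => ?_
  rw [interior_Icc] at hp
  rw [(hasDerivAt_pow_mul_pow hs ht p).deriv]
  have h1 : 0 < (s : ℝ) / (s + t) := by positivity
  have h2 : 0 < p := h1.trans hp.1
  have h3 : 0 < 1 - p := by linarith [hp.2]
  have h4 := (div_lt_iff₀ (by positivity)).1 hp.1
  exact mul_neg_of_pos_of_neg (by positivity) (by linarith)

theorem monotoneOn_pow_mul_pow {s t : ℕ} (hs : 1 ≤ s) (ht : 1 ≤ t) :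
    MonotoneOn (fun p : ℝ => p ^ s * (1 - p) ^ t) (Set.Icc 0 ((s : ℝ) / (s + t))) := by
  have hs' : (0 : ℝ) < s := by exact_mod_cast hs
  have ht' : (0 : ℝ) < t := by exact_mod_cast ht
  refine monotoneOn_of_deriv_nonneg (convex_Icc _ _) (by fun_prop) (by fun_prop) fun p hp => ?_
  rw [interior_Icc] at hp
  rw [(hasDerivAt_pow_mul_pow hs ht p).deriv]
  have h4 := (lt_div_iff₀ (by positivity)).1 hp.2
  have h5 : (s : ℝ) / (s + t) < 1 := by rw [div_lt_one (by positivity)]; linarith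
  have h3 : 0 < 1 - p := by linarith [hp.2]
  have h2 := hp.1
  exact mul_nonneg (by positivity) (by linarith)

/-- The weight of the left quantile. -/
noncomputable def leftWeight (k j : ℕ) (p : ℝ) : ℝ :=
  ((k : ℝ) + 1) ^ 2 * (p ^ k * (1 - p) ^ (j + 2))

/-- The weight of the right quantile. -/
noncomputable def rightWeight (k j : ℕ) (p : ℝ) : ℝ :=
  ((j : ℝ) + 1) ^ 2 * (p ^ (k + 2) * (1 - p) ^ j)

/-- The position of the right quantile at which the difference of the weights is stationary. -/
noncomputable def critical (k j : ℕ) (a : ℝ) : ℝ :=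
  ((j : ℝ) * ((k : ℝ) + 1) / k * a + 1) / ((j : ℝ) + 1)

theorem critical_lt_one {k j : ℕ} (hk : 1 ≤ k) (hj : 1 ≤ j) {a : ℝ} :
    critical k j a < 1 ↔ a < (k : ℝ) / (k + 1) := by
  have hk' : (0 : ℝ) < k := by exact_mod_cast hk
  have hj' : (0 : ℝ) < j := by exact_mod_cast hj
  unfold critical
  rw [div_lt_one (by positivity), lt_div_iff₀ (by positivity), div_mul_eq_mul_div, ← lt_sub_iff_add_lt,
    div_lt_iff₀ hk']
  constructor <;> intro h
  · have : (j : ℝ) * (a * (k + 1)) < j * k := by linarith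
    exact lt_of_mul_lt_mul_left this hj'.le
  · have : (j : ℝ) * (a * (k + 1)) < j * k := mul_lt_mul_of_pos_left h hj'
    linarith

/-- Once the critical right weight exceeds the left weight, it does so further to the left. -/
theorem leftWeight_lt_of_le {k j : ℕ} (hk : 1 ≤ k) (hj : 1 ≤ j) {a a' : ℝ}
    (h1 : (k : ℝ) / (k + j + 2) ≤ a') (h2 : (k : ℝ) ^ 2 / ((k + 1) * (k + j)) ≤ a') (haa : a' ≤ a)
    (ha : a < (k : ℝ) / (k + 1)) (h : leftWeight k j a < rightWeight k j (critical k j a)) :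
    leftWeight k j a' < rightWeight k j (critical k j a') := by
  have hk' : (0 : ℝ) < k := by exact_mod_cast hk
  have hj' : (0 : ℝ) < j := by exact_mod_cast hj
  have ha0 : 0 < a' := lt_of_lt_of_le (by positivity) h1
  have hk1 : (k : ℝ) / (k + 1) < 1 := by rw [div_lt_one (by positivity)]; linarith
  set β : ℝ := (j : ℝ) * ((k : ℝ) + 1) / k / ((j : ℝ) + 1) with hβ
  let Λ : ℝ → ℝ := fun a => ((k : ℝ) + 2) * Real.log (critical k j a) +
    j * Real.log (1 - critical k j a) - k * Real.log a - ((j : ℝ) + 2) * Real.log (1 - a)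
  have pos : ∀ x ∈ Set.Icc a' a, 0 < x ∧ 0 < 1 - x ∧ 0 < critical k j x ∧
      0 < 1 - critical k j x := fun x hx => by
    have hx0 : 0 < x := ha0.trans_le hx.1
    refine ⟨hx0, by linarith [hx.2], by unfold critical; positivity, ?_⟩
    rw [sub_pos, critical_lt_one hk hj]
    exact hx.2.trans_lt ha
  have hcrit : ∀ x, HasDerivAt (critical k j) β x := fun x => by
    have := (((hasDerivAt_id x).const_mul ((j : ℝ) * ((k : ℝ) + 1) / k)).add_const 1).div_const
      ((j : ℝ) + 1)
    exact this.congr_deriv (by rw [hβ, mul_one])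
  have hΛ : ∀ x ∈ Set.Icc a' a, HasDerivAt Λ (((k : ℝ) + 2) * (β / critical k j x) +
      j * (-β / (1 - critical k j x)) - k * (1 / x) - ((j : ℝ) + 2) * (-1 / (1 - x))) x :=
    fun x hx => by
      obtain ⟨p1, p2, p3, p4⟩ := pos x hx
      exact (((((hcrit x).log p3.ne').const_mul _).add
        ((((hcrit x).const_sub 1).log p4.ne').const_mul _)).sub
        (((hasDerivAt_id x).log p1.ne').const_mul _)).sub
        ((((hasDerivAt_id x).const_sub 1).log p2.ne').const_mul _)
  have hanti : AntitoneOn Λ (Set.Icc a' a) := by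
    refine antitoneOn_of_deriv_nonpos (convex_Icc _ _)
      (fun x hx => (hΛ x hx).continuousAt.continuousWithinAt) (fun x hx => ?_) fun x hx => ?_
    · rw [interior_Icc] at hx
      exact (hΛ x (Set.Ioo_subset_Icc_self hx)).differentiableAt.differentiableWithinAt
    · rw [interior_Icc] at hx
      obtain ⟨p1, p2, p3, p4⟩ := pos x (Set.Ioo_subset_Icc_self hx)
      rw [(hΛ x (Set.Ioo_subset_Icc_self hx)).deriv]
      have q1 : (k : ℝ) ≤ (k + j + 2) * x := by
        have := h1.trans hx.1.le
        rw [div_le_iff₀ (by positivity)] at this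
        linarith
      have q2 : (k : ℝ) ^ 2 ≤ (k + 1) * (k + j) * x := by
        have := h2.trans hx.1.le
        rw [div_le_iff₀ (by positivity)] at this
        linarith
      -- The derivative of the log ratio factors. Its two linear factors have the roots `k / (k + j
      -- + 2)` and `k ^ 2 / ((k + 1) * (k + j))`, which explains the hypotheses `h1` and `h2`.
      have key : ((k : ℝ) + 2) * (β / critical k j x) +
          j * (-β / (1 - critical k j x)) - k * (1 / x) - ((j : ℝ) + 2) * (-1 / (1 - x)) =
          (k - (k + j + 2) * x) * ((k + 1) * (k + j) * x - k ^ 2) /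
            (k ^ 2 * (j + 1) ^ 2 / j * (critical k j x * (1 - critical k j x)) * (x * (1 - x))) := by
        have e1 : critical k j x = (j * (k + 1) * x + k) / (k * (j + 1)) := by
          unfold critical; field_simp
        have e2 : 1 - critical k j x = j * (k - (k + 1) * x) / (k * (j + 1)) := by
          rw [e1]; field_simp; ring
        have n1 : (j : ℝ) * (k + 1) * x + k ≠ 0 := by positivity
        have n2 : (k : ℝ) - (k + 1) * x ≠ 0 := by
          intro h0; rw [e2, h0] at p4; simp at p4
        have p2' := p2.ne'
        rw [e2, e1, hβ]
        field_simp
        ring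
      rw [key]
      exact div_nonpos_of_nonpos_of_nonneg
        (mul_nonpos_of_nonpos_of_nonneg (by linarith) (by linarith)) (by positivity)
  have hlog : ∀ x ∈ Set.Icc a' a, (leftWeight k j x < rightWeight k j (critical k j x) ↔
      0 < Λ x + (2 * Real.log ((j : ℝ) + 1) - 2 * Real.log ((k : ℝ) + 1))) := fun x hx => by
    obtain ⟨p1, p2, p3, p4⟩ := pos x hx
    have l1 : Real.log (leftWeight k j x) = 2 * Real.log ((k : ℝ) + 1) + (k * Real.log x +
        ((j : ℝ) + 2) * Real.log (1 - x)) := by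
      unfold leftWeight
      rw [Real.log_mul (by positivity) (by positivity), Real.log_mul (by positivity) (by positivity),
        Real.log_pow, Real.log_pow, Real.log_pow]
      push_cast; ring
    have l2 : Real.log (rightWeight k j (critical k j x)) = 2 * Real.log ((j : ℝ) + 1) +
        (((k : ℝ) + 2) * Real.log (critical k j x) + j * Real.log (1 - critical k j x)) := by
      unfold rightWeight
      rw [Real.log_mul (by positivity) (by positivity), Real.log_mul (by positivity) (by positivity),
        Real.log_pow, Real.log_pow, Real.log_pow]
      push_cast; ring
    have w1 : 0 < leftWeight k j x := by unfold leftWeight; positivity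
    have w2 : 0 < rightWeight k j (critical k j x) := by unfold rightWeight; positivity
    rw [← Real.log_lt_log_iff w1 w2, l1, l2]
    constructor <;> intro h <;> simp only [Λ] at * <;> linarith
  have m1 : a' ∈ Set.Icc a' a := ⟨le_rfl, haa⟩
  have m2 : a ∈ Set.Icc a' a := ⟨haa, le_rfl⟩
  rw [hlog _ m1]
  rw [hlog _ m2] at h
  linarith [hanti m1 m2 haa]

theorem choose_add_two_mul (k j : ℕ) :
    ((k : ℝ) + 1) * (k + 2) * ((k + 1 + j).choose (k + 2) : ℝ) =
      (j + 1) * j * ((k + 1 + j).choose k : ℝ) := by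
  have h1 := Nat.choose_succ_right_eq (k + 1 + j) k
  have h2 := Nat.choose_succ_right_eq (k + 1 + j) (k + 1)
  rw [show k + 1 + j - k = j + 1 by omega] at h1
  rw [show k + 1 + j - (k + 1) = j by omega] at h2
  have h1' : ((k + 1 + j).choose (k + 1) : ℝ) * (k + 1) = (k + 1 + j).choose k * (j + 1) := by
    exact_mod_cast h1
  have h2' : ((k + 1 + j).choose (k + 2) : ℝ) * (k + 2) = (k + 1 + j).choose (k + 1) * j := by
    exact_mod_cast h2
  linear_combination ((k : ℝ) + 1) * h2' + (j : ℝ) * h1'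

/-- All powers cancel against `tailDeriv`: differentiated with respect to the order of the quantile,
the weight has a derivative affine in the quantile. The same happens on the right, which is why the
weights are followed along the order. -/
theorem leftWeight_deriv_quotient {k j : ℕ} (hk : 1 ≤ k) {a : ℝ} (ha : a ∈ Set.Ioo (0 : ℝ) 1) :
    ((k : ℝ) + 1) ^ 2 * (a ^ (k - 1) * (1 - a) ^ (j + 2 - 1) * (k - (k + (j + 2 : ℕ)) * a)) *
      (tailDeriv (k + 1 + j) k a)⁻¹ =
    ((k : ℝ) + 1) ^ 2 * (k - (k + j + 2) * a) / (k * ((k + 1 + j).choose k : ℝ)) := by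
  have hC : (0 : ℝ) < ((k + 1 + j).choose k : ℝ) := by
    exact_mod_cast Nat.choose_pos (by omega)
  have hk' : (0 : ℝ) < k := by exact_mod_cast hk
  have h1 : 0 < a := ha.1
  have h2 : 0 < 1 - a := sub_pos.2 ha.2
  have h1' := pow_pos h1 (k - 1)
  have h2' := pow_pos h2 (j + 1)
  unfold tailDeriv
  rw [show k + 1 + j - k = j + 1 by omega, show j + 2 - 1 = j + 1 by omega]
  push_cast
  field_simp
  ring

theorem rightWeight_deriv_quotient {k j : ℕ} (hj : 1 ≤ j) {b : ℝ} (hb : b ∈ Set.Ioo (0 : ℝ) 1) :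
    ((j : ℝ) + 1) ^ 2 * (b ^ (k + 2 - 1) * (1 - b) ^ (j - 1) * ((k + 2 : ℕ) - ((k + 2 : ℕ) + j) * b)) *
      (tailDeriv (k + 1 + j) (k + 2) b)⁻¹ =
    ((j : ℝ) + 1) * (k + 1) * (k + 2 - (k + j + 2) * b) / (j * ((k + 1 + j).choose k : ℝ)) := by
  have hC : (0 : ℝ) < ((k + 1 + j).choose k : ℝ) := by
    exact_mod_cast Nat.choose_pos (by omega)
  have hj' : (0 : ℝ) < j := by exact_mod_cast hj
  have h1 : 0 < b := hb.1
  have h2 : 0 < 1 - b := sub_pos.2 hb.2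
  have h1' := pow_pos h1 (k + 1)
  have h2' := pow_pos h2 (j - 1)
  have hC2 : (((k + 2 : ℕ) : ℝ)) * ((k + 1 + j).choose (k + 2) : ℝ) =
      (j + 1) * j * ((k + 1 + j).choose k : ℝ) / (k + 1) := by
    rw [eq_div_iff (by positivity)]
    push_cast
    linear_combination choose_add_two_mul k j
  unfold tailDeriv
  rw [hC2, show k + 1 + j - (k + 2) = j - 1 by omega, show k + 2 - 1 = k + 1 by omega]
  push_cast
  field_simp
  ring

/-- `critical` is increasing and maps the mode of the left weight to the mode of the right weight.
-/
theorem mean_le_critical {k j : ℕ} (hk : 1 ≤ k) {a : ℝ} (h : (k : ℝ) / (k + j + 2) ≤ a) :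
    ((k : ℝ) + 2) / (k + 2 + j) ≤ critical k j a := by
  have hk' : (0 : ℝ) < k := by exact_mod_cast hk
  have h1 : critical k j (k / (k + j + 2)) ≤ critical k j a := by
    unfold critical
    gcongr
  refine le_trans (le_of_eq ?_) h1
  unfold critical
  field_simp
  ring

theorem rightWeight_strictAntiOn {k j : ℕ} (hj : 1 ≤ j) :
    StrictAntiOn (rightWeight k j) (Set.Icc (((k : ℝ) + 2) / (k + 2 + j)) 1) := by
  have := strictAntiOn_pow_mul_pow (s := k + 2) (t := j) (by omega) hj
  push_cast at this
  intro x hx y hy hxy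
  unfold rightWeight
  exact mul_lt_mul_of_pos_left (this hx hy hxy) (by positivity)

/-- Let `φ t` be the left minus the right weight at the quantiles of order `t`. Then `φ 1 = 0`, and
`φ'` is a positive multiple of `cb t - critical k j (ca t)`. If `φ` is negative somewhere, then at
its minimum `t` the derivative is not negative, so the right quantile is at least `critical`. The
right weight decreases there, hence the critical right weight exceeds the left weight, and by
`leftWeight_lt_of_le` it does so down to `a₀`. The first alternative of `hcase` denies this at `a₀`.
Under the second, `φ` starts nonnegative and has a last zero `s` before `t`; but there the same
inequality makes `φ'` positive, while `φ` is negative right after `s`. -/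
theorem rightWeight_le_leftWeight {n k j : ℕ} (hn : n = k + 1 + j) (hk : 1 ≤ k) (hj : 1 ≤ j)
    {a₀ b₀ a b : ℝ} (ha₀ : a₀ ∈ Set.Icc (0 : ℝ) 1) (hb₀ : b₀ ∈ Set.Icc (0 : ℝ) 1)
    (h₀ : tail n k a₀ = tail n (k + 2) b₀)
    (h1 : (k : ℝ) / (k + j + 2) ≤ a₀) (h2 : (k : ℝ) ^ 2 / ((k + 1) * (k + j)) ≤ a₀)
    (hcase : (critical k j a₀ < 1 → rightWeight k j (critical k j a₀) ≤ leftWeight k j a₀) ∨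
      (rightWeight k j b₀ ≤ leftWeight k j a₀ ∧ ((k : ℝ) + 2) / (k + 2 + j) ≤ b₀))
    (ha : a ∈ Set.Icc a₀ 1) (hb : b ∈ Set.Icc (0 : ℝ) 1) (hab : tail n k a = tail n (k + 2) b) :
    rightWeight k j b ≤ leftWeight k j a := by
  have hk' : (0 : ℝ) < k := by exact_mod_cast hk
  have hj' : (0 : ℝ) < j := by exact_mod_cast hj
  have hkn : k ≤ n := by omega
  have hkn2 : k + 2 ≤ n := by omega
  have hk2 : 1 ≤ k + 2 := by omega
  have ha₀pos : 0 < a₀ := lt_of_lt_of_le (by positivity) h1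
  have inj : ∀ {i : ℕ}, 1 ≤ i → i ≤ n → ∀ {p q : ℝ}, p ∈ Set.Icc (0 : ℝ) 1 →
      q ∈ Set.Icc (0 : ℝ) 1 → tail n i p = tail n i q → p = q := fun h1 h2 _ _ hp hq h =>
    (strictMonoOn_tail h1 h2).injOn hp hq h
  have rng : ∀ {i : ℕ}, 1 ≤ i → i ≤ n → ∀ {p : ℝ}, p ∈ Set.Icc (0 : ℝ) 1 →
      tail n i p ∈ Set.Icc (0 : ℝ) 1 := fun h1 h2 p hp => by
    have e1 := tail_le_tail h1 h2 le_rfl hp.1 hp.2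
    have e2 := tail_le_tail h1 h2 hp.1 hp.2 le_rfl
    rw [tail_at_zero h1] at e1
    rw [tail_at_one h2] at e2
    exact ⟨e1, e2⟩
  have ha01 : a ∈ Set.Icc (0 : ℝ) 1 := ⟨ha₀.1.trans ha.1, ha.2⟩
  obtain ⟨ca, hca, ca_spec⟩ := exists_quantile (n := n) hk hkn
  obtain ⟨cb, hcb, cb_spec⟩ := exists_quantile (n := n) hk2 hkn2
  set y₀ := tail n k a₀ with hy₀
  set y := tail n k a with hy
  have my₀ : y₀ ∈ Set.Icc (0 : ℝ) 1 := rng hk hkn ha₀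
  have my : y ∈ Set.Icc (0 : ℝ) 1 := rng hk hkn ha01
  have hyy : y₀ ≤ y := tail_le_tail hk hkn ha₀.1 ha.1 ha.2
  have ca0 : ca y₀ = a₀ := inj hk hkn (ca_spec y₀ my₀).1 ha₀ (ca_spec y₀ my₀).2
  have cb0 : cb y₀ = b₀ := inj hk2 hkn2 (cb_spec y₀ my₀).1 hb₀ ((cb_spec y₀ my₀).2.trans h₀)
  have cay : ca y = a := inj hk hkn (ca_spec y my).1 ha01 (ca_spec y my).2
  have cby : cb y = b := inj hk2 hkn2 (cb_spec y my).1 hb ((cb_spec y my).2.trans hab)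
  have one_mem : (1 : ℝ) ∈ Set.Icc (0 : ℝ) 1 := ⟨zero_le_one, le_rfl⟩
  have ca1 : ca 1 = 1 :=
    inj hk hkn (ca_spec 1 one_mem).1 one_mem ((ca_spec 1 one_mem).2.trans (tail_at_one hkn).symm)
  have cb1 : cb 1 = 1 := inj hk2 hkn2 (cb_spec 1 one_mem).1 one_mem
    ((cb_spec 1 one_mem).2.trans (tail_at_one hkn2).symm)
  have y₀pos : 0 < y₀ := by
    have := tail_lt_tail hk hkn le_rfl ha₀pos ha₀.2
    rwa [tail_at_zero hk] at this
  let φ : ℝ → ℝ := fun t => leftWeight k j (ca t) - rightWeight k j (cb t)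
  have hφc : Continuous φ := by
    unfold φ leftWeight rightWeight
    fun_prop
  have hφ1 : φ 1 = 0 := by
    have : j ≠ 0 := by omega
    simp [φ, leftWeight, rightWeight, ca1, cb1, this]
  have hC : (0 : ℝ) < ((k + 1 + j).choose k : ℝ) := by exact_mod_cast Nat.choose_pos (by omega)
  have hder : ∀ t ∈ Set.Ioo (0 : ℝ) 1, HasDerivAt φ (((k : ℝ) + 1) * (k + j + 2) * (j + 1) /
      (j * ((k + 1 + j).choose k : ℝ)) * (cb t - critical k j (ca t))) t := fun t ht => by
    obtain ⟨m1, d1⟩ := hasDerivAt_quantile hk hkn hca ca_spec ht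
    obtain ⟨m2, d2⟩ := hasDerivAt_quantile hk2 hkn2 hcb cb_spec ht
    have e1 := (((hasDerivAt_pow_mul_pow (s := k) (t := j + 2) hk (by omega) (ca t)).const_mul
      (((k : ℝ) + 1) ^ 2))).comp t d1
    have e2 := (((hasDerivAt_pow_mul_pow (s := k + 2) (t := j) (by omega) hj (cb t)).const_mul
      (((j : ℝ) + 1) ^ 2))).comp t d2
    refine (e1.sub e2).congr_deriv ?_
    subst hn
    rw [leftWeight_deriv_quotient hk m1, rightWeight_deriv_quotient hj m2]
    unfold critical
    field_simp
    ring
  by_contra! hlt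
  have hφy : φ y < 0 := by simp only [φ, cay, cby]; linarith
  obtain ⟨t, ht, hmin⟩ := isCompact_Icc.exists_isMinOn (Set.nonempty_Icc.2 my₀.2)
    (hφc.continuousOn (s := Set.Icc y₀ 1))
  have hφt : φ t < 0 := (hmin ⟨hyy, my.2⟩).trans_lt hφy
  have ht1 : t < 1 := ht.2.lt_of_ne fun h => by rw [h, hφ1] at hφt; exact hφt.false
  have ht0 : t ∈ Set.Ioo (0 : ℝ) 1 := ⟨y₀pos.trans_le ht.1, ht1⟩
  have a₀_le : ∀ s ∈ Set.Icc y₀ 1, a₀ ≤ ca s := fun s hs => by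
    have hs' : s ∈ Set.Icc (0 : ℝ) 1 := ⟨my₀.1.trans hs.1, hs.2⟩
    by_contra! hc
    have := tail_lt_tail hk hkn (ca_spec s hs').1.1 hc ha₀.2
    rw [(ca_spec s hs').2] at this
    exact this.not_ge hs.1
  have b₀_le : ∀ s ∈ Set.Icc y₀ 1, b₀ ≤ cb s := fun s hs => by
    have hs' : s ∈ Set.Icc (0 : ℝ) 1 := ⟨my₀.1.trans hs.1, hs.2⟩
    by_contra! hc
    have := tail_lt_tail hk2 hkn2 (cb_spec s hs').1.1 hc hb₀.2
    rw [(cb_spec s hs').2, ← h₀] at this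
    exact this.not_ge hs.1
  have ca_mono : ∀ s ∈ Set.Icc y₀ t, ca s ≤ ca t := fun s hs => by
    have hs' : s ∈ Set.Icc (0 : ℝ) 1 := ⟨my₀.1.trans hs.1, hs.2.trans ht.2⟩
    by_contra! hc
    have := tail_lt_tail hk hkn (ca_spec t (Set.Ioo_subset_Icc_self ht0)).1.1 hc (ca_spec s hs').1.2
    rw [(ca_spec s hs').2, (ca_spec t (Set.Ioo_subset_Icc_self ht0)).2] at this
    exact this.not_ge hs.2
  have hcst : (0 : ℝ) < ((k : ℝ) + 1) * (k + j + 2) * (j + 1) /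
      (j * ((k + 1 + j).choose k : ℝ)) := by positivity
  have hcb_ge : critical k j (ca t) ≤ cb t := by
    by_contra! hc
    obtain ⟨s, hs, hs'⟩ := exists_lt_of_hasDerivAt_neg (hder t ht0)
      (mul_neg_of_pos_of_neg hcst (by linarith)) ht1
    exact (hmin ⟨ht.1.trans hs.1.le, hs.2.le⟩).not_gt hs'
  have hcbt := (hasDerivAt_quantile hk2 hkn2 hcb cb_spec ht0).1
  have hcat_lt : ca t < (k : ℝ) / (k + 1) :=
    (critical_lt_one hk hj).1 (hcb_ge.trans_lt hcbt.2)
  have hmean : ((k : ℝ) + 2) / (k + 2 + j) ≤ critical k j (ca t) :=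
    mean_le_critical hk (h1.trans (a₀_le t ht))
  have hL : leftWeight k j (ca t) < rightWeight k j (critical k j (ca t)) := by
    have h3 := (rightWeight_strictAntiOn (k := k) hj).antitoneOn
      ⟨hmean, hcb_ge.trans hcbt.2.le⟩ ⟨hmean.trans hcb_ge, hcbt.2.le⟩ hcb_ge
    have h4 : leftWeight k j (ca t) - rightWeight k j (cb t) < 0 := hφt
    linarith
  rcases hcase with hc | ⟨hc1, hc2⟩
  · have h5 := leftWeight_lt_of_le hk hj h1 h2 (a₀_le t ht) hcat_lt hL
    exact (hc ((critical_lt_one hk hj).2 ((a₀_le t ht).trans_lt hcat_lt))).not_gt h5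
  · have hcomp : IsCompact (Set.Icc y₀ t ∩ {s | 0 ≤ φ s}) :=
      isCompact_Icc.inter_right (isClosed_le continuous_const hφc)
    obtain ⟨s, ⟨hs, hs0⟩, hgt⟩ := hcomp.exists_isGreatest
      ⟨y₀, ⟨le_rfl, ht.1⟩, by simp only [Set.mem_ofPred_eq, φ, ca0, cb0]; linarith⟩
    have hst : s < t := hs.2.lt_of_ne fun h => by
      rw [h] at hs0; exact (hs0 : (0 : ℝ) ≤ φ t).not_gt hφt
    have hneg : ∀ r ∈ Set.Ioo s t, φ r < 0 := fun r hr => by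
      by_contra! hc
      exact (hgt ⟨⟨hs.1.trans hr.1.le, hr.2.le⟩, hc⟩).not_gt hr.1
    have hs1 : s ∈ Set.Icc y₀ 1 := ⟨hs.1, hs.2.trans ht.2⟩
    have hsI : s ∈ Set.Ioo (0 : ℝ) 1 := ⟨y₀pos.trans_le hs.1, hst.trans ht1⟩
    have hφs : φ s = 0 := by
      refine le_antisymm (le_of_not_gt fun hpos => ?_) hs0
      have := (hφc.tendsto s).eventually (eventually_gt_nhds hpos)
      obtain ⟨r, hr1, hr2⟩ :=
        ((this.filter_mono nhdsWithin_le_nhds).and (Ioo_mem_nhdsGT hst)).exists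
      exact (hneg r hr2).not_gt hr1
    have hcas := ca_mono s hs
    have hLs := leftWeight_lt_of_le hk hj (h1.trans (a₀_le s hs1)) (h2.trans (a₀_le s hs1))
      hcas hcat_lt hL
    have hms : ((k : ℝ) + 2) / (k + 2 + j) ≤ critical k j (ca s) :=
      mean_le_critical hk (h1.trans (a₀_le s hs1))
    have hcs1 : critical k j (ca s) < 1 := (critical_lt_one hk hj).2 (hcas.trans_lt hcat_lt)
    have hcbs := (hasDerivAt_quantile hk2 hkn2 hcb cb_spec hsI).1
    have hbs : critical k j (ca s) < cb s := by
      by_contra! hc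
      have h3 := (rightWeight_strictAntiOn (k := k) hj).antitoneOn
        ⟨hc2.trans (b₀_le s hs1), hcbs.2.le⟩ ⟨hms, hcs1.le⟩ hc
      have h4 : leftWeight k j (ca s) - rightWeight k j (cb s) = 0 := hφs
      linarith
    obtain ⟨r, hr, hr'⟩ := exists_lt_of_hasDerivAt_neg (hder s hsI).neg
      (neg_lt_zero.2 (mul_pos hcst (by linarith))) hst
    have h6 := hneg r hr
    simp only [Pi.neg_apply, hφs] at hr'
    linarith

/-- Each side uses the form of `prim` that collapses at its quantile; the two remaining terms are
the weights up to one common positive factor. -/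
theorem prim_le_prim_of_weight {n k j : ℕ} (hn : n = k + 1 + j) {y a b : ℝ}
    (ha : tail n k a = y) (hb : tail n (k + 2) b = y)
    (h : rightWeight k j b ≤ leftWeight k j a) :
    prim n (k + 1) y b ≤ prim n (k + 1) y a := by
  rw [prim_eq (by omega) y a, ha]
  unfold prim
  rw [hb]
  subst hn
  unfold binomialProb
  have h1 := Nat.choose_succ_right_eq (k + 1 + j) k
  rw [show k + 1 + j - k = j + 1 by omega] at h1
  have h1' : ((k + 1 + j).choose (k + 1) : ℝ) = (k + 1 + j).choose k * (j + 1) / (k + 1) := by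
    rw [eq_div_iff (by positivity)]
    exact_mod_cast h1
  rw [h1', show k + 1 + j - k = j + 1 by omega, show k + 1 + j - (k + 1) = j by omega]
  unfold leftWeight rightWeight at h
  have hd : (0 : ℝ) < (k + 1) * (k + j + 2) := by positivity
  have hC : (0 : ℝ) ≤ ((k + 1 + j).choose k : ℝ) := Nat.cast_nonneg _
  push_cast
  have e : ∀ A B : ℝ, A = ((k + 1 + j).choose k : ℝ) / ((k + 1) * (k + j + 2)) *
      (((j : ℝ) + 1) ^ 2 * (b ^ (k + 2) * (1 - b) ^ j)) →
      B = ((k + 1 + j).choose k : ℝ) / ((k + 1) * (k + j + 2)) *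
      (((k : ℝ) + 1) ^ 2 * (a ^ k * (1 - a) ^ (j + 2))) → A ≤ B := fun A B hA hB => by
    rw [hA, hB]
    exact mul_le_mul_of_nonneg_left h (by positivity)
  apply e
  · field_simp
    ring
  · field_simp
    ring

/-! ### Integer tests for evaluation in the kernel -/

/-- Application of `f` to `x`, with `x` evaluated first in kernel reduction. -/
def force {β : Type} (x : ℕ) (f : ℕ → β) : β :=
  Nat.rec (motive := fun _ => β) (f 0) (fun p _ => f (Nat.succ p)) x

/-- Whether `f m` holds for all `m < N`. -/
def allBelow (N : ℕ) (f : ℕ → Bool) : Bool :=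
  Nat.rec (motive := fun _ => Bool) true (fun m ih => f m && ih) N

/-- Horner evaluation of a partial binomial sum, started after `d` terms with value `P` and last
term `t`. -/
def tailLoop (n A B : ℕ) (J : ℕ) : ℕ → ℕ → ℕ → ℕ :=
  Nat.rec (motive := fun _ => ℕ → ℕ → ℕ → ℕ) (fun _ P _ => P)
    (fun _ ih d P t =>
      force (Nat.div (Nat.mul (Nat.mul t (Nat.sub n d)) B) (Nat.add d 1)) fun t' =>
      force (Nat.add (Nat.mul P A) t') fun P' => force (Nat.add d 1) fun d' => ih d' P' t') J

/-- `∑ d ≤ J, n.choose d * B ^ d * A ^ (J - d)`, the tail `tail n (n - J) (A / (A + B))` up to the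
factor `(A + B) ^ n / A ^ (n - J)`. -/
def tailSum (n A B J : ℕ) : ℕ := tailLoop n A B J 0 1 1

/-- Test for `tail n (n - J) (A / (A + B)) ≤ 73 / 100`. -/
def tailLe (n A B J : ℕ) : Bool :=
  Nat.ble (Nat.mul 100 (Nat.mul (tailSum n A B J) (Nat.pow A (Nat.sub n J))))
    (Nat.mul 73 (Nat.pow (Nat.add A B) n))

/-- Test for `73 / 100 ≤ tail n (n - J) (A / (A + B))`. -/
def leTail (n A B J : ℕ) : Bool :=
  Nat.ble (Nat.mul 73 (Nat.pow (Nat.add A B) n))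
    (Nat.mul 100 (Nat.mul (tailSum n A B J) (Nat.pow A (Nat.sub n J))))

/-- Test for `critical k j a < 1 → rightWeight k j (critical k j a) ≤ leftWeight k j a` at
`a = A / (A + B)`. -/
def criticalLe (k j A B : ℕ) : Bool :=
  force (Nat.add A B) fun D =>
  force (Nat.add (Nat.mul (Nat.mul j (Nat.add k 1)) A) (Nat.mul k D)) fun r =>
  force (Nat.mul (Nat.mul k D) (Nat.add j 1)) fun s =>
  Nat.ble s r ||
    Nat.ble (Nat.mul (Nat.mul (Nat.pow (Nat.add j 1) 2)
        (Nat.mul (Nat.pow r (Nat.add k 2)) (Nat.pow (Nat.sub s r) j)))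
        (Nat.pow D (Nat.add (Nat.add k j) 2)))
      (Nat.mul (Nat.mul (Nat.pow (Nat.add k 1) 2)
        (Nat.mul (Nat.pow A k) (Nat.pow B (Nat.add j 2))))
        (Nat.pow s (Nat.add (Nat.add k j) 2)))

/-- Lower bound for a multiple of the sum of `n.choose y * A ^ y * B ^ (n - y)` over `y < x`, with
`T` terms computed from the term `t` for `x`, and added to `P`. -/
def headLoop (n A B : ℕ) (T : ℕ) : ℕ → ℕ → ℕ → ℕ :=
  Nat.rec (motive := fun _ => ℕ → ℕ → ℕ → ℕ) (fun _ _ P => P)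
    (fun _ ih x t P =>
      force (Nat.div (Nat.mul (Nat.mul t x) B) (Nat.mul (Nat.sub (Nat.add n 1) x) A)) fun t' =>
      force (Nat.add P t') fun P' => force (Nat.sub x 1) fun x' => ih x' t' P') T

/-- Test of the weights at the left quantile `A / (A + B)`, with `C` at most `n.choose x` for
`x = k - 1`. -/
def checkAt (n x k j A B T C : ℕ) : Bool :=
  Nat.ble (Nat.mul k (Nat.add A B)) (Nat.mul A (Nat.add (Nat.add k j) 2)) &&
  Nat.ble (Nat.mul (Nat.mul k k) (Nat.add A B)) (Nat.mul A (Nat.mul (Nat.add k 1) (Nat.add k j))) &&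
  Nat.ble 270000000000 (force (Nat.div (Nat.mul 1000000000000
      (Nat.mul (Nat.mul C (Nat.pow A x)) (Nat.pow B (Nat.sub n x)))) (Nat.pow (Nat.add A B) n))
    fun t => headLoop n A B T x t t) &&
  criticalLe k j A B

/-- An integer square root by Newton's method, for arguments of moderate size. -/
def newtonSqrt (v : ℕ) : ℕ :=
  Nat.rec (motive := fun _ => ℕ → ℕ) (fun x => x)
    (fun _ ih x => force (Nat.div (Nat.add x (Nat.div v x)) 2) ih) 4 300

/-- A left quantile of order slightly less than `73 / 100`, as `A / (100 * (n - 1))`. -/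
def leftNumerator (n j : ℕ) : ℕ :=
  Nat.sub (Nat.mul 100 (Nat.sub n 1)) (Nat.add (Nat.sub (Nat.mul 100 (Nat.add j 1))
    (newtonSqrt (Nat.div (Nat.mul (Nat.mul 3721 j) (Nat.sub n j)) n))) 55)

/-- Numerators `(s, b, c)` approximating the complementary quantile of order `73 / 100`: it is about
`n * s / (10 * (1000 * n ^ 2 + n * (157 - b) + (8 - c)))`. -/
def quantileTable : List (ℕ × ℕ × ℕ) :=
  [(3147, 0, 0), (10157, 148, 107), (18023, 253, 292), (26276, 337, 540), (34760, 409, 848),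
    (43402, 472, 1216), (52162, 528, 1647), (61014, 579, 2143), (69941, 625, 2709),
    (78927, 672, 3246), (87965, 717, 3817), (97048, 760, 4423), (106170, 801, 5062),
    (115327, 840, 5732), (124514, 877, 6434), (133729, 913, 7167), (142968, 948, 7930),
    (152231, 982, 8722), (161514, 1014, 9544), (170817, 1046, 10394)]

/-- The test of the weights at a pair of approximate quantiles. -/
def weightLe (k j n A B A' B' : ℕ) : Bool :=
  leTail n A B (Nat.add j 1) && tailLe n A' B' (Nat.sub j 1) &&
  Nat.ble (Nat.mul (Nat.add k 2) (Nat.add A' B')) (Nat.mul A' (Nat.add n 1)) &&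
  Nat.ble (Nat.mul (Nat.pow (Nat.add j 1) 2) (Nat.mul (Nat.mul (Nat.pow A' (Nat.add k 2))
      (Nat.pow B' j)) (Nat.pow (Nat.add A B) (Nat.add n 1))))
    (Nat.mul (Nat.pow (Nat.add k 1) 2) (Nat.mul (Nat.mul (Nat.pow A k)
      (Nat.pow B (Nat.add j 2))) (Nat.pow (Nat.add A' B') (Nat.add n 1))))

/-- The test of the weights for `j < k` with `j` small. -/
def checkTop (k j : ℕ) (q q' : ℕ × ℕ × ℕ) : Bool :=
  force (Nat.add (Nat.add k j) 1) fun n =>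
  force (Nat.mul 10 (Nat.sub (Nat.add (Nat.mul 1000 (Nat.mul n n)) (Nat.add (Nat.mul 157 n) 8))
    (Nat.add (Nat.mul n q.2.1) q.2.2))) fun D =>
  force (Nat.mul 10 (Nat.sub (Nat.add (Nat.mul 1000 (Nat.mul n n)) (Nat.add (Nat.mul 157 n) 8))
    (Nat.add (Nat.mul n q'.2.1) q'.2.2))) fun D' =>
  -- The margins of `20` move the left approximation up and the right one down, to the sides that
  -- `weightLe` tests.
  force (Nat.mul (Nat.sub q.1 20) n) fun B => force (Nat.mul (Nat.add q'.1 20) n) fun B' =>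
  force (Nat.mul k k) fun A₀ =>
  force (Nat.sub (Nat.mul (Nat.add k 1) (Nat.add k j)) A₀) fun B₀ =>
  Nat.ble A₀ (Nat.mul (Nat.add k 1) (Nat.add k j)) && Nat.ble (Nat.add B 1) D && Nat.ble (Nat.add B' 1) D' &&
  tailLe n A₀ B₀ (Nat.add j 1) && force (Nat.sub D B) fun A => force (Nat.sub D' B') fun A' =>
    weightLe k j n A B A' B'

/-- The test of the weights for `k = x + 1` and `j = n - 1 - k`, with `C` at most `n.choose x`. -/
def checkWeights (n x C : ℕ) : Bool :=
  force (Nat.add x 1) fun k => force (Nat.sub (Nat.sub n 1) k) fun j =>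
  -- `Bool.rec` takes the `false` branch first: `18 < j < k`, then `j < k` with `j ≤ 18`, and last
  -- `k ≤ j`, where the mode `k / (k + j + 2)` of the left weight itself serves as left quantile.
  Bool.rec
    (Bool.rec
      (force (leftNumerator n j) fun A => force (Nat.sub (Nat.mul 100 (Nat.sub n 1)) A) fun B =>
        checkAt n x k j A B 10 C)
      (checkTop k j (quantileTable.getD (Nat.add j 1) (0, 0, 0))
        (quantileTable.getD (Nat.sub j 1) (0, 0, 0))) (Nat.ble j 18))
    (force (Nat.add j 2) fun B => checkAt n x k j k B 5 C) (Nat.ble k j)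

/-- The tests of the weights for `T` values of `x`, with lower bounds `C` for `n.choose x`. -/
def rowLoop (n : ℕ) (T : ℕ) : ℕ → ℕ → Bool :=
  Nat.rec (motive := fun _ => ℕ → ℕ → Bool) (fun _ _ => true)
    (fun _ ih x C => checkWeights n x C &&
      force (Nat.add x 1) fun x' => force (Nat.div (Nat.mul C (Nat.sub n x)) x') fun C' =>
        ih x' C') T

/-- The tests of the weights for all `n` with `N ≤ n < N + M`. -/
def checkRows (N M : ℕ) : Bool :=
  allBelow M fun m => force (Nat.add N m) fun n => force (Nat.sub n 2) fun T => rowLoop n T 0 1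

/-- The five ranges cover `3 ≤ n ≤ 200`; `3` is the least `k + 1 + j` with `k, j ≥ 1`. -/
theorem checkRows_3 : checkRows 3 77 = true := by decide +kernel
theorem checkRows_80 : checkRows 80 40 = true := by decide +kernel
theorem checkRows_120 : checkRows 120 30 = true := by decide +kernel
theorem checkRows_150 : checkRows 150 30 = true := by decide +kernel
theorem checkRows_180 : checkRows 180 21 = true := by decide +kernel

/-- The test for the penultimate end point on the interval from `1 - s / D` to `1 - t / D`, with
`1 - r / D` as a lower bound of the next end point. -/
def checkCell (n D s t r : ℕ) : Bool :=
  force (Nat.sub D s) fun X => force (Nat.sub D t) fun Y => force (Nat.sub D r) fun W =>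
  Nat.ble s r && Nat.ble t s && Nat.ble r D &&
  Nat.ble (Nat.add (Nat.mul (Nat.mul (Nat.pow W n) (Nat.sub (Nat.mul (Nat.add n 1) D)
      (Nat.mul (Nat.sub n 1) W))) t) (Nat.mul (Nat.pow D (Nat.add n 1)) (Nat.sub r s)))
    (Nat.add (Nat.mul (Nat.mul (Nat.pow X n) (Nat.sub (Nat.mul (Nat.add n 1) D)
      (Nat.mul (Nat.sub n 1) X))) t) (Nat.mul (Nat.pow Y (Nat.add n 1)) (Nat.sub r s))) &&
  Nat.ble (Nat.add (Nat.mul (Nat.add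
      (Nat.mul (Nat.pow Y (Nat.sub n 1)) (Nat.sub (Nat.mul n D) (Nat.mul (Nat.sub n 1) Y)))
      (Nat.mul (Nat.pow W (Nat.sub n 1)) (Nat.sub (Nat.mul n D) (Nat.mul (Nat.sub n 1) W))))
      (Nat.mul (Nat.add n 1) s)) (Nat.add (Nat.mul 2 (Nat.pow X (Nat.add n 1))) 1))
    (Nat.mul 2 (Nat.pow D (Nat.add n 1))) &&
  Nat.ble (Nat.pow D (Nat.add n 1)) (Nat.add (Nat.pow Y (Nat.add n 1))
    (Nat.mul (Nat.mul (Nat.pow X (Nat.sub n 1)) (Nat.sub (Nat.mul n D) (Nat.mul (Nat.sub n 1) X)))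
      (Nat.mul (Nat.add n 1) t)))

/-- The tests for the penultimate end point for `n` trials. -/
def checkPenultimate (n : ℕ) : Bool :=
  force (Nat.mul (Nat.sub n 1) 100000) fun D =>
  Nat.ble (Nat.mul 100 (Nat.pow D (Nat.add n 1)))
    (Nat.add (Nat.mul 100 (Nat.pow (Nat.sub D 66260) (Nat.add n 1)))
      (Nat.mul 73 (Nat.mul (Nat.mul (Nat.add n 1) 66260) (Nat.pow D n)))) &&
  Nat.ble (Nat.add (Nat.mul (Nat.mul (Nat.mul 2 (Nat.pow (Nat.sub n 2) (Nat.sub n 1)))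
      (Nat.mul (Nat.add n 1) 65000)) (Nat.pow D n))
      (Nat.mul (Nat.pow (Nat.sub n 1) (Nat.sub n 1)) (Nat.pow (Nat.sub D 65000) (Nat.add n 1))))
    (Nat.mul (Nat.pow (Nat.sub n 1) (Nat.sub n 1)) (Nat.pow D (Nat.add n 1))) &&
  -- The `63` cells of width `20` lead from `65000` exactly to `66260`. Nothing about the formula
  -- for `r` is used beyond the tests that it passes.
  allBelow 63 fun m => force (Nat.add 65000 (Nat.mul 20 m)) fun t => force (Nat.add t 20) fun s =>
    checkCell n D s t (Nat.sub (Nat.add 135144 (Nat.div (Nat.mul 807 (Nat.sub s 65000)) 1000))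
      (Nat.div 63423 n))

theorem checkPenultimate_eq_true :
    (allBelow 135 fun m => force (Nat.add 66 m) checkPenultimate) = true := by decide +kernel

/-- Test for `tail n (n - 1) ((n - 2) / (n - 1)) ≤ 73 / 100`. -/
def checkMode (n : ℕ) : Bool :=
  Nat.ble (Nat.mul 200 (Nat.pow (Nat.sub n 2) (Nat.sub n 1)))
    (Nat.mul 73 (Nat.pow (Nat.sub n 1) (Nat.sub n 1)))

theorem checkMode_eq_true :
    (allBelow 62 fun m => force (Nat.add 4 m) checkMode) = true := by decide +kernel

/-- The tests for the first step, with left quantile at least `(10 n - 11) / (10 n)`. -/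
def checkFirst (n : ℕ) : Bool :=
  Nat.ble (Nat.mul 100 (Nat.mul (Nat.pow (Nat.sub (Nat.mul 10 n) 11) (Nat.sub n 1))
      (Nat.sub (Nat.mul 21 n) 11)))
    (Nat.mul 73 (Nat.pow (Nat.mul 10 n) n)) &&
  Nat.ble (Nat.mul 100 (Nat.pow (Nat.mul 10 n) n))
    (Nat.mul (Nat.pow (Nat.sub (Nat.mul 10 n) 11) (Nat.sub n 1))
      (Nat.add (Nat.mul 1210 n) (Nat.mul 100 (Nat.sub (Nat.mul 21 n) 11))))

/-- The test for the last step. -/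
def checkLast (n : ℕ) : Bool :=
  Nat.ble (Nat.mul (Nat.mul 400 (Nat.mul n n)) (Nat.pow (Nat.sub n 1) (Nat.sub n 1)))
    (Nat.mul 73 (Nat.pow (Nat.add n 1) (Nat.add n 1)))

theorem checkFirst_eq_true :
    (allBelow 199 fun m => force (Nat.add 2 m) checkFirst) = true := by decide +kernel

theorem checkLast_eq_true :
    (allBelow 199 fun m => force (Nat.add 2 m) checkLast) = true := by decide +kernel

/-! ### Soundness of the tests of the weights -/

theorem force_eq {β : Type} (x : ℕ) (f : ℕ → β) : force x f = f x := by
  cases x <;> rfl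

theorem allBelow_spec {N : ℕ} {f : ℕ → Bool} (h : allBelow N f = true) {m : ℕ} (hm : m < N) :
    f m = true := by
  induction N with
  | zero => omega
  | succ N ih =>
    have h' : (f N && allBelow N f) = true := h
    rw [Bool.and_eq_true] at h'
    rcases Nat.lt_succ_iff_lt_or_eq.1 hm with h1 | rfl
    · exact ih h'.2 h1
    · exact h'.1

/-- The integer numerator of `binomialProb n x (A / (A + B))`. -/
def weight (n A B x : ℕ) : ℕ := n.choose x * A ^ x * B ^ (n - x)

theorem weight_succ_mul (n A B m : ℕ) :
    weight n A B (m + 1) * (m + 1) * B = weight n A B m * ((n - m) * A) := by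
  unfold weight
  have h1 := Nat.choose_succ_right_eq n m
  rcases Nat.lt_or_ge m n with h | h
  · have h2 : n - m = (n - (m + 1)) + 1 := by omega
    calc n.choose (m + 1) * A ^ (m + 1) * B ^ (n - (m + 1)) * (m + 1) * B
        = (n.choose (m + 1) * (m + 1)) * A ^ (m + 1) * B ^ (n - (m + 1) + 1) := by ring
      _ = (n.choose m * (n - m)) * A ^ (m + 1) * B ^ (n - m) := by rw [h1, ← h2]
      _ = _ := by ring
  · rw [Nat.choose_eq_zero_of_lt (by omega : n < m + 1), Nat.sub_eq_zero_of_le h]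
    simp

theorem one_sub_div_add {A B : ℕ} (h : 0 < A + B) :
    1 - (A : ℝ) / ((A : ℝ) + B) = B / ((A : ℝ) + B) := by
  have h : (0 : ℝ) < (A : ℝ) + B := by exact_mod_cast h
  field_simp
  ring

theorem binomialProb_div {n A B x : ℕ} (h : 0 < A + B) (hx : x ≤ n) :
    binomialProb n x ((A : ℝ) / ((A : ℝ) + B)) * ((A : ℝ) + B) ^ n = weight n A B x := by
  have hD : (0 : ℝ) < (A : ℝ) + B := by exact_mod_cast h
  unfold binomialProb weight
  rw [one_sub_div_add h, div_pow, div_pow]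
  obtain ⟨d, rfl⟩ := Nat.exists_eq_add_of_le hx
  rw [Nat.add_sub_cancel_left, pow_add]
  push_cast
  field_simp

theorem tail_div {n A B i : ℕ} (h : 0 < A + B) :
    tail n i ((A : ℝ) / ((A : ℝ) + B)) * ((A : ℝ) + B) ^ n =
      ((∑ x ∈ Finset.Icc i n, weight n A B x : ℕ) : ℝ) := by
  unfold tail
  rw [Finset.sum_mul]
  push_cast
  exact Finset.sum_congr rfl fun x hx => binomialProb_div h (Finset.mem_Icc.1 hx).2

theorem sum_weight_add {n A B k : ℕ} (hk : k ≤ n) :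
    ∑ x ∈ Finset.range k, weight n A B x + ∑ x ∈ Finset.Icc k n, weight n A B x = (A + B) ^ n := by
  rw [add_pow, ← Finset.Ico_add_one_right_eq_Icc,
    Finset.sum_range_add_sum_Ico _ (by omega : k ≤ n + 1)]
  exact Finset.sum_congr rfl fun x _ => by unfold weight; rw [Nat.cast_id]; ring

/-- The division in this loop is exact, because `d + 1` divides `n.choose d * (n - d)`; hence an
equality. -/
theorem tailLoop_eq (n A B J d : ℕ) :
    tailLoop n A B J d (∑ e ∈ Finset.range (d + 1), n.choose e * B ^ e * A ^ (d - e))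
      (n.choose d * B ^ d) =
    ∑ e ∈ Finset.range (d + J + 1), n.choose e * B ^ e * A ^ (d + J - e) := by
  induction J generalizing d with
  | zero => rfl
  | succ J ih =>
    have h : ∀ P t, tailLoop n A B (J + 1) d P t =
        tailLoop n A B J (d + 1) (P * A + t * (n - d) * B / (d + 1)) (t * (n - d) * B / (d + 1)) :=
      fun P t => by
        change force (t * (n - d) * B / (d + 1)) (fun t' => force (P * A + t') fun P' =>
          force (d + 1) fun d' => tailLoop n A B J d' P' t') = _
        simp only [force_eq]
    have e1 : n.choose d * B ^ d * (n - d) * B / (d + 1) = n.choose (d + 1) * B ^ (d + 1) := by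
      refine Nat.div_eq_of_eq_mul_left (Nat.succ_pos d) ?_
      have := Nat.choose_succ_right_eq n d
      calc n.choose d * B ^ d * (n - d) * B = (n.choose d * (n - d)) * B ^ (d + 1) := by ring
        _ = _ := by rw [← this]; ring
    have e2 : (∑ e ∈ Finset.range (d + 1), n.choose e * B ^ e * A ^ (d - e)) * A +
        n.choose (d + 1) * B ^ (d + 1) =
        ∑ e ∈ Finset.range (d + 1 + 1), n.choose e * B ^ e * A ^ (d + 1 - e) := by
      rw [Finset.sum_range_succ _ (d + 1), Nat.sub_self, pow_zero, mul_one, Finset.sum_mul]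
      congr 1
      refine Finset.sum_congr rfl fun e he => ?_
      rw [Nat.succ_sub (by have := Finset.mem_range.1 he; omega), pow_succ]
      ring
    rw [h, e1, e2, ih (d + 1), show d + 1 + J = d + (J + 1) by omega]

theorem tailSum_mul {n A B J : ℕ} (hJ : J ≤ n) :
    tailSum n A B J * A ^ (n - J) = ∑ x ∈ Finset.Icc (n - J) n, weight n A B x := by
  have h := tailLoop_eq n A B J 0
  simp only [zero_add, Finset.sum_range_one, Nat.choose_zero_right, pow_zero, mul_one,
    Nat.sub_self] at h
  unfold tailSum
  rw [h, Finset.sum_mul]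
  refine Finset.sum_bij' (fun e _ => n - e) (fun x _ => n - x) ?_ ?_ ?_ ?_ ?_
  · intro e he; have := Finset.mem_range.1 he; simp only [Finset.mem_Icc]; omega
  · intro x hx; have := Finset.mem_Icc.1 hx; simp only [Finset.mem_range]; omega
  · intro e he; have := Finset.mem_range.1 he; omega
  · intro x hx; have := Finset.mem_Icc.1 hx; omega
  · intro e he
    have := Finset.mem_range.1 he
    unfold weight
    rw [Nat.choose_symm (by omega), show n - (n - e) = e by omega, mul_assoc, ← pow_add,
      show J - e + (n - J) = n - e by omega]
    ring

theorem tail_le_of_tailLe {n A B J : ℕ} (hAB : 0 < A + B) (hJ : J ≤ n)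
    (h : tailLe n A B J = true) :
    tail n (n - J) ((A : ℝ) / ((A : ℝ) + B)) ≤ 73 / 100 := by
  have h1 := Nat.le_of_ble_eq_true h
  have h2 : 100 * (tailSum n A B J * A ^ (n - J)) ≤ 73 * (A + B) ^ n := h1
  rw [tailSum_mul hJ] at h2
  have h3 : (100 : ℝ) * ((∑ x ∈ Finset.Icc (n - J) n, weight n A B x : ℕ) : ℝ) ≤
      73 * ((A : ℝ) + B) ^ n := by exact_mod_cast h2
  rw [← tail_div hAB] at h3
  have hD : (0 : ℝ) < ((A : ℝ) + B) ^ n := pow_pos (by exact_mod_cast hAB) n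
  nlinarith

theorem le_tail_of_leTail {n A B J : ℕ} (hAB : 0 < A + B) (hJ : J ≤ n)
    (h : leTail n A B J = true) :
    73 / 100 ≤ tail n (n - J) ((A : ℝ) / ((A : ℝ) + B)) := by
  have h1 := Nat.le_of_ble_eq_true h
  have h2 : 73 * (A + B) ^ n ≤ 100 * (tailSum n A B J * A ^ (n - J)) := h1
  rw [tailSum_mul hJ] at h2
  have h3 : 73 * ((A : ℝ) + B) ^ n ≤
      100 * ((∑ x ∈ Finset.Icc (n - J) n, weight n A B x : ℕ) : ℝ) := by exact_mod_cast h2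
  rw [← tail_div hAB] at h3
  have hD : (0 : ℝ) < ((A : ℝ) + B) ^ n := pow_pos (by exact_mod_cast hAB) n
  nlinarith

/-- Every division rounds down and only `T` terms are added, so the loop can only underestimate. `S
/ M` is the scale of the fixed-point numbers, `10 ^ 12 / (A + B) ^ n` in the application. -/
theorem headLoop_mul_le {n A B : ℕ} (S M : ℕ) (T x t P : ℕ) (ht : M * t ≤ S * weight n A B x) (hx : x ≤ n) :
    M * headLoop n A B T x t P ≤ M * P + S * ∑ y ∈ Finset.range x, weight n A B y := by
  induction T generalizing x t P with
  | zero => exact Nat.le_add_right _ _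
  | succ T ih =>
    have h : headLoop n A B (T + 1) x t P = headLoop n A B T (x - 1)
        (t * x * B / ((n + 1 - x) * A)) (P + t * x * B / ((n + 1 - x) * A)) := by
      change force (t * x * B / ((n + 1 - x) * A)) (fun t' => force (P + t') fun P' =>
        force (x - 1) fun x' => headLoop n A B T x' t' P') = _
      simp only [force_eq]
    rw [h]
    rcases x with _ | m
    · have := ih 0 0 P (by simp) (Nat.zero_le n)
      simpa using this
    · set t' := t * (m + 1) * B / ((n + 1 - (m + 1)) * A) with ht'
      have h1 : M * t' ≤ S * weight n A B m := by
        rcases Nat.eq_zero_or_pos ((n + 1 - (m + 1)) * A) with h0 | h0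
        · rw [ht', h0, Nat.div_zero, mul_zero]; exact Nat.zero_le _
        · refine Nat.le_of_mul_le_mul_right (c := (n + 1 - (m + 1)) * A) ?_ h0
          calc M * t' * ((n + 1 - (m + 1)) * A) = M * (t' * ((n + 1 - (m + 1)) * A)) := by ring
            _ ≤ M * (t * (m + 1) * B) := Nat.mul_le_mul_left _ (Nat.div_mul_le_self _ _)
            _ = (M * t) * ((m + 1) * B) := by ring
            _ ≤ (S * weight n A B (m + 1)) * ((m + 1) * B) := Nat.mul_le_mul_right _ ht
            _ = S * (weight n A B (m + 1) * (m + 1) * B) := by ring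
            _ = S * (weight n A B m * ((n - m) * A)) := by rw [weight_succ_mul]
            _ = _ := by rw [show n + 1 - (m + 1) = n - m by omega]; ring
      have h2 := ih m t' (P + t') h1 (by omega)
      rw [Finset.sum_range_succ]
      rw [Nat.add_sub_cancel]
      nlinarith

theorem criticalLe_spec {k j A B : ℕ} (hk : 1 ≤ k) (hAB : 0 < A + B)
    (h : criticalLe k j A B = true) :
    critical k j ((A : ℝ) / ((A : ℝ) + B)) < 1 →
      rightWeight k j (critical k j ((A : ℝ) / ((A : ℝ) + B))) ≤
        leftWeight k j ((A : ℝ) / ((A : ℝ) + B)) := by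
  intro hlt
  have hk' : (0 : ℝ) < k := by exact_mod_cast hk
  have hD : (0 : ℝ) < (A : ℝ) + B := by exact_mod_cast hAB
  unfold criticalLe at h
  simp only [force_eq, Bool.or_eq_true, Nat.ble_eq, Nat.add_eq, Nat.mul_eq, Nat.sub_eq,
    Nat.pow_eq] at h
  obtain ⟨D, hDdef⟩ : ∃ D, D = A + B := ⟨_, rfl⟩
  have hDR : (A : ℝ) + B = D := by rw [hDdef]; push_cast; ring
  have hBR : (B : ℝ) = D - A := by linarith
  rw [← hDdef] at h
  rw [hDR] at hlt hD ⊢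
  obtain ⟨r, hr⟩ : ∃ r, r = j * (k + 1) * A + k * D := ⟨_, rfl⟩
  obtain ⟨s, hs⟩ : ∃ s, s = k * D * (j + 1) := ⟨_, rfl⟩
  rw [← hr, ← hs] at h
  have hrR : (r : ℝ) = j * (k + 1) * A + k * D := by rw [hr]; push_cast; ring
  have hsR : (s : ℝ) = k * D * (j + 1) := by rw [hs]; push_cast; ring
  have hs0 : (0 : ℝ) < s := by rw [hsR]; positivity
  have hcrit : critical k j ((A : ℝ) / D) = r / s := by
    rw [hrR, hsR]
    unfold critical
    field_simp
  rw [hcrit] at hlt ⊢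
  have hrs : r < s := by
    rw [div_lt_one hs0] at hlt
    exact_mod_cast hlt
  rcases h with h | h
  · omega
  have h' : (((j : ℝ) + 1) ^ 2 * ((r : ℝ) ^ (k + 2) * ((s : ℝ) - r) ^ j)) * (D : ℝ) ^ (k + j + 2) ≤
      (((k : ℝ) + 1) ^ 2 * ((A : ℝ) ^ k * (B : ℝ) ^ (j + 2))) * (s : ℝ) ^ (k + j + 2) := by
    rw [← Nat.cast_sub hrs.le]
    exact_mod_cast h
  unfold rightWeight leftWeight
  have e1 : 1 - (r : ℝ) / s = (s - r) / s := by field_simp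
  have e2 : 1 - (A : ℝ) / D = B / D := by rw [hBR]; field_simp
  rw [e1, e2]
  have e3 : ((j : ℝ) + 1) ^ 2 * ((r / s : ℝ) ^ (k + 2) * (((s : ℝ) - r) / s) ^ j) =
      (((j : ℝ) + 1) ^ 2 * ((r : ℝ) ^ (k + 2) * ((s : ℝ) - r) ^ j)) / (s : ℝ) ^ (k + j + 2) := by
    rw [div_pow, div_pow, show k + j + 2 = (k + 2) + j by omega, pow_add _ (k + 2) j]
    field_simp
  have e4 : ((k : ℝ) + 1) ^ 2 * ((A / D : ℝ) ^ k * ((B : ℝ) / D) ^ (j + 2)) =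
      (((k : ℝ) + 1) ^ 2 * ((A : ℝ) ^ k * (B : ℝ) ^ (j + 2))) / (D : ℝ) ^ (k + j + 2) := by
    rw [div_pow, div_pow, show k + j + 2 = k + (j + 2) by omega, pow_add _ k (j + 2)]
    field_simp
  rw [e3, e4, div_le_div_iff₀ (by positivity) (by positivity)]
  exact h'

/-- Quantiles of an order of at most `73 / 100` at which the comparison of the weights starts. -/
def HasStart (k j : ℕ) : Prop :=
  ∃ a₀ b₀ : ℝ, a₀ ∈ Set.Icc (0 : ℝ) 1 ∧ b₀ ∈ Set.Icc (0 : ℝ) 1 ∧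
    tail (k + 1 + j) k a₀ = tail (k + 1 + j) (k + 2) b₀ ∧ tail (k + 1 + j) k a₀ ≤ 73 / 100 ∧
    (k : ℝ) / (k + j + 2) ≤ a₀ ∧ (k : ℝ) ^ 2 / ((k + 1) * (k + j)) ≤ a₀ ∧
    ((critical k j a₀ < 1 → rightWeight k j (critical k j a₀) ≤ leftWeight k j a₀) ∨
      (rightWeight k j b₀ ≤ leftWeight k j a₀ ∧ ((k : ℝ) + 2) / (k + 2 + j) ≤ b₀))

theorem div_add_mem_Icc {A B : ℕ} :
    (A : ℝ) / ((A : ℝ) + B) ∈ Set.Icc (0 : ℝ) 1 := by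
  have hA : (0 : ℝ) ≤ A := Nat.cast_nonneg A
  have hB : (0 : ℝ) ≤ B := Nat.cast_nonneg B
  exact ⟨by positivity, div_le_one_of_le₀ (by linarith) (by positivity)⟩

theorem hasStart_of_checkAt {x j A B T C : ℕ} (hj : 1 ≤ j)
    (hC : C ≤ (x + 1 + 1 + j).choose x) (hAB : 0 < A + B)
    (h : checkAt (x + 1 + 1 + j) x (x + 1) j A B T C = true) : HasStart (x + 1) j := by
  unfold checkAt at h
  simp only [force_eq, Bool.and_eq_true, Nat.ble_eq, Nat.add_eq, Nat.mul_eq, Nat.sub_eq,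
    Nat.pow_eq] at h
  obtain ⟨⟨⟨h1, h2⟩, h3⟩, h4⟩ := h
  obtain ⟨n, hn⟩ : ∃ n, n = x + 1 + 1 + j := ⟨_, rfl⟩
  obtain ⟨k, hk⟩ : ∃ k, k = x + 1 := ⟨_, rfl⟩
  rw [← hn] at h3 hC
  rw [← hk] at h1 h2 h4 hn ⊢
  have hD : (0 : ℝ) < (A : ℝ) + B := by exact_mod_cast hAB
  have hkR : (1 : ℝ) ≤ k := by exact_mod_cast (by omega : 1 ≤ k)
  have hjR : (1 : ℝ) ≤ j := by exact_mod_cast hj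
  set a₀ := (A : ℝ) / ((A : ℝ) + B) with ha₀
  have hm : a₀ ∈ Set.Icc (0 : ℝ) 1 := div_add_mem_Icc
  have htail : tail n k a₀ ≤ 73 / 100 := by
    set t := 1000000000000 * (C * A ^ x * B ^ (n - x)) / (A + B) ^ n with ht
    have ht' : (A + B) ^ n * t ≤ 1000000000000 * weight n A B x := by
      refine (Nat.mul_div_le _ _).trans ?_
      unfold weight
      gcongr
    have h5 := headLoop_mul_le 1000000000000 ((A + B) ^ n) T x t t ht' (by omega)
    -- The tail is bounded above through its complement, of which a few terms next to `k` suffice.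
    have h6 : 27 * (A + B) ^ n ≤ 100 * ∑ y ∈ Finset.range k, weight n A B y := by
      rw [hk, Finset.sum_range_succ]
      have := Nat.mul_le_mul_left ((A + B) ^ n) h3
      have h7 := this.trans h5
      omega
    have h8 := sum_weight_add (n := n) (A := A) (B := B) (k := k) (by omega)
    have h9 : 100 * ∑ y ∈ Finset.Icc k n, weight n A B y ≤ 73 * (A + B) ^ n := by omega
    have h10 : (100 : ℝ) * ((∑ x ∈ Finset.Icc k n, weight n A B x : ℕ) : ℝ) ≤
        73 * ((A : ℝ) + B) ^ n := by exact_mod_cast h9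
    rw [← tail_div hAB] at h10
    have := pow_pos hD n
    nlinarith
  have hkn2 : k + 2 ≤ n := by omega
  have hT0 := tail_le_tail (n := n) (i := k) (by omega) (by omega) le_rfl hm.1 hm.2
  rw [tail_at_zero (by omega)] at hT0
  obtain ⟨b₀, hb₀, hb⟩ := exists_tail_eq (n := n) (i := k + 2) (zero_le_one' ℝ) (y := tail n k a₀)
    (by rw [tail_at_zero (by omega)]; exact hT0) (by rw [tail_at_one hkn2]; linarith)
  have h1R : (k : ℝ) * ((A : ℝ) + B) ≤ A * (k + j + 2) := by exact_mod_cast h1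
  have h2R : (k : ℝ) * k * ((A : ℝ) + B) ≤ A * ((k + 1) * (k + j)) := by exact_mod_cast h2
  subst hn
  refine ⟨a₀, b₀, hm, hb₀, hb.symm, htail, ?_, ?_, Or.inl (criticalLe_spec (by omega) hAB h4)⟩
  · rw [ha₀, div_le_div_iff₀ (by positivity) hD]
    exact h1R
  · rw [ha₀, div_le_div_iff₀ (by positivity) hD]
    nlinarith

/-- The start is at the exact quantiles of order `73 / 100`, bounded by rationals: `a₀` from above,
`b₀` from below. Both weights decrease beyond their modes, so the inequality tested at the rationals
is the stronger one. -/
theorem hasStart_of_weightLe {k j A B A' B' A₀ B₀ : ℕ} (hk : 1 ≤ k) (hj : 1 ≤ j)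
    (hAB : 0 < A + B) (hAB' : 0 < A' + B') (hA₀ : A₀ = k * k)
    (hB₀ : A₀ + B₀ = (k + 1) * (k + j)) (hjk : j ≤ k)
    (h₀ : tailLe (k + 1 + j) A₀ B₀ (j + 1) = true)
    (h : weightLe k j (k + 1 + j) A B A' B' = true) : HasStart k j := by
  have hAB₀ : 0 < A₀ + B₀ := by rw [hB₀]; positivity
  unfold weightLe at h
  simp only [Bool.and_eq_true, Nat.ble_eq, Nat.add_eq, Nat.mul_eq, Nat.sub_eq, Nat.pow_eq] at h
  obtain ⟨⟨⟨h1, h2⟩, h3⟩, h4⟩ := h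
  have h0 := tail_le_of_tailLe hAB₀ (by omega) h₀
  have h1 := le_tail_of_leTail hAB (by omega) h1
  have h2 := tail_le_of_tailLe hAB' (by omega) h2
  rw [show k + 1 + j - (j + 1) = k by omega] at h0 h1
  rw [show k + 1 + j - (j - 1) = k + 2 by omega] at h2
  obtain ⟨n, hn⟩ : ∃ n, n = k + 1 + j := ⟨_, rfl⟩
  rw [← hn] at h0 h1 h2 h3 h4
  have hD : (0 : ℝ) < (A : ℝ) + B := by exact_mod_cast hAB
  have hD' : (0 : ℝ) < (A' : ℝ) + B' := by exact_mod_cast hAB'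
  have hkR : (1 : ℝ) ≤ k := by exact_mod_cast hk
  have hjR : (1 : ℝ) ≤ j := by exact_mod_cast hj
  have hjkR : (j : ℝ) ≤ k := by exact_mod_cast hjk
  have hkn : k ≤ n := by omega
  have hkn2 : k + 2 ≤ n := by omega
  set a := (A : ℝ) / ((A : ℝ) + B) with ha
  set b := (A' : ℝ) / ((A' : ℝ) + B') with hb
  have ma : a ∈ Set.Icc (0 : ℝ) 1 := div_add_mem_Icc
  have mb : b ∈ Set.Icc (0 : ℝ) 1 := div_add_mem_Icc
  have e₀ : (A₀ : ℝ) / ((A₀ : ℝ) + B₀) = (k : ℝ) ^ 2 / ((k + 1) * (k + j)) := by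
    have : (A₀ : ℝ) + B₀ = (k + 1) * (k + j) := by exact_mod_cast hB₀
    rw [this, hA₀]; push_cast; ring
  have m₀ : (A₀ : ℝ) / ((A₀ : ℝ) + B₀) ∈ Set.Icc (0 : ℝ) 1 := div_add_mem_Icc
  rw [e₀] at h0 m₀
  obtain ⟨a₀, ha₀, ta⟩ := exists_tail_eq (n := n) (i := k) (zero_le_one' ℝ) (y := 73 / 100)
    (by rw [tail_at_zero hk]; norm_num) (by rw [tail_at_one hkn]; norm_num)
  obtain ⟨b₀, hb₀, tb⟩ := exists_tail_eq (n := n) (i := k + 2) (zero_le_one' ℝ) (y := 73 / 100)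
    (by rw [tail_at_zero (by omega)]; norm_num) (by rw [tail_at_one hkn2]; norm_num)
  have mono : ∀ {i : ℕ} {p q : ℝ}, 1 ≤ i → i ≤ n → p ∈ Set.Icc (0 : ℝ) 1 → q ∈ Set.Icc (0 : ℝ) 1 →
      tail n i p ≤ tail n i q → p ≤ q := fun h1 h2 hp hq h => by
    by_contra! hc
    exact (tail_lt_tail h1 h2 hq.1 hc hp.2).not_ge h
  have g2 : (k : ℝ) ^ 2 / ((k + 1) * (k + j)) ≤ a₀ := mono hk hkn m₀ ha₀ (by linarith)
  have g1 : (k : ℝ) / (k + j + 2) ≤ a₀ := by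
    refine le_trans ?_ g2
    rw [div_le_div_iff₀ (by positivity) (by positivity)]
    nlinarith
  have g3 : a₀ ≤ a := mono hk hkn ha₀ ma (by linarith)
  have g4 : b ≤ b₀ := mono (by omega) hkn2 mb hb₀ (by linarith)
  have g5 : ((k : ℝ) + 2) / (k + 2 + j) ≤ b := by
    rw [hb, div_le_div_iff₀ (by positivity) hD']
    have : ((k : ℝ) + 2) * (A' + B') ≤ A' * (n + 1) := by exact_mod_cast h3
    rw [hn] at this
    push_cast at this
    linarith
  subst hn
  refine ⟨a₀, b₀, ha₀, hb₀, by rw [ta, tb], ta.le, g1, g2, Or.inr ⟨?_, g5.trans g4⟩⟩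
  calc rightWeight k j b₀ ≤ rightWeight k j b :=
        (rightWeight_strictAntiOn hj).antitoneOn ⟨g5, mb.2⟩ ⟨g5.trans g4, hb₀.2⟩ g4
    _ ≤ leftWeight k j a := by
        unfold rightWeight leftWeight
        have e1 : 1 - a = B / ((A : ℝ) + B) := one_sub_div_add hAB
        have e2 : 1 - b = B' / ((A' : ℝ) + B') := one_sub_div_add hAB'
        have h4R : ((j : ℝ) + 1) ^ 2 * ((A' : ℝ) ^ (k + 2) * (B' : ℝ) ^ j *
            ((A : ℝ) + B) ^ (k + j + 2)) ≤ ((k : ℝ) + 1) ^ 2 * ((A : ℝ) ^ k * (B : ℝ) ^ (j + 2) *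
            ((A' : ℝ) + B') ^ (k + j + 2)) := by
          rw [show k + 1 + j + 1 = k + j + 2 by omega] at h4
          exact_mod_cast h4
        rw [e1, e2, ha, hb, div_pow, div_pow, div_pow, div_pow]
        have e3 : ∀ x : ℝ, x ^ (k + j + 2) = x ^ (k + 2) * x ^ j := fun x => by ring
        have e4 : ∀ x : ℝ, x ^ (k + j + 2) = x ^ k * x ^ (j + 2) := fun x => by ring
        rw [div_mul_div_comm, div_mul_div_comm, ← e3, ← e4, mul_div_assoc', mul_div_assoc',
          div_le_div_iff₀ (by positivity) (by positivity)]
        linarith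
    _ ≤ leftWeight k j a₀ := by
        have := (strictAntiOn_pow_mul_pow (s := k) (t := j + 2) hk (by omega)).antitoneOn
        push_cast at this
        unfold leftWeight
        rw [← add_assoc] at this
        exact mul_le_mul_of_nonneg_left (this ⟨g1, ha₀.2⟩ ⟨g1.trans g3, ma.2⟩ g3) (by positivity)

theorem hasStart_of_checkTop {k j : ℕ} {q q' : ℕ × ℕ × ℕ} (hk : 1 ≤ k) (hj : 1 ≤ j) (hjk : j ≤ k)
    (h : checkTop k j q q' = true) : HasStart k j := by
  unfold checkTop at h
  simp only [force_eq, Bool.and_eq_true, Nat.ble_eq, Nat.add_eq, Nat.mul_eq, Nat.sub_eq] at h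
  obtain ⟨⟨⟨⟨h1, h2⟩, h3⟩, h4⟩, h5⟩ := h
  rw [show k + j + 1 = k + 1 + j by omega] at h2 h3 h4 h5
  exact hasStart_of_weightLe hk hj (by omega) (by omega) rfl (by omega) hjk h4 h5

theorem hasStart_of_checkWeights {x j C : ℕ} (hj : 1 ≤ j) (hC : C ≤ (x + 1 + 1 + j).choose x)
    (h : checkWeights (x + 1 + 1 + j) x C = true) : HasStart (x + 1) j := by
  unfold checkWeights at h
  simp only [force_eq, Nat.add_eq, Nat.sub_eq] at h
  rw [show x + 1 + 1 + j - 1 - (x + 1) = j by omega] at h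
  rcases h1 : Nat.ble (x + 1) j with _ | _
  · rw [h1] at h
    have h1' : j < x + 1 := by
      by_contra! hc
      rw [Nat.ble_eq_true_of_le hc] at h1
      exact Bool.noConfusion h1
    rcases h2 : Nat.ble j 18 with _ | _
    · rw [h2] at h
      change checkAt _ _ _ _ _ _ _ _ = true at h
      refine hasStart_of_checkAt hj hC ?_ h
      simp only [Nat.mul_eq]
      omega
    · rw [h2] at h
      change checkTop _ _ _ _ = true at h
      exact hasStart_of_checkTop (by omega) hj h1'.le h
  · rw [h1] at h
    change checkAt _ _ _ _ _ _ _ _ = true at h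
    exact hasStart_of_checkAt hj hC (by omega) h

theorem rowLoop_spec {n T x C : ℕ} (h : rowLoop n T x C = true) (hC : C ≤ n.choose x) {m : ℕ}
    (hm : m < T) : ∃ C' ≤ n.choose (x + m), checkWeights n (x + m) C' = true := by
  induction T generalizing x C m with
  | zero => omega
  | succ T ih =>
    have h' : (checkWeights n x C && force (x + 1) fun x' => force (C * (n - x) / x') fun C' =>
      rowLoop n T x' C') = true := h
    simp only [force_eq, Bool.and_eq_true] at h'
    rcases m with _ | m
    · exact ⟨C, hC, h'.1⟩
    · have h1 : C * (n - x) / (x + 1) ≤ n.choose (x + 1) := by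
        refine Nat.div_le_of_le_mul ?_
        have := Nat.choose_succ_right_eq n x
        calc C * (n - x) ≤ n.choose x * (n - x) := Nat.mul_le_mul_right _ hC
          _ = _ := by rw [← this]; ring
      have h2 := ih h'.2 h1 (by omega : m < T)
      rwa [show x + 1 + m = x + (m + 1) by omega] at h2

theorem hasStart_of_checkRows {N M k j : ℕ} (h : checkRows N M = true) (hk : 1 ≤ k) (hj : 1 ≤ j)
    (h1 : N ≤ k + 1 + j) (h2 : k + 1 + j < N + M) : HasStart k j := by
  have h3 := allBelow_spec h (m := k + 1 + j - N) (by omega)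
  simp only [force_eq, Nat.add_eq, Nat.sub_eq] at h3
  rw [show N + (k + 1 + j - N) = k + 1 + j by omega] at h3
  obtain ⟨C, hC, h4⟩ := rowLoop_spec h3 (by simp) (m := k - 1) (by omega)
  obtain ⟨x, rfl⟩ := Nat.exists_eq_add_of_le' hk
  rw [zero_add, Nat.add_sub_cancel] at hC h4
  exact hasStart_of_checkWeights hj hC h4

theorem hasStart {k j : ℕ} (hk : 1 ≤ k) (hj : 1 ≤ j) (h : k + 1 + j ≤ 200) : HasStart k j := by
  rcases Nat.lt_or_ge (k + 1 + j) 80 with h1 | h1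
  · exact hasStart_of_checkRows checkRows_3 hk hj (by omega) h1
  rcases Nat.lt_or_ge (k + 1 + j) 120 with h2 | h2
  · exact hasStart_of_checkRows checkRows_80 hk hj h1 h2
  rcases Nat.lt_or_ge (k + 1 + j) 150 with h3 | h3
  · exact hasStart_of_checkRows checkRows_120 hk hj h2 h3
  rcases Nat.lt_or_ge (k + 1 + j) 180 with h4 | h4
  · exact hasStart_of_checkRows checkRows_150 hk hj h3 h4
  · exact hasStart_of_checkRows checkRows_180 hk hj h4 (by omega)

theorem HasStart.prim_le {k j : ℕ} (h : HasStart k j) (hk : 1 ≤ k) (hj : 1 ≤ j) {a b y : ℝ}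
    (hy : 73 / 100 < y) (ha : a ∈ Set.Icc (0 : ℝ) 1) (hb : b ∈ Set.Icc (0 : ℝ) 1)
    (ta : tail (k + 1 + j) k a = y) (tb : tail (k + 1 + j) (k + 2) b = y) :
    prim (k + 1 + j) (k + 1) y b ≤ prim (k + 1 + j) (k + 1) y a := by
  obtain ⟨a₀, b₀, ha₀, hb₀, h1, h2, h3, h4, h5⟩ := h
  have h6 : a₀ < a := by
    by_contra! hc
    have := tail_le_tail (n := k + 1 + j) hk (by omega) ha.1 hc ha₀.2
    linarith
  exact prim_le_prim_of_weight rfl ta tb (rightWeight_le_leftWeight rfl hk hj ha₀ hb₀ h1 h3 h4 h5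
    ⟨h6.le, ha.2⟩ hb (ta.trans tb.symm))

/-- Since `k ^ 2 - 1 ≤ k ^ 2`, the mode `(k - 1) / (k + j)` is at most `k ^ 2 / ((k + 1) * (k +
j))`, hence at most `a₀`. -/
theorem HasStart.tail_mode_le {k j : ℕ} (h : HasStart k j) (hk : 1 ≤ k) (hj : 1 ≤ j) {m : ℝ}
    (hm : m = ((k : ℝ) - 1) / ((k + 1 + j : ℕ) - 1)) :
    tail (k + 1 + j) k m ≤ 73 / 100 := by
  obtain ⟨a₀, b₀, ha₀, hb₀, h1, h2, h3, h4, h5⟩ := h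
  have hkR : (1 : ℝ) ≤ k := by exact_mod_cast hk
  have hjR : (1 : ℝ) ≤ j := by exact_mod_cast hj
  have e : ((k + 1 + j : ℕ) : ℝ) - 1 = k + j := by push_cast; ring
  rw [e] at hm
  have hm0 : 0 ≤ m := by rw [hm]; exact div_nonneg (by linarith) (by linarith)
  refine (tail_le_tail hk (by omega) hm0 (le_trans ?_ h4) ha₀.2).trans h2
  rw [hm, div_le_div_iff₀ (by positivity) (by positivity)]
  nlinarith

/-! ### The thresholds `n` and `1` -/

theorem tail_self (n : ℕ) (p : ℝ) : tail n n p = p ^ n := by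
  rw [tail_eq_add le_rfl, tail_of_lt (Nat.lt_succ_self n)]
  simp [binomialProb]

theorem tail_penultimate {m : ℕ} (p : ℝ) :
    tail (m + 1) m p = p ^ m * ((m + 1) - m * p) := by
  rw [tail_eq_add (Nat.le_succ m), tail_self, Nat.succ_eq_add_one, pow_succ]
  unfold binomialProb
  rw [Nat.choose_succ_self_right, show m + 1 - m = 1 by omega]
  push_cast
  ring

theorem prim_self (n : ℕ) (y p : ℝ) :
    prim n n y p = (n * y + p ^ (n + 1) - (n + 1) * (y * p)) / (n + 1) := by
  unfold prim
  rw [tail_of_lt (Nat.lt_succ_self n)]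
  simp only [binomialProb, Nat.choose_self, Nat.sub_self, pow_zero]
  field_simp
  push_cast
  ring

theorem pow_mul_pow_le {s t : ℕ} (hs : 1 ≤ s) (ht : 1 ≤ t) {p : ℝ} (hp : p ∈ Set.Icc (0 : ℝ) 1) :
    p ^ s * (1 - p) ^ t ≤ ((s : ℝ) / (s + t)) ^ s * ((t : ℝ) / (s + t)) ^ t := by
  have hs' : (0 : ℝ) < s := by exact_mod_cast hs
  have ht' : (0 : ℝ) < t := by exact_mod_cast ht
  have e : (t : ℝ) / (s + t) = 1 - (s : ℝ) / (s + t) := by field_simp; ring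
  have h0 : (0 : ℝ) ≤ (s : ℝ) / (s + t) := by positivity
  have h1 : (s : ℝ) / (s + t) ≤ 1 := by rw [div_le_one (by positivity)]; linarith
  rw [e]
  rcases le_total p ((s : ℝ) / (s + t)) with h | h
  · exact monotoneOn_pow_mul_pow hs ht ⟨hp.1, h⟩ ⟨h0, le_rfl⟩ h
  · exact (strictAntiOn_pow_mul_pow hs ht).antitoneOn ⟨le_rfl, h1⟩ ⟨h, hp.2⟩ h

/-- For the threshold `1` the point `0` replaces the left quantile. Up to the factor `1 / (n + 1)`
the two sides are `n ^ 2 * b ^ 2 * (1 - b) ^ (n - 1)` and `y`; `checkLast` bounds the maximum of the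
former, taken at `b = 2 / (n + 1)`, by `73 / 100`. -/
theorem prim_lt_prim_last {n : ℕ} (hn : 2 ≤ n) (hn' : n ≤ 200) {y b : ℝ} (hy : 73 / 100 < y)
    (hb : b ∈ Set.Icc (0 : ℝ) 1) (tb : tail n 2 b = y) : prim n 1 y b < prim n 1 y 0 := by
  have h := allBelow_spec checkLast_eq_true (m := n - 2) (by omega)
  rw [force_eq, Nat.add_eq, show 2 + (n - 2) = n by omega] at h
  simp only [checkLast, Nat.ble_eq, Nat.add_eq, Nat.mul_eq, Nat.sub_eq, Nat.pow_eq] at h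
  obtain ⟨m, rfl⟩ := Nat.exists_eq_add_of_le' (show 1 ≤ n by omega)
  rw [Nat.add_sub_cancel] at h
  have hR : 400 * (((m : ℝ) + 1) * (m + 1)) * (m : ℝ) ^ m ≤ 73 * ((m : ℝ) + 2) ^ (m + 2) := by
    exact_mod_cast h
  have h1 := pow_mul_pow_le (s := 2) (t := m) (by omega) (by omega) hb
  push_cast at h1
  have h2 : ((2 : ℝ) / (2 + m)) ^ 2 * ((m : ℝ) / (2 + m)) ^ m =
      4 * (m : ℝ) ^ m / ((m : ℝ) + 2) ^ (m + 2) := by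
    rw [div_pow, div_pow, add_comm 2 (m : ℝ), pow_add _ m 2]
    field_simp
    norm_num
  rw [h2] at h1
  have h3 : ((m : ℝ) + 1) * (m + 1) * (b ^ 2 * (1 - b) ^ m) ≤ 73 / 100 := by
    calc ((m : ℝ) + 1) * (m + 1) * (b ^ 2 * (1 - b) ^ m)
        ≤ ((m : ℝ) + 1) * (m + 1) * (4 * (m : ℝ) ^ m / ((m : ℝ) + 2) ^ (m + 2)) :=
          mul_le_mul_of_nonneg_left h1 (by positivity)
      _ ≤ _ := by
        rw [mul_div_assoc', div_le_div_iff₀ (by positivity) (by norm_num)]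
        linarith
  unfold prim
  rw [tb, tail_at_zero (by omega)]
  simp only [binomialProb, Nat.choose_one_right, pow_one, Nat.add_sub_cancel]
  have hm : (0 : ℝ) < (m : ℝ) + 2 := by positivity
  push_cast
  rw [show ((m : ℝ) + 1 + 1) = m + 2 by ring]
  have e : (b - 1 / ((m : ℝ) + 2)) * (y - y) +
      (1 - 1 / ((m : ℝ) + 2)) * (b * ((m + 1) * b * (1 - b) ^ m)) =
      ((m : ℝ) + 1) * (m + 1) * (b ^ 2 * (1 - b) ^ m) / (m + 2) := by
    field_simp; ring
  have e' : (0 - 1 / ((m : ℝ) + 2)) * (0 - y) +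
      (1 - 1 / ((m : ℝ) + 2)) * (0 * ((m + 1) * 0 * (1 - 0) ^ m)) = y / (m + 2) := by
    field_simp; ring
  rw [e, e']
  exact div_lt_div_of_pos_right (by linarith) hm

/-- The function increases up to `(m + 1) / (m + 2)` and then decreases to its value `1` at `p = 1`,
so a bound at `A` suffices. -/
theorem one_lt_of_quantile {m : ℕ} {A p : ℝ} (hA0 : 0 < A)
    (hA : 1 ≤ ((m : ℝ) + 2) ^ 2 * (1 - A) ^ 2 * A ^ (m + 1) +
      (m + 2) * A ^ (m + 1) - (m + 1) * A ^ (m + 2)) (hAp : A < p) (hp : p < 1) :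
    1 < ((m : ℝ) + 2) ^ 2 * (1 - p) ^ 2 * p ^ (m + 1) +
      (m + 2) * p ^ (m + 1) - (m + 1) * p ^ (m + 2) := by
  let R : ℝ → ℝ := fun p => ((m : ℝ) + 2) ^ 2 * (1 - p) ^ 2 * p ^ (m + 1) +
      (m + 2) * p ^ (m + 1) - (m + 1) * p ^ (m + 2)
  have hR : ∀ p, HasDerivAt R
      (((m : ℝ) + 2) * (m + 3) * p ^ m * (1 - p) * ((m + 1) - (m + 2) * p)) p := fun p => by
    have h1 := hasDerivAt_pow (m + 1) p
    have h2 := hasDerivAt_pow (m + 2) p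
    have h3 := hasDerivAt_pow (m + 3) p
    have h4 : HasDerivAt (fun p : ℝ => (((m : ℝ) + 2) ^ 2 + (m + 2)) * p ^ (m + 1) -
        (2 * ((m : ℝ) + 2) ^ 2 + (m + 1)) * p ^ (m + 2) + ((m : ℝ) + 2) ^ 2 * p ^ (m + 3)) _ p :=
      ((h1.const_mul (((m : ℝ) + 2) ^ 2 + (m + 2))).sub
      (h2.const_mul (2 * ((m : ℝ) + 2) ^ 2 + (m + 1)))).add (h3.const_mul (((m : ℝ) + 2) ^ 2))
    have e : R = fun p : ℝ => (((m : ℝ) + 2) ^ 2 + (m + 2)) * p ^ (m + 1) -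
        (2 * ((m : ℝ) + 2) ^ 2 + (m + 1)) * p ^ (m + 2) + ((m : ℝ) + 2) ^ 2 * p ^ (m + 3) := by
      funext p; simp only [R]; ring
    rw [e]
    refine h4.congr_deriv ?_
    simp only [Nat.add_sub_cancel, show m + 2 - 1 = m + 1 by omega, show m + 3 - 1 = m + 2 by omega]
    push_cast
    ring
  have hm : (0 : ℝ) < (m : ℝ) + 2 := by positivity
  have hc : Continuous R := continuous_iff_continuousAt.2 fun p => (hR p).continuousAt
  have hM : ((m : ℝ) + 1) / (m + 2) < 1 := by rw [div_lt_one hm]; linarith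
  rcases le_or_gt p (((m : ℝ) + 1) / (m + 2)) with h | h
  · have : StrictMonoOn R (Set.Icc A (((m : ℝ) + 1) / (m + 2))) := by
      refine strictMonoOn_of_deriv_pos (convex_Icc _ _) hc.continuousOn fun q hq => ?_
      rw [interior_Icc] at hq
      rw [(hR q).deriv]
      have h1 := (lt_div_iff₀ hm).1 hq.2
      have h2 : 0 < q := hA0.trans hq.1
      have h3 : 0 < 1 - q := by linarith [hq.2]
      have h4 : 0 < (m : ℝ) + 1 - (m + 2) * q := by linarith
      positivity
    exact hA.trans_lt (this ⟨le_rfl, hAp.le.trans h⟩ ⟨hAp.le, h⟩ hAp)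
  · have : StrictAntiOn R (Set.Icc (((m : ℝ) + 1) / (m + 2)) 1) := by
      refine strictAntiOn_of_deriv_neg (convex_Icc _ _) hc.continuousOn fun q hq => ?_
      rw [interior_Icc] at hq
      rw [(hR q).deriv]
      have h1 := (div_lt_iff₀ hm).1 hq.1
      have h2 : 0 < q := lt_trans (by positivity) hq.1
      have h3 : 0 < 1 - q := by linarith [hq.2]
      exact mul_neg_of_pos_of_neg (by positivity) (by linarith)
    have h5 : R 1 < R p := this ⟨h.le, hp.le⟩ ⟨hM.le, le_rfl⟩ hp
    have h6 : R 1 = 1 := by simp only [R]; simp; ring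
    rw [h6] at h5
    exact h5

/-- For the threshold `n` the point `1` replaces the right quantile. The claim is `1 < (n + 1) * y *
(1 - a) + a ^ (n + 1)`; inserting `y` as the tail at `a` gives the function of `one_lt_of_quantile`,
started at `A = 1 - 11 / (10 * n)`. -/
theorem prim_one_lt_prim {n : ℕ} (hn : 2 ≤ n) (hn' : n ≤ 200) {y a : ℝ} (hy : 73 / 100 < y)
    (hy1 : y < 1) (ha : a ∈ Set.Icc (0 : ℝ) 1) (ta : tail n (n - 1) a = y) :
    prim n n y 1 < prim n n y a := by
  have h := allBelow_spec checkFirst_eq_true (m := n - 2) (by omega)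
  rw [force_eq, Nat.add_eq, show 2 + (n - 2) = n by omega] at h
  simp only [checkFirst, Bool.and_eq_true, Nat.ble_eq, Nat.add_eq, Nat.mul_eq, Nat.sub_eq,
    Nat.pow_eq] at h
  obtain ⟨h1, h2⟩ := h
  obtain ⟨m, rfl⟩ := Nat.exists_eq_add_of_le' hn
  rw [show m + 2 - 1 = m + 1 by omega] at h1 h2 ta
  have c1 : ((10 * (m + 2) - 11 : ℕ) : ℝ) = 10 * m + 9 := by
    rw [show 10 * (m + 2) - 11 = 10 * m + 9 by omega]; push_cast; ring
  have c2 : ((21 * (m + 2) - 11 : ℕ) : ℝ) = 21 * m + 31 := by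
    rw [show 21 * (m + 2) - 11 = 21 * m + 31 by omega]; push_cast; ring
  have h1R : 100 * ((10 * (m : ℝ) + 9) ^ (m + 1) * (21 * m + 31)) ≤
      73 * (10 * ((m : ℝ) + 2)) ^ (m + 2) := by
    rw [← c1, ← c2]; exact_mod_cast h1
  have h2R : 100 * (10 * ((m : ℝ) + 2)) ^ (m + 2) ≤ (10 * (m : ℝ) + 9) ^ (m + 1) *
      (1210 * (m + 2) + 100 * (21 * m + 31)) := by
    rw [← c1, ← c2]; exact_mod_cast h2
  obtain ⟨A, hA⟩ : ∃ A : ℝ, A = (10 * (m : ℝ) + 9) / (10 * (m + 2)) := ⟨_, rfl⟩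
  have hD : (0 : ℝ) < 10 * ((m : ℝ) + 2) := by positivity
  have hA0 : 0 < A := by rw [hA]; positivity
  have hA1 : A < 1 := by rw [hA, div_lt_one hD]; linarith
  have tA : tail (m + 2) (m + 1) A ≤ 73 / 100 := by
    rw [tail_penultimate, hA, div_pow]
    push_cast
    have e : (10 * (m : ℝ) + 9) ^ (m + 1) / (10 * ((m : ℝ) + 2)) ^ (m + 1) *
        (m + 1 + 1 - (m + 1) * ((10 * (m : ℝ) + 9) / (10 * (m + 2)))) =
        (10 * (m : ℝ) + 9) ^ (m + 1) * (21 * m + 31) / (10 * ((m : ℝ) + 2)) ^ (m + 2) := by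
      rw [pow_succ (10 * ((m : ℝ) + 2)) (m + 1)]
      field_simp
      ring
    rw [e, div_le_div_iff₀ (by positivity) (by norm_num)]
    linarith
  have hAa : A < a := lt_of_tail_lt (n := m + 2) (i := m + 1) (by omega) (by omega) hA1.le ha.1
    (by linarith)
  have ha1 : a < 1 := ha.2.lt_of_ne fun h => by
    rw [h, tail_at_one (by omega)] at ta
    linarith
  have h3 : 1 ≤ ((m : ℝ) + 2) ^ 2 * (1 - A) ^ 2 * A ^ (m + 1) +
      (m + 2) * A ^ (m + 1) - (m + 1) * A ^ (m + 2) := by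
    have e : ((m : ℝ) + 2) ^ 2 * (1 - A) ^ 2 * A ^ (m + 1) +
        (m + 2) * A ^ (m + 1) - (m + 1) * A ^ (m + 2) =
        (10 * (m : ℝ) + 9) ^ (m + 1) * (1210 * (m + 2) + 100 * (21 * m + 31)) /
          (100 * (10 * ((m : ℝ) + 2)) ^ (m + 2)) := by
      rw [pow_succ A (m + 1), hA, div_pow, pow_succ (10 * ((m : ℝ) + 2)) (m + 1)]
      field_simp
      ring
    rw [e, one_le_div (by positivity)]
    exact h2R
  have h4 := one_lt_of_quantile hA0 h3 hAa ha1
  rw [tail_penultimate] at ta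
  rw [prim_self, prim_self]
  refine div_lt_div_of_pos_right ?_ (by positivity)
  push_cast at ta ⊢
  rw [← ta]
  simp only [one_pow]
  have e : a ^ (m + 2 + 1) = a ^ (m + 1) * a ^ 2 := by ring
  have e' : a ^ (m + 2) = a ^ (m + 1) * a := by ring
  rw [e'] at h4
  rw [e]
  nlinarith

/-! ### Existence of the next end point -/

/-- The state of the construction of the end points before the step for the threshold `i`. -/
def Admissible (n i : ℕ) (y b : ℝ) : Prop :=
  0 < b ∧ b ≤ 1 ∧ tail n (i + 1) b < y ∧ y < tail n i b

theorem exists_quantile_at {n i : ℕ} (hi : 1 ≤ i) (hn : i ≤ n) {y : ℝ} (hy0 : 0 < y) (hy1 : y < 1) :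
    ∃ c, 0 < c ∧ c < 1 ∧ tail n i c = y := by
  obtain ⟨c, hc, h⟩ := exists_tail_eq (n := n) (i := i) (zero_le_one' ℝ) (y := y)
    (by rw [tail_at_zero hi]; exact hy0.le) (by rw [tail_at_one hn]; exact hy1.le)
  refine ⟨c, hc.1.lt_of_ne fun h0 => ?_, hc.2.lt_of_ne fun h0 => ?_, h⟩
  · rw [← h0, tail_at_zero hi] at h; exact hy0.ne h
  · rw [h0, tail_at_one hn] at h; exact hy1.ne h.symm

theorem tail_succ_lt {n i : ℕ} (hn : i ≤ n) {p : ℝ} (h0 : 0 < p) (h1 : p < 1) :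
    tail n (i + 1) p < tail n i p := by
  rw [tail_eq_add hn]
  linarith [binomialProb_pos hn h0 h1]

/-- Let `c` be the quantile for the threshold `i - 1`, or `0` if `i = 1`. From `b` on, `prim`
increases up to the quantile for `i + 1`, or up to `1` if `i = n`, and its value there does not
exceed the one at `c`. So `prim` is larger at `c` than at `b`, and the intermediate value theorem
gives `w > c`. -/
theorem Admissible.exists_next {n i : ℕ} (hi : 1 ≤ i) (hn : i ≤ n) (hn' : n ≤ 200) {y b : ℝ}
    (hy : 73 / 100 < y) (hy1 : y < 1) (h : Admissible n i y b) :
    ∃ w, w < b ∧ prim n i y w = prim n i y b ∧ Admissible n (i - 1) y w := by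
  obtain ⟨hb0, hb1, h1, h2⟩ := h
  suffices hc : ∃ c, 0 ≤ c ∧ c < b ∧ tail n i c < y ∧ prim n i y b < prim n i y c ∧
      ∀ w, c < w → w ≤ 1 → y < tail n (i - 1) w by
    obtain ⟨c, hc0, hcb, tc, hp, hw⟩ := hc
    obtain ⟨w, hcw, hwb, hw1, hw2⟩ := exists_prim_eq hi hn hc0 hcb hb1 tc h2 hp
    exact ⟨w, hwb, hw1, hc0.trans_lt hcw, by linarith,
      by rwa [Nat.sub_add_cancel hi], hw w hcw (by linarith)⟩
  have le_next : ∀ {b'}, b < b' → b' ≤ 1 → prim n i y b < prim n i y b' := fun hbb hb' =>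
    prim_lt_of_le_tail hi hn hb0.le hbb hb' h2.le
  rcases Nat.lt_or_ge i 2 with hi2 | hi2
  · obtain rfl : i = 1 := by omega
    refine ⟨0, le_rfl, hb0, by rw [tail_at_zero le_rfl]; linarith, ?_, fun w _ _ => by
      rw [Nat.sub_self, tail_zero]; exact hy1⟩
    rcases Nat.lt_or_ge n 2 with hn2 | hn2
    · obtain rfl : n = 1 := by omega
      have e1 : prim 1 1 y 1 < prim 1 1 y 0 := by
        rw [prim_self, prim_self]; norm_num; linarith
      rcases hb1.eq_or_lt with rfl | hlt
      · exact e1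
      · exact (le_next hlt le_rfl).trans e1
    · obtain ⟨c', h0, h1', tc'⟩ := exists_quantile_at (n := n) (i := 2) (by omega) hn2
        (by linarith) hy1
      have hbc : b < c' := lt_of_tail_lt (n := n) (i := 2) (by omega) hn2 hb1 h0.le (by linarith)
      exact (le_next hbc h1'.le).trans (prim_lt_prim_last hn2 hn' hy ⟨h0.le, h1'.le⟩ tc')
  · obtain ⟨c, c0, c1, tc⟩ := exists_quantile_at (n := n) (i := i - 1) (y := y) (by omega)
      (by omega) (by linarith) hy1
    have tci : tail n i c < y := by
      have := tail_succ_lt (n := n) (i := i - 1) (by omega) c0 c1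
      rw [Nat.sub_add_cancel hi] at this
      linarith
    refine ⟨c, c0.le, lt_of_tail_lt hi hn c1.le hb0.le (by linarith), tci, ?_, fun w hw hw1 => by
      have := tail_lt_tail (n := n) (i := i - 1) (by omega) (by omega) c0.le hw hw1
      linarith⟩
    rcases hn.eq_or_lt with rfl | hlt
    · have e1 := prim_one_lt_prim hi2 hn' hy hy1 ⟨c0.le, c1.le⟩ tc
      rcases hb1.eq_or_lt with rfl | hlt
      · exact e1
      · exact (le_next hlt le_rfl).trans e1
    · obtain ⟨c', h0, h1', tc'⟩ := exists_quantile_at (n := n) (i := i + 1) (y := y) (by omega) hlt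
        (by linarith) hy1
      have hbc : b < c' := lt_of_tail_lt (n := n) (i := i + 1) (by omega) hlt hb1 h0.le
        (by linarith)
      obtain ⟨k, rfl⟩ := Nat.exists_eq_add_of_le' hi
      obtain ⟨j, rfl⟩ := Nat.exists_eq_add_of_le hn
      rw [Nat.add_sub_cancel] at tc
      exact (le_next hbc h1'.le).trans_le ((hasStart (by omega) (by omega) hn').prim_le (by omega)
        (by omega) hy ⟨c0.le, c1.le⟩ ⟨h0.le, h1'.le⟩ tc tc')

/-! ### The threshold `n - 1` in the minimality argument -/

theorem prim_penultimate (m : ℕ) (y p : ℝ) :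
    prim (m + 1) m y p = (p ^ (m + 1) * ((m + 2) - m * p)) / (m + 2) - y * p + m * y / (m + 2) := by
  unfold prim
  rw [tail_self]
  unfold binomialProb
  rw [Nat.choose_succ_self_right, show m + 1 - m = 1 by omega]
  push_cast
  rw [show (m : ℝ) + 1 + 1 = m + 2 by ring]
  field_simp
  ring

/-- The sum `1 + p + ⋯ + p ^ n`. -/
noncomputable def geomSum (n : ℕ) (p : ℝ) : ℝ := ∑ r ∈ Finset.range (n + 1), p ^ r

theorem geomSum_mul (n : ℕ) (p : ℝ) : geomSum n p * (1 - p) = 1 - p ^ (n + 1) := by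
  have := geom_sum_mul p (n + 1)
  unfold geomSum
  linarith

theorem geomSum_mono {n : ℕ} {p q : ℝ} (hp : 0 ≤ p) (hpq : p ≤ q) : geomSum n p ≤ geomSum n q :=
  Finset.sum_le_sum fun r _ => pow_le_pow_left₀ hp hpq r

/-- The equation for the threshold `n` can be solved for `y`, and the solution increases with `x`;
bounds for `x` and for `y` are thus interchangeable. -/
theorem mul_eq_geomSum {n : ℕ} {y x : ℝ} (hx : x < 1) (h : prim n n y x = prim n n y 1) :
    (n + 1) * y = geomSum n x := by
  rw [prim_self, prim_self, div_left_inj' (by positivity)] at h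
  have h1 := geomSum_mul n x
  have h2 : 0 < 1 - x := by linarith
  refine mul_right_cancel₀ h2.ne' ?_
  rw [h1]
  rw [one_pow] at h
  linear_combination h

/-- `1 - s / D`. -/
noncomputable def gridPoint (D s : ℕ) : ℝ := 1 - (s : ℝ) / D

theorem gridPoint_eq {D s : ℕ} (hD : 0 < D) (hs : s ≤ D) : gridPoint D s = ((D - s : ℕ) : ℝ) / D := by
  have : (0 : ℝ) < D := by exact_mod_cast hD
  unfold gridPoint
  rw [Nat.cast_sub hs]
  field_simp

theorem gridPoint_mem {D s : ℕ} (hD : 0 < D) (hs : s ≤ D) :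
    gridPoint D s ∈ Set.Icc (0 : ℝ) 1 := by
  have : (0 : ℝ) < D := by exact_mod_cast hD
  have h : (s : ℝ) ≤ D := by exact_mod_cast hs
  unfold gridPoint
  refine ⟨?_, ?_⟩
  · rw [sub_nonneg, div_le_one this]; exact h
  · have : 0 ≤ (s : ℝ) / D := by positivity
    linarith

theorem gridPoint_pow {D s : ℕ} (hD : 0 < D) (hs : s ≤ D) (m : ℕ) :
    ((D - s : ℕ) : ℝ) ^ m = gridPoint D s ^ m * (D : ℝ) ^ m := by
  have : (0 : ℝ) < D := by exact_mod_cast hD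
  rw [gridPoint_eq hD hs, div_pow]
  field_simp

theorem gridPoint_pow_mul {D s a b m : ℕ} (hD : 0 < D) (hs : s ≤ D) (hab : b ≤ a) :
    (((D - s) ^ m * (a * D - b * (D - s)) : ℕ) : ℝ) =
      gridPoint D s ^ m * (a - b * gridPoint D s) * (D : ℝ) ^ (m + 1) := by
  have h0 : (0 : ℝ) < D := by exact_mod_cast hD
  have h1 : b * (D - s) ≤ a * D := Nat.mul_le_mul hab (Nat.sub_le _ _)
  have h2 : ((D - s : ℕ) : ℝ) = gridPoint D s * D := by
    have := gridPoint_pow hD hs 1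
    simpa using this
  rw [Nat.cast_mul, Nat.cast_pow, Nat.cast_sub h1, Nat.cast_mul, Nat.cast_mul, h2]
  ring

-- On the cell from `xs` to `xt`, `y` lies between two geometric sums. With these bounds the tests
-- give `prim v ≤ prim xs ≤ prim x = prim w`, hence `w ≤ v`, and then `tail xt + tail v < 2 * y`.
-- The summand `1` in the second test makes this strict.
set_option maxHeartbeats 400000 in
theorem add_tail_lt_of_checkCell {m D s t r : ℕ} (hm : 1 ≤ m) (hD : 0 < D) (ht : 0 < t)
    (h : checkCell (m + 1) D s t r = true) {y x w : ℝ} (hw : 0 < w) (hwx : w < x) (hx : x < 1)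
    (tw : tail (m + 1) m w < y) (hxy : ((m + 1 : ℕ) + 1) * y = geomSum (m + 1) x)
    (hp : prim (m + 1) m y w = prim (m + 1) m y x)
    (hsx : gridPoint D s ≤ x) (hxt : x ≤ gridPoint D t) :
    tail (m + 1) m x + tail (m + 1) m w < 2 * y := by
  unfold checkCell at h
  simp only [force_eq, Bool.and_eq_true, Nat.ble_eq, Nat.add_eq, Nat.mul_eq, Nat.sub_eq,
    Nat.pow_eq] at h
  obtain ⟨⟨⟨⟨⟨hsr, hts⟩, hrD⟩, h1⟩, h2⟩, h3⟩ := h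
  have hsD : s ≤ D := hsr.trans hrD
  have htD : t ≤ D := hts.trans hsD
  rw [Nat.add_sub_cancel] at h1 h2 h3
  have hDR : (0 : ℝ) < D := by exact_mod_cast hD
  have htR : (0 : ℝ) < t := by exact_mod_cast ht
  have hsR : (0 : ℝ) < s := by exact_mod_cast ht.trans_le hts
  obtain ⟨xs, hxs⟩ : ∃ z, z = gridPoint D s := ⟨_, rfl⟩
  obtain ⟨xt, hxt'⟩ : ∃ z, z = gridPoint D t := ⟨_, rfl⟩
  obtain ⟨v, hv⟩ : ∃ z, z = gridPoint D r := ⟨_, rfl⟩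
  have ms := gridPoint_mem hD hsD
  have mt := gridPoint_mem hD htD
  have mr := gridPoint_mem hD hrD
  have es : (s : ℝ) = (1 - xs) * D := by rw [hxs]; unfold gridPoint; field_simp; ring
  have et : (t : ℝ) = (1 - xt) * D := by rw [hxt']; unfold gridPoint; field_simp; ring
  have er : (r : ℝ) = (1 - v) * D := by rw [hv]; unfold gridPoint; field_simp; ring
  have h1' := (Nat.cast_le (α := ℝ)).2 h1
  have h2' := (Nat.cast_le (α := ℝ)).2 h2
  have h3' := (Nat.cast_le (α := ℝ)).2 h3
  rw [Nat.cast_add, Nat.cast_add, Nat.cast_mul _ t, Nat.cast_mul _ t,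
    gridPoint_pow_mul hD hrD (by omega), gridPoint_pow_mul hD hsD (by omega),
    Nat.cast_mul _ (r - s), Nat.cast_mul _ (r - s), Nat.cast_sub hsr, Nat.cast_pow, Nat.cast_pow,
    gridPoint_pow hD htD, ← hxs, ← hxt', ← hv] at h1'
  rw [Nat.cast_add, Nat.cast_mul, Nat.cast_add,
    gridPoint_pow_mul hD hrD (by omega), gridPoint_pow_mul hD htD (by omega),
    Nat.cast_add (2 * _) 1, Nat.cast_mul (m + 1 + 1), Nat.cast_mul 2, Nat.cast_mul 2, Nat.cast_pow, Nat.cast_pow,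
    gridPoint_pow hD hsD, ← hxs, ← hxt', ← hv] at h2'
  rw [Nat.cast_add, Nat.cast_mul, gridPoint_pow_mul hD hsD (by omega), Nat.cast_mul, Nat.cast_pow,
    Nat.cast_pow, gridPoint_pow hD htD, ← hxs, ← hxt'] at h3'
  rw [← hxs] at hsx ms
  rw [← hxt'] at hxt mt
  rw [← hv] at mr
  push_cast at h1' h2' h3' hxy
  have gs := geomSum_mul (m + 1) xs
  have gt := geomSum_mul (m + 1) xt
  have ys : geomSum (m + 1) xs ≤ ((m : ℝ) + 1 + 1) * y := by
    rw [hxy]; exact geomSum_mono ms.1 hsx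
  have yt : ((m : ℝ) + 1 + 1) * y ≤ geomSum (m + 1) xt := by
    rw [hxy]; exact geomSum_mono (by linarith) hxt
  have hxt1 : 0 < 1 - xt := by
    by_contra! hc
    rw [et] at htR
    linarith [mul_nonpos_of_nonpos_of_nonneg hc hDR.le]
  have hxs1 : 0 < 1 - xs := by
    by_contra! hc
    rw [es] at hsR
    linarith [mul_nonpos_of_nonpos_of_nonneg hc hDR.le]
  have hm2 : (0 : ℝ) < (m : ℝ) + 1 + 1 := by positivity
  have hDm2 : (0 : ℝ) < (D : ℝ) ^ (m + 1 + 1) := by positivity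
  have hvs : v ≤ xs := by
    have : (s : ℝ) ≤ r := by exact_mod_cast hsr
    rw [es, er] at this
    linarith [le_of_mul_le_mul_right this hDR]
  -- the tail at the left grid point
  have f3 : y ≤ tail (m + 1) m xs := by
    rw [tail_penultimate]
    rw [et] at h3'
    have e : (1 : ℝ) * (D : ℝ) ^ (m + 1 + 1) ≤ (xt ^ (m + 1 + 1) + xs ^ m * (m + 1 - m * xs) *
        ((m + 1 + 1) * (1 - xt))) * (D : ℝ) ^ (m + 1 + 1) := by
      refine le_trans (by linarith) (h3'.trans (le_of_eq ?_))
      ring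
    have e1 := le_of_mul_le_mul_right e hDm2
    have e2 : geomSum (m + 1) xt * (1 - xt) ≤
        xs ^ m * (m + 1 - m * xs) * (m + 1 + 1) * (1 - xt) := by
      rw [gt]; linarith
    have e3 := yt.trans (le_of_mul_le_mul_right e2 hxt1)
    rw [mul_comm] at e3
    exact le_of_mul_le_mul_right e3 hm2
  have f1 : prim (m + 1) m y v ≤ prim (m + 1) m y xs := by
    rw [prim_penultimate, prim_penultimate]
    rw [et, er, es] at h1'
    have e : (v ^ (m + 1) * (m + 1 + 1 - m * v) * (1 - xt) + (xs - v)) *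
        (D : ℝ) ^ (m + 1 + 1 + 1) ≤
        (xs ^ (m + 1) * (m + 1 + 1 - m * xs) * (1 - xt) + xt ^ (m + 1 + 1) * (xs - v)) *
        (D : ℝ) ^ (m + 1 + 1 + 1) := by
      refine le_trans (le_of_eq ?_) (h1'.trans (le_of_eq ?_))
      · ring
      · ring
    have e1 := le_of_mul_le_mul_right e (by positivity)
    have e2 : (geomSum (m + 1) xt * (xs - v)) * (1 - xt) ≤
        (xs ^ (m + 1) * (m + 1 + 1 - m * xs) - v ^ (m + 1) * (m + 1 + 1 - m * v)) * (1 - xt) := by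
      have : (geomSum (m + 1) xt * (xs - v)) * (1 - xt) = (1 - xt ^ (m + 1 + 1)) * (xs - v) := by
        rw [← gt]; ring
      rw [this]; linarith
    have e3 := le_of_mul_le_mul_right e2 hxt1
    have e4 : ((m : ℝ) + 1 + 1) * y * (xs - v) ≤ geomSum (m + 1) xt * (xs - v) :=
      mul_le_mul_of_nonneg_right yt (by linarith)
    have e5 : y * (xs - v) ≤ (xs ^ (m + 1) * (m + 1 + 1 - m * xs) -
        v ^ (m + 1) * (m + 1 + 1 - m * v)) / (m + 2) := by
      rw [le_div_iff₀ (by positivity)]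
      linarith
    rw [show ((m : ℝ) + 1 + 1) = m + 2 by ring, sub_div] at e5
    linarith
  have f2 : prim (m + 1) m y xs ≤ prim (m + 1) m y x := by
    rcases hsx.eq_or_lt with h | h
    · rw [h]
    · exact (prim_lt_of_le_tail hm (by omega) ms.1 h hx.le f3).le
  have hwv : w ≤ v := by
    by_contra! hc
    have := prim_lt_of_tail_le hm (by omega) mr.1 hc (by linarith) tw.le
    linarith
  have g1 := tail_le_tail (n := m + 1) hm (by omega) (by linarith) hxt mt.2
  have g2 := tail_le_tail (n := m + 1) hm (by omega) hw.le hwv mr.2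
  have g3 : tail (m + 1) m xt + tail (m + 1) m v < 2 * y := by
    rw [tail_penultimate, tail_penultimate]
    rw [es] at h2'
    have e : ((xt ^ m * (m + 1 - m * xt) + v ^ m * (m + 1 - m * v)) * ((m + 1 + 1) * (1 - xs)) +
        2 * xs ^ (m + 1 + 1)) * (D : ℝ) ^ (m + 1 + 1) < 2 * (D : ℝ) ^ (m + 1 + 1) := by
      have e0 : ((xt ^ m * (m + 1 - m * xt) + v ^ m * (m + 1 - m * v)) *
          ((m + 1 + 1) * (1 - xs)) + 2 * xs ^ (m + 1 + 1)) * (D : ℝ) ^ (m + 1 + 1) =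
          (xt ^ m * (m + 1 - m * xt) * (D : ℝ) ^ (m + 1) +
          v ^ m * (m + 1 - m * v) * (D : ℝ) ^ (m + 1)) * ((m + 1 + 1) * ((1 - xs) * D)) +
          2 * (xs ^ (m + 1 + 1) * (D : ℝ) ^ (m + 1 + 1)) := by ring
      rw [e0]
      linarith
    have e1 := lt_of_mul_lt_mul_right e hDm2.le
    have e2 : (xt ^ m * (m + 1 - m * xt) + v ^ m * (m + 1 - m * v)) * (m + 1 + 1) * (1 - xs) <
        2 * geomSum (m + 1) xs * (1 - xs) := by
      rw [mul_assoc 2, gs]; linarith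
    have e3 := lt_of_mul_lt_mul_right e2 hxs1.le
    refine lt_of_mul_lt_mul_right (e3.trans_le ?_) hm2.le
    linarith
  linarith

theorem exists_cell {g : ℕ → ℝ} {N : ℕ} {x : ℝ} (h0 : x ≤ g 0) (hN : g N ≤ x) (hN0 : 0 < N) :
    ∃ m < N, g (m + 1) ≤ x ∧ x ≤ g m := by
  induction N with
  | zero => omega
  | succ N ih =>
    rcases le_or_gt x (g N) with h | h
    · exact ⟨N, Nat.lt_succ_self N, hN, h⟩
    · rcases Nat.eq_zero_or_pos N with rfl | h'
      · exact absurd h0 (not_le.2 h)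
      · obtain ⟨m, hm, hm'⟩ := ih h.le h'
        exact ⟨m, hm.trans (Nat.lt_succ_self N), hm'⟩

theorem tail_penultimate_mode {m : ℕ} (hm : 1 ≤ m) :
    tail (m + 1) m (((m : ℝ) - 1) / m) = 2 * ((m - 1 : ℕ) : ℝ) ^ m / (m : ℝ) ^ m := by
  have hmR : (0 : ℝ) < m := by exact_mod_cast hm
  rw [tail_penultimate, Nat.cast_sub hm, div_pow]
  push_cast
  field_simp
  ring

/-- The tail at the mode is `2 * ((m - 1) / m) ^ m`, which increases to `2 / e > 73 / 100`. Below `n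
= 66` it is at most `73 / 100`. Later, if it exceeds `y`, then `y` is confined to a short interval
above `73 / 100`, which confines `x` to the range from `1 - 66260 / D` to `1 - 65000 / D`, covered
by the cells. -/
theorem tail_mode_le_or_add_tail_lt {m : ℕ} (h3 : 3 ≤ m) (hm : m + 1 ≤ 200) {y x w : ℝ}
    (hy : 73 / 100 < y) (hw : 0 < w) (hwx : w < x) (hx : x < 1)
    (tw : tail (m + 1) m w < y) (hx1 : prim (m + 1) (m + 1) y x = prim (m + 1) (m + 1) y 1)
    (hp : prim (m + 1) m y w = prim (m + 1) m y x) :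
    tail (m + 1) m (((m : ℝ) - 1) / m) ≤ y ∨
      tail (m + 1) m x + tail (m + 1) m w < 2 * y := by
  have hmR : (0 : ℝ) < m := by exact_mod_cast (by omega : 0 < m)
  rcases Nat.lt_or_ge (m + 1) 66 with hlt | hge
  · left
    have h := allBelow_spec checkMode_eq_true (m := m - 3) (by omega)
    rw [force_eq, Nat.add_eq, show 4 + (m - 3) = m + 1 by omega] at h
    simp only [checkMode, Nat.ble_eq, Nat.mul_eq, Nat.sub_eq, Nat.pow_eq] at h
    rw [Nat.add_sub_cancel, show m + 1 - 2 = m - 1 by omega] at h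
    have h' : 200 * ((m - 1 : ℕ) : ℝ) ^ m ≤ 73 * (m : ℝ) ^ m := by exact_mod_cast h
    rw [tail_penultimate_mode (by omega)]
    refine le_trans ?_ hy.le
    rw [div_le_div_iff₀ (by positivity) (by norm_num)]
    linarith
  · rcases le_or_gt (tail (m + 1) m (((m : ℝ) - 1) / m)) y with hf | hf
    · exact Or.inl hf
    right
    have h := allBelow_spec checkPenultimate_eq_true (m := m + 1 - 66) (by omega)
    rw [force_eq, Nat.add_eq, show 66 + (m + 1 - 66) = m + 1 by omega] at h
    simp only [checkPenultimate, force_eq, Bool.and_eq_true, Nat.ble_eq, Nat.mul_eq, Nat.sub_eq,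
      Nat.pow_eq, Nat.add_eq] at h
    obtain ⟨⟨h1, h2⟩, h3⟩ := h
    rw [Nat.add_sub_cancel] at h1 h2 h3
    obtain ⟨D, hD⟩ : ∃ D, D = m * 100000 := ⟨_, rfl⟩
    rw [← hD] at h1 h2 h3
    have hD0 : 66260 < D := by omega
    have hDR : (0 : ℝ) < D := by exact_mod_cast (by omega : 0 < D)
    have hxy := mul_eq_geomSum hx hx1
    have mono : ∀ {p q : ℝ}, 0 ≤ p → geomSum (m + 1) q < geomSum (m + 1) p → q ≤ p := fun hp h => by
      by_contra! hc
      exact (geomSum_mono hp hc.le).not_gt h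
    have hm2 : (0 : ℝ) < (m : ℝ) + 1 + 1 := by positivity
    push_cast at hxy
    have hlo : gridPoint D 66260 ≤ x := by
      have h1' := (Nat.cast_le (α := ℝ)).2 h1
      rw [Nat.cast_add, Nat.cast_mul 100 ((D - 66260) ^ _), Nat.cast_pow (D - 66260),
        gridPoint_pow (by omega) hD0.le] at h1'
      push_cast at h1'
      have g := geomSum_mul (m + 1) (gridPoint D 66260)
      have e0 : 1 - gridPoint D 66260 = 66260 / D := by unfold gridPoint; push_cast; ring
      rw [e0] at g
      refine mono (by linarith) ?_
      have e1 : (100 * (1 - gridPoint D 66260 ^ (m + 1 + 1))) * (D : ℝ) ^ (m + 1 + 1) ≤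
          (73 * (m + 1 + 1) * (66260 / D)) * (D : ℝ) ^ (m + 1 + 1) := by
        have : (73 * ((m : ℝ) + 1 + 1) * (66260 / D)) * (D : ℝ) ^ (m + 1 + 1) =
            73 * ((m + 1 + 1) * 66260 * (D : ℝ) ^ (m + 1)) := by
          rw [pow_succ]; field_simp
        rw [this]
        linarith
      have e2 := le_of_mul_le_mul_right e1 (by positivity)
      rw [← g] at e2
      have e3 : (100 * geomSum (m + 1) (gridPoint D 66260)) * (66260 / D : ℝ) ≤
          (73 * (m + 1 + 1)) * (66260 / D : ℝ) := by linarith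
      have e4 := le_of_mul_le_mul_right e3 (by positivity)
      rw [← hxy]
      clear h1 h2 h3
      linarith [mul_lt_mul_of_pos_right hy hm2]
    have hhi : x ≤ gridPoint D 65000 := by
      have h2' := (Nat.cast_le (α := ℝ)).2 h2
      rw [Nat.cast_add, Nat.cast_mul (m ^ _) ((D - 65000) ^ _), Nat.cast_pow (D - 65000),
        gridPoint_pow (by omega) (by omega), show m + 1 - 2 = m - 1 by omega] at h2'
      push_cast at h2'
      have g := geomSum_mul (m + 1) (gridPoint D 65000)
      have e0 : 1 - gridPoint D 65000 = 65000 / D := by unfold gridPoint; push_cast; ring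
      rw [e0] at g
      refine mono (gridPoint_mem (by omega) (by omega)).1 ?_
      rw [tail_penultimate_mode (by omega), lt_div_iff₀ (by positivity)] at hf
      have e1 : (2 * ((m - 1 : ℕ) : ℝ) ^ m * (m + 1 + 1) * (65000 / D)) * (D : ℝ) ^ (m + 1 + 1) ≤
          ((m : ℝ) ^ m * (1 - gridPoint D 65000 ^ (m + 1 + 1))) * (D : ℝ) ^ (m + 1 + 1) := by
        have : (2 * ((m - 1 : ℕ) : ℝ) ^ m * (m + 1 + 1) * (65000 / D)) * (D : ℝ) ^ (m + 1 + 1) =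
            2 * ((m - 1 : ℕ) : ℝ) ^ m * ((m + 1 + 1) * 65000) * (D : ℝ) ^ (m + 1) := by
          rw [pow_succ]; field_simp
        rw [this]
        linarith
      have e2 := le_of_mul_le_mul_right e1 (by positivity)
      rw [← g] at e2
      have e3 : (2 * ((m - 1 : ℕ) : ℝ) ^ m * (m + 1 + 1)) * (65000 / D : ℝ) ≤
          ((m : ℝ) ^ m * geomSum (m + 1) (gridPoint D 65000)) * (65000 / D : ℝ) := by linarith
      have e4 := le_of_mul_le_mul_right e3 (by positivity)
      rw [← hxy]
      refine lt_of_mul_lt_mul_left ?_ (by positivity : (0 : ℝ) ≤ (m : ℝ) ^ m)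
      refine lt_of_lt_of_le ?_ e4
      clear h1 h2 h3
      linarith [mul_lt_mul_of_pos_right hf hm2]
    obtain ⟨c, hc, hc1, hc2⟩ := exists_cell (g := fun c => gridPoint D (65000 + 20 * c)) (N := 63)
      hhi hlo (by norm_num)
    have h4 := allBelow_spec h3 hc
    exact add_tail_lt_of_checkCell (by omega) (by omega) (by omega) h4 hw hwx hx tw
      (by push_cast; exact hxy) hp hc1 hc2

/-! ### The optimal sequence and its minimality -/

/-- The sequence of optimal upper end points, in terms of antiderivatives. -/
structure IsOptimal (n : ℕ) (y : ℝ) (u : ℕ → ℝ) : Prop where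
  last_eq : u n = 1
  pos : ∀ i < n, 0 < u i
  lt_succ : ∀ i < n, u i < u (i + 1)
  prim_eq : ∀ i < n, prim n (i + 1) y (u i) = prim n (i + 1) y (u (i + 1))

/-- A sequence of locally correct upper end points, in terms of antiderivatives. -/
structure IsCorrect (n : ℕ) (y : ℝ) (v : ℕ → ℝ) : Prop where
  last_eq : v n = 1
  pos : ∀ i < n, 0 < v i
  lt_succ : ∀ i < n, v i < v (i + 1)
  prim_le : ∀ i < n, prim n (i + 1) y (v i) ≤ prim n (i + 1) y (v (i + 1))

theorem exists_isOptimal {n : ℕ} (hn : n ≤ 200) {y : ℝ} (hy : 73 / 100 < y) (hy1 : y < 1) :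
    ∃ u, IsOptimal n y u := by
  -- A total choice, with the junk value `0` off the admissible states, permits recursion on `k = n
  -- - i`.
  have step : ∀ k b, ∃ w, k < n → Admissible n (n - k) y b →
      w < b ∧ prim n (n - k) y w = prim n (n - k) y b ∧ Admissible n (n - k - 1) y w := fun k b => by
    by_cases h : k < n ∧ Admissible n (n - k) y b
    · obtain ⟨w, hw⟩ := h.2.exists_next (by omega) (by omega) hn hy hy1
      exact ⟨w, fun _ _ => hw⟩
    · exact ⟨0, fun h1 h2 => absurd ⟨h1, h2⟩ h⟩
  choose f hf using step
  let s : ℕ → ℝ := fun k => Nat.rec 1 f k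
  have hs : ∀ k ≤ n, Admissible n (n - k) y (s k) := fun k => by
    induction k with
    | zero =>
      intro _
      refine ⟨zero_lt_one, le_rfl, ?_, ?_⟩
      · change tail n (n - 0 + 1) 1 < y
        rw [tail_of_lt (by omega)]
        linarith
      · change y < tail n (n - 0) 1
        rw [tail_at_one (by omega)]
        exact hy1
    | succ k ih =>
      intro hk
      exact (hf k (s k) (by omega) (ih (by omega))).2.2
  refine ⟨fun i => s (n - i), by simp [s], fun i hi => (hs _ (by omega)).1, fun i hi => ?_,
    fun i hi => ?_⟩
  · have := (hf (n - (i + 1)) _ (by omega) (hs _ (by omega))).1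
    change s (n - i) < _
    rwa [show n - i = n - (i + 1) + 1 by omega]
  · have := (hf (n - (i + 1)) _ (by omega) (hs _ (by omega))).2.1
    rw [show n - (n - (i + 1)) = i + 1 by omega] at this
    change prim n (i + 1) y (s (n - i)) = _
    rwa [show n - i = n - (i + 1) + 1 by omega]

theorem IsOptimal.le_one {n : ℕ} {y : ℝ} {u : ℕ → ℝ} (h : IsOptimal n y u) {i : ℕ} (hi : i ≤ n) :
    u i ≤ 1 := by
  induction hi using Nat.decreasingInduction with
  | self => exact h.last_eq.le
  | of_succ k hk ih => exact (h.lt_succ k hk).le.trans ih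

theorem IsCorrect.le_one {n : ℕ} {y : ℝ} {u : ℕ → ℝ} (h : IsCorrect n y u) {i : ℕ} (hi : i ≤ n) :
    u i ≤ 1 := by
  induction hi using Nat.decreasingInduction with
  | self => exact h.last_eq.le
  | of_succ k hk ih => exact (h.lt_succ k hk).le.trans ih

theorem IsOptimal.unique {n : ℕ} {y : ℝ} {u v : ℕ → ℝ} (hu : IsOptimal n y u)
    (hv : IsOptimal n y v) {i : ℕ} (hi : i ≤ n) : u i = v i := by
  induction hi using Nat.decreasingInduction with
  | self => rw [hu.last_eq, hv.last_eq]
  | of_succ k hk ih =>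
    refine eq_of_prim_eq (by omega) (by omega) (hu.pos k hk).le (hu.lt_succ k hk) (hv.pos k hk).le
      ?_ (hu.le_one hk) (hu.prim_eq k hk) ?_
    · rw [ih]; exact hv.lt_succ k hk
    · rw [ih]; exact hv.prim_eq k hk

theorem IsOptimal.le_of_le {n : ℕ} {y : ℝ} {u v : ℕ → ℝ} (hu : IsOptimal n y u)
    (hv : IsCorrect n y v) {i : ℕ} (hi : i < n) (h : v (i + 1) ≤ u (i + 1)) : u i ≤ v i :=
  le_of_prim_le (by omega) (by omega) (hu.pos i hi) (hu.lt_succ i hi) (hu.le_one hi)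
    (hu.prim_eq i hi) (hv.pos i hi) (hv.lt_succ i hi) h (hv.prim_le i hi)

theorem IsOptimal.add_lt_add {n : ℕ} (hn : n ≤ 200) {y : ℝ} (hy : 73 / 100 < y)
    {u v : ℕ → ℝ} (hu : IsOptimal n y u) (hv : IsCorrect n y v) {i : ℕ} (hi : i + 1 < n)
    (h : u (i + 1) < v (i + 1)) : u i + u (i + 1) < v i + v (i + 1) := by
  have hi' : i < n := by omega
  have tw := (tail_lt_of_prim_eq (by omega) hi.le (hu.pos i hi').le (hu.lt_succ i hi')
    (hu.le_one hi.le) (hu.prim_eq i hi')).1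
  refine add_lt_add_of_prim_le (by omega) hi (by linarith) (hu.pos i hi') (hu.lt_succ i hi')
    (hu.prim_eq i hi') (hv.pos i hi') h (hv.le_one hi.le) (hv.prim_le i hi') fun hm => ?_
  -- The threshold is `i + 1`; up to `n - 2` the starting conditions bound the tail at the mode.
  rcases Nat.lt_or_ge (i + 2) n with h1 | h1
  · left
    obtain ⟨j, rfl⟩ : ∃ j, n = i + 1 + 1 + j := ⟨n - (i + 2), by omega⟩
    exact ((hasStart (k := i + 1) (j := j) (by omega) (by omega) (by omega)).tail_mode_le (by omega)
      (by omega) rfl).trans hy.le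
  · obtain rfl : n = i + 1 + 1 := by omega
    have h3 : 3 ≤ i + 1 := by
      push_cast at hm
      have : (1 : ℝ) < i := by linarith
      have : 1 < i := by exact_mod_cast this
      omega
    have e : ((i + 1 + 1 : ℕ) : ℝ) - 1 = (i + 1 : ℕ) := by push_cast; ring
    rw [e]
    refine tail_mode_le_or_add_tail_lt h3 hn hy (hu.pos i hi') (hu.lt_succ i hi') ?_ tw ?_
      (hu.prim_eq i hi')
    · have := hu.lt_succ (i + 1) hi
      rwa [hu.last_eq] at this
    · have := hu.prim_eq (i + 1) hi
      rwa [hu.last_eq] at this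

/-- The optimal sequence has the smallest sum. -/
theorem IsOptimal.sum_lt {n : ℕ} (hn : n ≤ 200) {y : ℝ} (hy : 73 / 100 < y)
    {u v : ℕ → ℝ} (hu : IsOptimal n y u) (hv : IsCorrect n y v) :
    ∑ i ∈ Finset.range (n + 1), u i ≤ ∑ i ∈ Finset.range (n + 1), v i ∧
      (∑ i ∈ Finset.range (n + 1), u i = ∑ i ∈ Finset.range (n + 1), v i →
        ∀ i ≤ n, u i = v i) := by
  -- The second clause carries the induction: if the difference at `k + 1` is positive, the sum from
  -- `k` on is at least the two lowest differences together, which `add_lt_add` makes positive.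
  have key : ∀ m ≤ n, 0 ≤ ∑ i ∈ Finset.Ico m (n + 1), (v i - u i) ∧
      v m - u m ≤ ∑ i ∈ Finset.Ico m (n + 1), (v i - u i) ∧
      (∑ i ∈ Finset.Ico m (n + 1), (v i - u i) = 0 → ∀ i, m ≤ i → i ≤ n → u i = v i) := by
    intro m hm
    induction hm using Nat.decreasingInduction with
    | self =>
      have e : u n = v n := hu.last_eq.trans hv.last_eq.symm
      rw [Nat.Ico_succ_singleton, Finset.sum_singleton, e, sub_self]
      refine ⟨le_rfl, le_rfl, fun _ i h1 h2 => ?_⟩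
      rw [le_antisymm h2 h1, e]
    | of_succ k hk ih =>
      obtain ⟨i1, i2, i3⟩ := ih
      rw [Finset.sum_eq_sum_Ico_succ_bot (by omega : k < n + 1)]
      rcases le_or_gt (v (k + 1)) (u (k + 1)) with h | h
      · have h1 := hu.le_of_le hv hk h
        refine ⟨by linarith, by linarith, fun h0 i hi1 hi2 => ?_⟩
        rcases hi1.eq_or_lt with rfl | hlt
        · linarith
        · exact i3 (by linarith) i hlt hi2
      · have hk1 : k + 1 < n := by
          refine lt_of_le_of_ne hk fun h0 => ?_
          rw [h0, hu.last_eq, hv.last_eq] at h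
          exact h.false
        have h1 := hu.add_lt_add hn hy hv hk1 h
        exact ⟨by linarith, by linarith, fun h0 => by linarith⟩
  obtain ⟨h1, -, h3⟩ := key 0 (Nat.zero_le n)
  rw [Nat.Ico_zero_eq_range, Finset.sum_sub_distrib] at h1 h3
  exact ⟨by linarith, fun h i hi => h3 (by linarith) i (Nat.zero_le i) hi⟩

/-! ### From averages of coverage to antiderivatives -/

theorem integral_tail {n i : ℕ} (hn : i ≤ n) (a b : ℝ) :
    ∫ p in a..b, tail n i p = prim n i 0 b - prim n i 0 a := by
  refine intervalIntegral.integral_eq_sub_of_hasDerivAt (fun p _ => ?_)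
    ((continuous_tail n i).intervalIntegrable a b)
  simpa using hasDerivAt_prim hn 0 p

theorem average_tail {n i : ℕ} (hn : i ≤ n) (y : ℝ) {a b : ℝ} (hab : a < b) :
    average (tail n i) a b = (prim n i y b - prim n i y a) / (b - a) + y := by
  have h : b - a ≠ 0 := sub_ne_zero.2 hab.ne'
  unfold average
  rw [integral_tail hn]
  unfold prim
  field_simp
  ring

theorem upperTail_eq_tail {n : ℕ} (i : Fin (n + 1)) : upperTail n i = tail n i := by
  funext p
  unfold upperTail tail
  have h := Fin.map_valEmbedding_Ici (a := i)
  rw [Finset.Ico_add_one_right_eq_Icc] at h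
  rw [← h, Finset.sum_map]
  rfl

theorem average_upperCoverage {n : ℕ} {u : Fin (n + 1) → ℝ} (hu : StrictMono u) (i : Fin n) :
    average (upperCoverage n u) (u i.castSucc) (u i.succ) =
      average (upperTail n i.succ) (u i.castSucc) (u i.succ) := by
  unfold average
  congr 1
  refine intervalIntegral.integral_congr_ae (Filter.Eventually.of_forall fun p hp => ?_)
  rw [Set.uIoc_of_le (hu i.castSucc_lt_succ).le] at hp
  exact upperCoverage_eq hu i hp.1 hp.2

theorem average_lowerCoverage {n : ℕ} {l : Fin (n + 1) → ℝ} (hl : StrictMono l) (i : Fin n) :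
    average (lowerCoverage n l) (l i.castSucc) (l i.succ) =
      average (lowerTail n i.castSucc) (l i.castSucc) (l i.succ) := by
  unfold average
  congr 1
  refine intervalIntegral.integral_congr_ae (Filter.Eventually.of_forall fun p hp => ?_)
  rw [Set.uIoc_of_le (hl i.castSucc_lt_succ).le] at hp
  exact lowerCoverage_eq hl i hp.1 hp.2

/-- The extension of end points to a sequence. -/
def extend {n : ℕ} (u : Fin (n + 1) → ℝ) (i : ℕ) : ℝ := u (Fin.ofNat (n + 1) i)

theorem extend_val {n : ℕ} (u : Fin (n + 1) → ℝ) (i : Fin (n + 1)) : extend u i = u i := by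
  unfold extend
  congr
  exact Fin.ext (Nat.mod_eq_of_lt i.2)

theorem extend_castSucc {n : ℕ} (u : Fin (n + 1) → ℝ) (i : Fin n) :
    extend u (i : ℕ) = u i.castSucc := extend_val u i.castSucc

theorem extend_succ {n : ℕ} (u : Fin (n + 1) → ℝ) (i : Fin n) :
    extend u ((i : ℕ) + 1) = u i.succ := extend_val u i.succ

theorem extend_last {n : ℕ} (u : Fin (n + 1) → ℝ) : extend u n = u (Fin.last n) :=
  extend_val u (Fin.last n)

theorem average_upperTail {n : ℕ} (y : ℝ) (i : Fin n) {a b : ℝ} (hab : a < b) :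
    average (upperTail n i.succ) a b =
      (prim n (i + 1) y b - prim n (i + 1) y a) / (b - a) + y := by
  rw [upperTail_eq_tail, Fin.val_succ, average_tail (by omega) y hab]

theorem isUpperOLC_iff {n : ℕ} {α : ℝ} {u : Fin (n + 1) → ℝ} :
    IsUpperOLC n α u ↔ IsOptimal n (1 - α) (extend u) := by
  constructor
  · intro h
    refine ⟨(extend_last u).trans h.last_eq, fun i hi => ?_, fun i hi => ?_, fun i hi => ?_⟩
    · exact (extend_castSucc u ⟨i, hi⟩).symm ▸ h.zero_lt ⟨i, hi⟩
    · have h1 := h.lt_succ ⟨i, hi⟩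
      rwa [← extend_castSucc u, ← extend_succ u] at h1
    · have h1 := h.average_eq ⟨i, hi⟩
      have h2 := h.lt_succ ⟨i, hi⟩
      rw [average_upperTail (1 - α) _ h2, add_eq_right, div_eq_zero_iff,
        or_iff_left (sub_ne_zero.2 h2.ne'), sub_eq_zero, ← extend_castSucc u, ← extend_succ u] at h1
      exact h1.symm
  · intro h
    have h2 : ∀ i : Fin n, u i.castSucc < u i.succ := fun i => by
      rw [← extend_castSucc u, ← extend_succ u]; exact h.lt_succ i i.2
    refine ⟨(extend_last u).symm.trans h.last_eq, fun i => ?_, h2, fun i => ?_⟩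
    · rw [← extend_castSucc u]; exact h.pos i i.2
    · rw [average_upperTail (1 - α) _ (h2 i), add_eq_right, div_eq_zero_iff, sub_eq_zero,
        ← extend_castSucc u, ← extend_succ u]
      exact Or.inl (h.prim_eq i i.2).symm

theorem IsUpperOLC.isUpperLCC {n : ℕ} {α : ℝ} {u : Fin (n + 1) → ℝ} (h : IsUpperOLC n α u) :
    IsUpperLCC n α u := by
  have hs : StrictMono u := Fin.strictMono_iff_lt_succ.2 h.lt_succ
  refine ⟨?_, hs, h.last_eq, fun i => ?_⟩
  · rcases n with _ | n
    · have : u 0 = 1 := h.last_eq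
      rw [this]; exact zero_lt_one
    · exact h.zero_lt 0
  · rw [average_upperCoverage hs, h.average_eq]

theorem IsUpperLCC.isCorrect {n : ℕ} {α : ℝ} {v : Fin (n + 1) → ℝ} (h : IsUpperLCC n α v) :
    IsCorrect n (1 - α) (extend v) := by
  have h2 : ∀ i : Fin n, v i.castSucc < v i.succ := fun i => h.strictMono i.castSucc_lt_succ
  refine ⟨(extend_last v).trans h.last_eq, fun i hi => ?_, fun i hi => ?_, fun i hi => ?_⟩
  · rw [extend_castSucc v ⟨i, hi⟩]
    exact h.zero_lt.trans_le (h.strictMono.monotone (Fin.zero_le _))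
  · have h1 := h2 ⟨i, hi⟩
    rwa [← extend_castSucc v, ← extend_succ v] at h1
  · have h1 := h.average_ge ⟨i, hi⟩
    have h3 := h2 ⟨i, hi⟩
    rw [average_upperCoverage h.strictMono, average_upperTail (1 - α) _ h3, le_add_iff_nonneg_left,
      le_div_iff₀ (sub_pos.2 h3), zero_mul, sub_nonneg, ← extend_castSucc v, ← extend_succ v] at h1
    exact h1

theorem existsUnique_isUpperOLC {n : ℕ} (hn : n ≤ 200) {α : ℝ} (hα : 0 < α) (hα' : α < 27 / 100) :
    ∃! u : Fin (n + 1) → ℝ, IsUpperOLC n α u := by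
  obtain ⟨s, hs⟩ := exists_isOptimal (n := n) (y := 1 - α) hn (by linarith) (by linarith)
  have e : ∀ i ≤ n, extend (n := n) (fun i => s i) i = s i := fun i hi =>
    extend_val (n := n) (fun i => s i) ⟨i, by omega⟩
  refine ⟨fun i => s i, isUpperOLC_iff.2 ⟨?_, fun i hi => ?_, fun i hi => ?_, fun i hi => ?_⟩,
    fun v hv => funext fun i => ?_⟩
  · rw [e n le_rfl, hs.last_eq]
  · rw [e i hi.le]; exact hs.pos i hi
  · rw [e i hi.le, e (i + 1) hi]; exact hs.lt_succ i hi
  · rw [e i hi.le, e (i + 1) hi]; exact hs.prim_eq i hi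
  · rw [← extend_val v i]
    exact (isUpperOLC_iff.1 hv).unique hs (by omega)

theorem IsUpperOLC.sum_lt {n : ℕ} (hn : n ≤ 200) {α : ℝ} (hα : α < 27 / 100)
    {u v : Fin (n + 1) → ℝ} (hu : IsUpperOLC n α u) (hv : IsUpperLCC n α v) (h : v ≠ u) :
    ∑ i, u i < ∑ i, v i := by
  have e : ∀ w : Fin (n + 1) → ℝ, ∑ i ∈ Finset.range (n + 1), extend w i = ∑ i, w i := fun w => by
    rw [Finset.sum_range]
    exact Finset.sum_congr rfl fun i _ => extend_val w i
  obtain ⟨h1, h2⟩ := (isUpperOLC_iff.1 hu).sum_lt hn (by linarith) hv.isCorrect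
  rw [e, e] at h1 h2
  refine h1.lt_of_ne fun h0 => h (funext fun i => ?_)
  rw [← extend_val u, ← extend_val v]
  exact (h2 h0 i (by omega)).symm

/-! ### The average expected length as a sum of end points -/

theorem integral_tail_zero_one {n i : ℕ} (hi : i ≤ n + 1) :
    ∫ p in (0 : ℝ)..1, tail n i p = 1 - i / (n + 1) := by
  rcases hi.eq_or_lt with rfl | h
  · simp only [tail_of_lt (Nat.lt_succ_self n), intervalIntegral.integral_zero]
    push_cast
    rw [div_self (by positivity), sub_self]
  · have hin : i ≤ n := by omega
    rw [integral_tail hin]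
    unfold prim
    rw [tail_at_zero (by omega)]
    have h1 : tail n (i + 1) 1 + binomialProb n i 1 = 1 := by
      rw [add_comm, ← tail_eq_add hin, tail_at_one hin]
    linear_combination (1 - (i : ℝ) / (n + 1)) * h1

theorem integral_binomialProb {n x : ℕ} (hx : x ≤ n) :
    ∫ p in (0 : ℝ)..1, binomialProb n x p = 1 / (n + 1) := by
  have e : ∀ p, binomialProb n x p = tail n x p - tail n (x + 1) p := fun p => by
    rw [tail_eq_add hx]; ring
  simp only [e]
  rw [intervalIntegral.integral_sub ((continuous_tail n x).intervalIntegrable _ _)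
    ((continuous_tail n (x + 1)).intervalIntegrable _ _), integral_tail_zero_one (by omega),
    integral_tail_zero_one (by omega)]
  push_cast
  ring

theorem averageExpectedLength_eq {n : ℕ} (l u : Fin (n + 1) → ℝ) :
    averageExpectedLength n l u = (∑ x, u x - ∑ x, l x) / (n + 1) := by
  unfold averageExpectedLength expectedLength
  have hc : ∀ x : ℕ, Continuous (binomialProb n x) := fun x => by unfold binomialProb; fun_prop
  rw [intervalIntegral.integral_finsetSum fun (x : Fin (n + 1)) _ =>
    ((hc x).const_mul (u x - l x)).intervalIntegrable 0 1]
  rw [← Finset.sum_sub_distrib, Finset.sum_div]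
  refine Finset.sum_congr rfl fun x _ => ?_
  rw [intervalIntegral.integral_const_mul, integral_binomialProb (by omega)]
  ring

/-! ### Lower end points by reflection -/

/-- The reflection interchanging lower and upper end points. -/
def reflect {n : ℕ} (l : Fin (n + 1) → ℝ) (i : Fin (n + 1)) : ℝ := 1 - l i.rev

theorem reflect_reflect {n : ℕ} (l : Fin (n + 1) → ℝ) : reflect (reflect l) = l := by
  funext i
  simp [reflect]

theorem reflect_injective {n : ℕ} : Function.Injective (reflect (n := n)) :=
  Function.LeftInverse.injective reflect_reflect

theorem sum_reflect {n : ℕ} (l : Fin (n + 1) → ℝ) : ∑ i, reflect l i = n + 1 - ∑ i, l i := by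
  unfold reflect
  have h : ∑ i : Fin (n + 1), l i.rev = ∑ i, l i := Equiv.sum_comp Fin.revPerm l
  rw [Finset.sum_sub_distrib, h]
  simp

theorem lowerTail_eq {n : ℕ} (i : Fin (n + 1)) (p : ℝ) :
    lowerTail n i p = upperTail n i.rev (1 - p) := by
  unfold lowerTail upperTail
  refine Finset.sum_equiv Fin.revPerm (fun x => by simp) fun x _ => ?_
  have hx : (x : ℕ) ≤ n := by omega
  unfold binomialProb
  rw [Fin.revPerm_apply, Fin.val_rev, show n + 1 - ((x : ℕ) + 1) = n - x by omega,
    Nat.choose_symm hx, Nat.sub_sub_self hx, sub_sub_cancel]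
  ring

theorem average_lowerTail {n : ℕ} (l : Fin (n + 1) → ℝ) (i : Fin n) :
    average (lowerTail n i.castSucc) (l i.castSucc) (l i.succ) =
      average (upperTail n i.rev.succ) (reflect l i.rev.castSucc) (reflect l i.rev.succ) := by
  unfold average reflect
  rw [Fin.rev_castSucc, Fin.rev_succ, Fin.rev_rev]
  congr 1
  · ring
  · rw [← intervalIntegral.integral_comp_sub_left]
    exact intervalIntegral.integral_congr fun p _ => by
      rw [lowerTail_eq, Fin.rev_castSucc]

theorem isLowerOLC_iff {n : ℕ} {α : ℝ} {l : Fin (n + 1) → ℝ} :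
    IsLowerOLC n α l ↔ IsUpperOLC n α (reflect l) := by
  have e1 : reflect l (Fin.last n) = 1 - l 0 := by simp [reflect]
  have e2 : ∀ i : Fin n, reflect l i.castSucc = 1 - l i.rev.succ := fun i => by
    rw [reflect, Fin.rev_castSucc]
  have e3 : ∀ i : Fin n, reflect l i.succ = 1 - l i.rev.castSucc := fun i => by
    rw [reflect, Fin.rev_succ]
  constructor
  · intro h
    refine ⟨by rw [e1, h.zero_eq, sub_zero], fun i => ?_, fun i => ?_, fun i => ?_⟩
    · rw [e2]; linarith [h.lt_one i.rev]
    · rw [e2, e3]; linarith [h.lt_succ i.rev]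
    · have := h.average_eq i.rev
      rwa [average_lowerTail, Fin.rev_rev] at this
  · intro h
    refine ⟨by linarith [h.last_eq], fun i => ?_, fun i => ?_, fun i => ?_⟩
    · have := h.lt_succ i.rev
      rw [e2, e3, Fin.rev_rev] at this
      linarith
    · have := h.zero_lt i.rev
      rw [e2, Fin.rev_rev] at this
      linarith
    · rw [average_lowerTail]; exact h.average_eq i.rev

theorem isLowerLCC_iff {n : ℕ} {α : ℝ} {l : Fin (n + 1) → ℝ} :
    IsLowerLCC n α l ↔ IsUpperLCC n α (reflect l) := by
  have e1 : reflect l (Fin.last n) = 1 - l 0 := by simp [reflect]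
  have e2 : reflect l 0 = 1 - l (Fin.last n) := by simp [reflect]
  have e3 : StrictMono l ↔ StrictMono (reflect l) := by
    constructor
    · intro h i j hij
      unfold reflect
      linarith [h (Fin.rev_lt_rev.2 hij)]
    · intro h i j hij
      have := h (Fin.rev_lt_rev.2 hij)
      unfold reflect at this
      rw [Fin.rev_rev, Fin.rev_rev] at this
      linarith
  constructor
  · intro h
    refine ⟨by linarith [h.last_lt], e3.1 h.strictMono, by linarith [h.zero_eq], fun i => ?_⟩
    have := h.average_ge i.rev
    rw [average_lowerCoverage h.strictMono, average_lowerTail, Fin.rev_rev] at this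
    rwa [average_upperCoverage (e3.1 h.strictMono)]
  · intro h
    refine ⟨by linarith [h.last_eq], e3.2 h.strictMono, by linarith [h.zero_lt], fun i => ?_⟩
    have := h.average_ge i.rev
    rw [average_upperCoverage h.strictMono] at this
    rwa [average_lowerCoverage (e3.2 h.strictMono), average_lowerTail]

theorem IsLowerOLC.isLowerLCC {n : ℕ} {α : ℝ} {l : Fin (n + 1) → ℝ} (h : IsLowerOLC n α l) :
    IsLowerLCC n α l :=
  isLowerLCC_iff.2 (isLowerOLC_iff.1 h).isUpperLCC

theorem existsUnique_isLowerOLC {n : ℕ} (hn : n ≤ 200) {α : ℝ} (hα : 0 < α) (hα' : α < 27 / 100) :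
    ∃! l : Fin (n + 1) → ℝ, IsLowerOLC n α l := by
  obtain ⟨u, hu, huniq⟩ := existsUnique_isUpperOLC hn hα hα'
  refine ⟨reflect u, isLowerOLC_iff.2 (by rwa [reflect_reflect]), fun l hl => ?_⟩
  rw [← huniq _ (isLowerOLC_iff.1 hl), reflect_reflect]

theorem IsLowerOLC.sum_lt {n : ℕ} (hn : n ≤ 200) {α : ℝ} (hα : α < 27 / 100)
    {l m : Fin (n + 1) → ℝ} (hl : IsLowerOLC n α l) (hm : IsLowerLCC n α m) (h : m ≠ l) :
    ∑ i, m i < ∑ i, l i := by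
  have := (isLowerOLC_iff.1 hl).sum_lt hn hα (isLowerLCC_iff.1 hm) (reflect_injective.ne h)
  rw [sum_reflect, sum_reflect] at this
  linarith

end BinomialInterval

theorem proposition2 (n : ℕ) (hn₁ : 1 ≤ n) (hn₂ : n ≤ 200) (α : ℝ)
    (hα₁ : 0.0001 < α) (hα₂ : α < 0.27) :
    (∃! u : Fin (n + 1) → ℝ, BinomialInterval.IsUpperOLC n α u) ∧
    (∃! l : Fin (n + 1) → ℝ, BinomialInterval.IsLowerOLC n α l) ∧
    ∀ u l : Fin (n + 1) → ℝ,
      BinomialInterval.IsUpperOLC n α u → BinomialInterval.IsLowerOLC n α l →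
      -- (i) one-tail intervals with confidence level `1 - α`
      ((BinomialInterval.IsUpperLCC n α u ∧
          ∀ v : Fin (n + 1) → ℝ, BinomialInterval.IsUpperLCC n α v → v ≠ u →
            BinomialInterval.upperAEL n u < BinomialInterval.upperAEL n v) ∧
        (BinomialInterval.IsLowerLCC n α l ∧
          ∀ m : Fin (n + 1) → ℝ, BinomialInterval.IsLowerLCC n α m → m ≠ l →
            BinomialInterval.lowerAEL n l < BinomialInterval.lowerAEL n m)) ∧
      -- (ii) equal-tail intervals with confidence level `1 - 2 * α`
      (BinomialInterval.IsEqualTailLCC n α l u ∧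
        ∀ m v : Fin (n + 1) → ℝ, BinomialInterval.IsEqualTailLCC n α m v → (m, v) ≠ (l, u) →
          BinomialInterval.averageExpectedLength n l u <
            BinomialInterval.averageExpectedLength n m v) := by
  have h0 : 0 < α := lt_trans (by norm_num) hα₁
  have h1 : α < 27 / 100 := lt_of_lt_of_eq hα₂ (by norm_num)
  have hn : (0 : ℝ) < (n : ℝ) + 1 := by positivity
  refine ⟨BinomialInterval.existsUnique_isUpperOLC hn₂ h0 h1,
    BinomialInterval.existsUnique_isLowerOLC hn₂ h0 h1, fun u l hu hl => ⟨⟨⟨hu.isUpperLCC,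
      fun v hv hne => ?_⟩, hl.isLowerLCC, fun m hm hne => ?_⟩, ⟨hl.isLowerLCC, hu.isUpperLCC⟩,
      fun m v h hne => ?_⟩⟩
  · unfold BinomialInterval.upperAEL
    rw [BinomialInterval.averageExpectedLength_eq, BinomialInterval.averageExpectedLength_eq]
    exact div_lt_div_of_pos_right (by linarith [hu.sum_lt hn₂ h1 hv hne]) hn
  · unfold BinomialInterval.lowerAEL
    rw [BinomialInterval.averageExpectedLength_eq, BinomialInterval.averageExpectedLength_eq]
    exact div_lt_div_of_pos_right (by linarith [hl.sum_lt hn₂ h1 hm hne]) hn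
  · rw [BinomialInterval.averageExpectedLength_eq, BinomialInterval.averageExpectedLength_eq]
    refine div_lt_div_of_pos_right ?_ hn
    by_cases hm : m = l
    · have hv : v ≠ u := fun hv => hne (by rw [hm, hv])
      rw [hm]
      linarith [hu.sum_lt hn₂ h1 h.upper hv]
    · have h2 := hl.sum_lt hn₂ h1 h.lower hm
      by_cases hv : v = u
      · rw [hv]; linarith
      · linarith [hu.sum_lt hn₂ h1 h.upper hv]
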